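/- Let $\mathbb K$ be a field of characteristic $0$. Write $\mathbf{DG}$, $\mathbf{DGLA}$ and $\mathbf L_\infty$ for the categories of ($\mathbb Z$-graded) differential graded vector spaces, differential graded Lie algebras and $L_\infty$-algebras over $\mathbb K$ (morphisms in $\mathbf L_\infty$ are $L_\infty$-morphisms $f=(f_n)_{n\ge1}$, and $f$ is called linear if $f_n=0$ for $n\ge 2$), and $\mathbf{DGLA}^{\mathbf 2}$ for the category of morphisms $\chi\colon L\to M$ in $\mathbf{DGLA}$, with commutative squares as morphisms. Consider the four functors: the Quillen construction $\mathbf{DGLA}\to\mathbf L_\infty$, sending $L$ to the $L_\infty$-algebra on $L$ with $q_1(x)=-dx$, $q_2(x\odot y)=(-1)^{\deg x}[x,y]$, $q_n=0$ for $n\ge3$; the functor $\mathbf L_\infty\to\mathbf{DG}$ forgetting the higher brackets, sending $(V,q_1,q_2,\dots)$ to $(V,-q_1)$ and $f$ to $f_1$; the functor $\mathbf{DGLA}\to\mathbf{DGLA}^{\mathbf 2}$, $L\mapsto\{L\to0\}$; and the suspended mapping cone $\mathbf{DGLA}^{\mathbf 2}\to\mathbf{DG}$, $\chi\mapsto(C_\chi,\delta)$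 with $C^i_\chi=L^i\oplus M^{i-1}$ and $\delta(l,m)=(dl,\chi(l)-dm)$. There exists a functor $\widetilde C\colon\mathbf{DGLA}^{\mathbf 2}\to\mathbf L_\infty$ making the diagram $$\begin{array}{ccc}\mathbf{DGLA}&\longrightarrow&\mathbf L_\infty\\ \downarrow&\nearrow&\downarrow\\ \mathbf{DGLA}^{\mathbf 2}&\longrightarrow&\mathbf{DG}\end{array}$$ commutative (under the canonical identification $C_{L\to 0}=L\oplus 0\cong L$): there are natural isomorphisms $\alpha_L\colon\widetilde C(L\to0)\cong L$ in $\mathbf L_\infty$, where $L$ is regarded as an $L_\infty$-algebra through the Quillen construction, and $\beta_\chi\colon(\widetilde C(\chi),-q_1)\cong(C_\chi,\delta)$ in $\mathbf{DG}$, such that each $\alpha_L$ is linear and its linear part is the composite of $\beta_{L\to 0}$ with $C_{L\to0}\cong L$. Moreover, if $\mathcal F\colon\mathbf{DGLA}^{\mathbf 2}\to\mathbf L_\infty$ is any functor for which both triangles commute, even only up to some natural isomorphisms, then for every morphism $\chi$ of differential graded Lie algebras the $L_\infty$-algebra $\mathcal F(\chi)$ is isomorphic to $\widetilde C(\chi)$.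 -/

import Mathlib

open CategoryTheory TensorProduct DirectSum

universe u v

set_option linter.unusedSectionVars false

noncomputable section

namespace LInf

variable {K : Type*} [Field K]

section Graded

variable {V : Type*} [AddCommGroup V] [Module K V] (gr : ℤ → Submodule K V)
variable {M : Type*} [AddCommMonoid M] [Module K M]

/-- The linear map out of a graded space `V = ⨁ V^i` given by a linear map on each `V^i`. -/
def glift [Decomposition gr] (φ : ∀ i, gr i →ₗ[K] M) : V →ₗ[K] M :=
  DirectSum.toModule K ℤ M φ ∘ₗ (decomposeLinearEquiv gr).toLinearMap

variable {gr} in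
theorem glift_of_mem [Decomposition gr] (φ : ∀ i, gr i →ₗ[K] M) {i : ℤ} {v : V} (hv : v ∈ gr i) :
    glift gr φ v = φ i ⟨v, hv⟩ := by
  simp only [glift, LinearMap.comp_apply, LinearEquiv.coe_coe, decomposeLinearEquiv_apply,
    decompose_of_mem gr hv]
  exact DirectSum.toModule_lof K i _

variable {gr} in
theorem ghom_ext [Decomposition gr] {f g : V →ₗ[K] M} (h : ∀ i, ∀ v ∈ gr i, f v = g v) :
    f = g := by
  ext v
  induction v using Decomposition.inductionOn gr with
  | zero => simp
  | homogeneous m => exact h _ _ m.2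
  | add a b ha hb => simp [ha, hb]

/-- The shift `V[n]`: the same space, with `(V[n])^i = V^(i+n)`. -/
def shift (n : ℤ) : ℤ → Submodule K V := fun i => gr (i + n)

theorem mem_shift {n i : ℤ} {v : V} : v ∈ shift gr n i ↔ v ∈ gr (i + n) := Iff.rfl

/-- A decomposition from a linear map to the direct sum that is a section on each piece. -/
@[reducible]
def decompositionOfLift (φ : V →ₗ[K] ⨁ i, gr i)
    (h₁ : ∀ v, DirectSum.coeLinearMap gr (φ v) = v)
    (h₂ : ∀ i v (hv : v ∈ gr i), φ v = DirectSum.lof K ℤ (fun i => gr i) i ⟨v, hv⟩) :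
    Decomposition gr :=
  Decomposition.ofLinearMap gr φ (LinearMap.ext h₁) (by
    ext i ⟨v, hv⟩ : 2
    simp only [LinearMap.comp_apply, DirectSum.coeLinearMap_lof, LinearMap.id_comp]
    exact h₂ i v hv)

theorem lof_eq {i j : ℤ} (h : i = j) {v : V} (hi : v ∈ gr i) (hj : v ∈ gr j) :
    DirectSum.lof K ℤ (fun i => gr i) i ⟨v, hi⟩ = DirectSum.lof K ℤ (fun i => gr i) j ⟨v, hj⟩ := by
  subst h; rfl

instance [Decomposition gr] (n : ℤ) : Decomposition (shift gr n) :=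
  decompositionOfLift (shift gr n)
    (glift gr fun i => DirectSum.lof K ℤ (fun j => shift gr n j) (i - n) ∘ₗ
      Submodule.inclusion (by simp [shift]))
    (LinearMap.congr_fun (f := DirectSum.coeLinearMap (shift gr n) ∘ₗ _) (g := LinearMap.id)
      (ghom_ext (gr := gr) fun i v hv => by
        simp [glift_of_mem _ hv, Submodule.coe_inclusion]))
    (fun i v hv => by
      rw [glift_of_mem _ (i := i + n) hv]
      exact lof_eq (shift gr n) (by ring) _ _)

end Graded

section Sym

variable {V : Type*} [AddCommGroup V] [Module K V] (gr : ℤ → Submodule K V)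

/-- The Koszul relations `x ⊙ y = (-1)^(ij) y ⊙ x` for `x ∈ V^i`, `y ∈ V^j`. -/
inductive GSym.Rel : TensorAlgebra K V → TensorAlgebra K V → Prop
  | comm (i j : ℤ) (x y : V) (hx : x ∈ gr i) (hy : y ∈ gr j) :
      GSym.Rel (TensorAlgebra.ι K x * TensorAlgebra.ι K y)
        ((-1 : K) ^ (i * j) • (TensorAlgebra.ι K y * TensorAlgebra.ι K x))

/-- The graded symmetric algebra `⨁_{n ≥ 0} ⊙^n V` of the graded space `V`. -/
def GSym : Type _ := RingQuot (GSym.Rel gr)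

namespace GSym

instance : Ring (GSym gr) := inferInstanceAs (Ring (RingQuot (GSym.Rel gr)))
instance : Algebra K (GSym gr) := inferInstanceAs (Algebra K (RingQuot (GSym.Rel gr)))

/-- The quotient map from the tensor algebra. -/
def mk : TensorAlgebra K V →ₐ[K] GSym gr := RingQuot.mkAlgHom K (GSym.Rel gr)

/-- The inclusion `V = ⊙^1 V ⊆ ⨁ ⊙^n V`. -/
def ι : V →ₗ[K] GSym gr := (mk gr).toLinearMap ∘ₗ TensorAlgebra.ι K

variable {gr}

theorem ι_comm {i j : ℤ} {x y : V} (hx : x ∈ gr i) (hy : y ∈ gr j) :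
    ι gr x * ι gr y = (-1 : K) ^ (i * j) • (ι gr y * ι gr x) := by
  have : mk gr _ = mk gr _ := RingQuot.mkAlgHom_rel K (GSym.Rel.comm i j x y hx hy)
  rw [map_mul, map_smul, map_mul] at this
  exact this

section lift
variable {A : Type*} [Ring A] [Algebra K A]

/-- The universal property of the graded symmetric algebra. -/
def lift (φ : V →ₗ[K] A) (h : ∀ i j x y, x ∈ gr i → y ∈ gr j →
    φ x * φ y = (-1 : K) ^ (i * j) • (φ y * φ x)) : GSym gr →ₐ[K] A :=
  RingQuot.liftAlgHom K ⟨TensorAlgebra.lift K φ, by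
    rintro _ _ ⟨i, j, x, y, hx, hy⟩
    simpa using h i j x y hx hy⟩

@[simp] theorem lift_ι (φ : V →ₗ[K] A) (h) (v : V) : lift (gr := gr) φ h (ι gr v) = φ v := by
  have := RingQuot.liftAlgHom_mkAlgHom_apply K (TensorAlgebra.lift K φ) (s := GSym.Rel gr)
    (by rintro _ _ ⟨i, j, x, y, hx, hy⟩
        simpa using h i j x y hx hy) (TensorAlgebra.ι K v)
  rw [TensorAlgebra.lift_ι_apply] at this
  exact this

end lift

/-- The counit, vanishing on `V`. -/
def counit : GSym gr →ₐ[K] K := lift 0 (by simp)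

@[simp] theorem counit_ι (v : V) : counit (ι gr v) = 0 := by simp [counit]

section
variable [Decomposition gr]

theorem induction {p : GSym gr → Prop} (one : p 1)
    (add : ∀ x y, p x → p y → p (x + y)) (smul : ∀ (c : K) x, p x → p (c • x))
    (mul : ∀ i, ∀ v ∈ gr i, ∀ x, p x → p (ι gr v * x)) (x : GSym gr) : p x := by
  have zero : p 0 := by simpa using smul 0 1 one
  have mul' : ∀ v x, p x → p (ι gr v * x) := by
    intro v x hx
    induction v using Decomposition.inductionOn gr with
    | zero => simpa using zero
    | homogeneous m => exact mul _ _ m.2 _ hx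
    | add a b ha hb => rw [map_add, add_mul]; exact add _ _ ha hb
  suffices h : ∀ x y : GSym gr, p y → p (x * y) by simpa using h x 1 one
  intro x
  obtain ⟨x, rfl⟩ : ∃ y, mk gr y = x := RingQuot.mkAlgHom_surjective K (GSym.Rel gr) x
  induction x using TensorAlgebra.induction with
  | algebraMap r =>
    intro y hy
    rw [AlgHom.commutes, ← Algebra.smul_def]
    exact smul _ _ hy
  | ι v => exact fun y hy => mul' v y hy
  | mul a b ha hb =>
    intro y hy
    rw [map_mul, mul_assoc]
    exact ha _ (hb _ hy)
  | add a b ha hb =>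
    intro y hy
    rw [map_add, add_mul]
    exact add _ _ (ha _ hy) (hb _ hy)

theorem hom_ext {M : Type*} [AddCommGroup M] [Module K M] {f g : GSym gr →ₗ[K] M}
    (one : f 1 = g 1)
    (mul : ∀ i, ∀ v ∈ gr i, ∀ x, f x = g x → f (ι gr v * x) = g (ι gr v * x)) : f = g := by
  ext x
  induction x using GSym.induction with
  | one => exact one
  | add x y hx hy => simp [hx, hy]
  | smul c x hx => simp [hx]
  | mul i v hv x hx => exact mul i v hv x hx

/-- The algebra automorphism `a ↦ (-1)^(n |a|) a`. -/
def sgn (n : ℤ) : GSym gr →ₐ[K] GSym gr :=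
  lift (glift gr fun j => (-1 : K) ^ (n * j) • (ι gr ∘ₗ (gr j).subtype)) (by
    intro i j x y hx hy
    simp only [glift_of_mem _ hx, glift_of_mem _ hy, LinearMap.smul_apply, LinearMap.comp_apply,
      Submodule.subtype_apply, smul_mul_smul_comm, ι_comm hx hy, smul_smul]
    congr 1; ring)

theorem sgn_ι (n : ℤ) {j : ℤ} {v : V} (hv : v ∈ gr j) :
    sgn (gr := gr) n (ι gr v) = (-1 : K) ^ (n * j) • ι gr v := by
  simp [sgn, glift_of_mem _ hv]

theorem sgn_comm (m n : ℤ) (x : GSym gr) : sgn m (sgn n x) = sgn n (sgn m x) := by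
  induction x using GSym.induction with
  | one => simp
  | add x y hx hy => simp [hx, hy]
  | smul c x hx => simp [hx]
  | mul i v hv x hx => simp [sgn_ι _ hv, hx, smul_smul, mul_comm]

/-- Left multiplication by `v ⊗ 1 + 1 ⊗ v` on `S ⊗ S`, with the Koszul rule
`(1 ⊗ v) (a ⊗ b) = (-1)^(|v| |a|) a ⊗ v b`. -/
def coact : V →ₗ[K] Module.End K (GSym gr ⊗[K] GSym gr) :=
  glift gr fun i =>
    (TensorProduct.mapBilinear (RingHom.id K) (GSym gr) (GSym gr) (GSym gr) (GSym gr)).flip LinearMap.id ∘ₗ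
        LinearMap.mul K (GSym gr) ∘ₗ ι gr ∘ₗ (gr i).subtype +
      TensorProduct.mapBilinear (RingHom.id K) (GSym gr) (GSym gr) (GSym gr) (GSym gr) (sgn i).toLinearMap ∘ₗ
        LinearMap.mul K (GSym gr) ∘ₗ ι gr ∘ₗ (gr i).subtype

theorem coact_tmul {i : ℤ} {v : V} (hv : v ∈ gr i) (a b : GSym gr) :
    coact (gr := gr) v (a ⊗ₜ b) = (ι gr v * a) ⊗ₜ b + sgn i a ⊗ₜ (ι gr v * b) := by
  simp [coact, glift_of_mem _ hv]

theorem coact_comm {i j : ℤ} {x y : V} (hx : x ∈ gr i) (hy : y ∈ gr j) :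
    coact (gr := gr) x * coact y = (-1 : K) ^ (i * j) • (coact y * coact x) := by
  refine TensorProduct.ext' fun a b => ?_
  have h : ∀ a, ι gr x * (ι gr y * a) = (-1 : K) ^ (i * j) • (ι gr y * (ι gr x * a)) := by
    intro a
    rw [← mul_assoc, ι_comm hx hy, smul_mul_assoc, mul_assoc]
  have e : (-1 : K) ^ (i * j) * (-1 : K) ^ (j * i) = 1 := by
    rw [mul_comm j i, ← mul_zpow]; simp
  simp only [Module.End.mul_apply, coact_tmul hx, coact_tmul hy, map_add,
    LinearMap.smul_apply, map_mul, sgn_ι _ hx, sgn_ι _ hy, smul_mul_assoc, smul_add,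
    TensorProduct.smul_tmul', TensorProduct.tmul_smul, h, sgn_comm i j, smul_smul, e, one_smul]
  abel

/-- The comultiplication: `Δ 1 = 1 ⊗ 1` and `Δ (v x) = (v ⊗ 1 + 1 ⊗ v) Δ x`. -/
def comul : GSym gr →ₗ[K] GSym gr ⊗[K] GSym gr :=
  (LinearMap.applyₗ (1 ⊗ₜ 1 : GSym gr ⊗[K] GSym gr)) ∘ₗ
    (lift (gr := gr) coact fun _ _ _ _ hx hy => coact_comm hx hy).toLinearMap

@[simp] theorem comul_one : comul (1 : GSym gr) = 1 ⊗ₜ 1 := by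
  simp [comul]

theorem comul_ι_mul (v : V) (x : GSym gr) : comul (ι gr v * x) = coact v (comul x) := by
  simp [comul]

theorem comul_ι (v : V) : comul (ι gr v) = ι gr v ⊗ₜ 1 + 1 ⊗ₜ ι gr v := by
  suffices h : (comul ∘ₗ ι gr : V →ₗ[K] _) = (TensorProduct.mk K (GSym gr) (GSym gr)).flip 1 ∘ₗ ι gr +
      TensorProduct.mk K _ _ 1 ∘ₗ ι gr from LinearMap.congr_fun h v
  refine ghom_ext (gr := gr) fun i v hv => ?_
  have := comul_ι_mul v (1 : GSym gr)
  rw [mul_one, comul_one, coact_tmul hv] at this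
  simp [this]

theorem counit_sgn (n : ℤ) (x : GSym gr) : counit (sgn n x) = counit x := by
  induction x using GSym.induction with
  | one => simp
  | add x y hx hy => simp [hx, hy]
  | smul c x hx => simp [hx]
  | mul i v hv x hx => simp [sgn_ι _ hv]

theorem comul_sgn (n : ℤ) (x : GSym gr) : comul (sgn n x) =
    TensorProduct.map (sgn n).toLinearMap (sgn n).toLinearMap (comul x) := by
  induction x using GSym.induction with
  | one => simp
  | add x y hx hy => simp [hx, hy]
  | smul c x hx => simp [hx]
  | mul i v hv x hx =>
    rw [map_mul, sgn_ι _ hv, smul_mul_assoc, map_smul, comul_ι_mul, comul_ι_mul, hx]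
    generalize comul x = z
    induction z with
    | zero => simp
    | add x y hx hy => simp_all
    | tmul a b =>
      simp only [coact_tmul hv, map_add, TensorProduct.map_tmul, AlgHom.toLinearMap_apply, map_mul,
        sgn_ι _ hv, smul_mul_assoc, TensorProduct.smul_tmul', TensorProduct.tmul_smul, smul_add,
        sgn_comm n i]

theorem coassoc_aux {i : ℤ} {v : V} (hv : v ∈ gr i) (z : GSym gr ⊗[K] GSym gr) :
    TensorProduct.assoc K (GSym gr) (GSym gr) (GSym gr) (comul.rTensor _ (coact v z)) =
      (LinearMap.mulLeft K (ι gr v)).rTensor (GSym gr ⊗[K] GSym gr)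
          (TensorProduct.assoc K (GSym gr) (GSym gr) (GSym gr) (comul.rTensor _ z)) +
        TensorProduct.map (sgn i).toLinearMap (coact v)
          (TensorProduct.assoc K (GSym gr) (GSym gr) (GSym gr) (comul.rTensor _ z)) := by
  induction z with
  | zero => simp
  | add x y hx hy => simp only [map_add, hx, hy]; abel
  | tmul a b =>
    simp only [coact_tmul hv, map_add, LinearMap.rTensor_tmul, comul_ι_mul, comul_sgn]
    generalize comul a = z
    induction z with
    | zero => simp
    | add x y hx hy =>
      simp only [map_add, TensorProduct.add_tmul] at hx hy ⊢
      rw [add_add_add_comm, hx, hy]; abel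
    | tmul c d =>
      simp [coact_tmul hv, TensorProduct.add_tmul, TensorProduct.tmul_add, add_assoc]

instance : Coalgebra K (GSym gr) where
  comul := comul
  counit := counit.toLinearMap
  coassoc := by
    refine hom_ext ?_ ?_
    · simp
    · intro i v hv x hx
      simp only [LinearMap.comp_apply, LinearEquiv.coe_coe, comul_ι_mul] at hx ⊢
      rw [coassoc_aux hv, hx]
      generalize comul x = z
      induction z with
      | zero => simp
      | add x y hx hy => simp only [map_add, ← hx, ← hy]; abel
      | tmul a b =>
        simp [coact_tmul hv, comul_ι_mul]
  rTensor_counit_comp_comul := by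
    refine hom_ext ?_ ?_
    · simp
    · intro i v hv x hx
      simp only [LinearMap.comp_apply, comul_ι_mul] at hx ⊢
      have : ∀ z : GSym gr ⊗[K] GSym gr, counit.toLinearMap.rTensor _ (coact v z) =
          (LinearMap.mulLeft K (ι gr v)).lTensor K (counit.toLinearMap.rTensor (GSym gr) z) := by
        intro z
        induction z with
        | zero => simp
        | add x y hx hy => simp only [map_add, hx, hy]
        | tmul a b => simp [coact_tmul hv, counit_sgn]
      rw [this, hx]
      simp
  lTensor_counit_comp_comul := by
    refine hom_ext ?_ ?_
    · simp
    · intro i v hv x hx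
      simp only [LinearMap.comp_apply, comul_ι_mul] at hx ⊢
      have : ∀ z : GSym gr ⊗[K] GSym gr, counit.toLinearMap.lTensor _ (coact v z) =
          (LinearMap.mulLeft K (ι gr v)).rTensor K (counit.toLinearMap.lTensor _ z) := by
        intro z
        induction z with
        | zero => simp
        | add x y hx hy => simp only [map_add, hx, hy]
        | tmul a b => simp [coact_tmul hv]
      rw [this, hx]
      simp

end

/-- The span of the products `v₁ ⊙ ⋯ ⊙ vₖ` of homogeneous elements of total degree `n`. -/
def degree (gr : ℤ → Submodule K V) (n : ℤ) : Submodule K (GSym gr) :=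
  Submodule.span K {x | ∃ l : List (Σ i : ℤ, gr i),
    (l.map Sigma.fst).sum = n ∧ x = (l.map fun p => ι gr (p.2 : V)).prod}

theorem one_mem_degree : (1 : GSym gr) ∈ degree gr 0 :=
  Submodule.subset_span ⟨[], by simp, by simp⟩

theorem ι_mul_mem_degree {i n m : ℤ} {v : V} (hv : v ∈ gr i) {x : GSym gr}
    (hx : x ∈ degree gr n) (h : i + n = m) : ι gr v * x ∈ degree gr m := by
  subst h
  induction hx using Submodule.span_induction with
  | zero => simp
  | add x y _ _ hx hy => rw [mul_add]; exact add_mem hx hy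
  | smul c x _ hx => rw [mul_smul_comm]; exact Submodule.smul_mem _ _ hx
  | mem x hx =>
    obtain ⟨l, rfl, rfl⟩ := hx
    exact Submodule.subset_span ⟨⟨i, v, hv⟩ :: l, by simp, by simp⟩

theorem ι_mem_degree {i : ℤ} {v : V} (hv : v ∈ gr i) : ι gr v ∈ degree gr i := by
  simpa using ι_mul_mem_degree hv one_mem_degree (add_zero i)

theorem degree_induction {p : ∀ (n : ℤ) (x : GSym gr), x ∈ degree gr n → Prop}
    (one : p 0 1 one_mem_degree) (zero : ∀ n, p n 0 (zero_mem _))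
    (add : ∀ n x y hx hy, p n x hx → p n y hy → p n (x + y) (add_mem hx hy))
    (smul : ∀ n (c : K) x hx, p n x hx → p n (c • x) (Submodule.smul_mem _ c hx))
    (mul : ∀ i n v (hv : v ∈ gr i) x (hx : x ∈ degree gr n), p n x hx →
      p (i + n) (ι gr v * x) (ι_mul_mem_degree hv hx rfl))
    {n : ℤ} {x : GSym gr} (hx : x ∈ degree gr n) : p n x hx := by
  induction hx using Submodule.span_induction with
  | zero => exact zero n
  | add x y _ _ hx hy => exact add n _ _ _ _ hx hy
  | smul c x _ hx => exact smul n _ _ _ hx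
  | mem x hx =>
    obtain ⟨l, rfl, rfl⟩ := hx
    induction l with
    | nil => simpa using one
    | cons a l ih =>
      have := mul a.1 _ _ a.2.2 _ (Submodule.subset_span ⟨l, rfl, rfl⟩) ih
      simpa using this

theorem hom_ext_degree [Decomposition gr] {M : Type*} [AddCommGroup M] [Module K M]
    {f g : GSym gr →ₗ[K] M} (h : ∀ n, ∀ x ∈ degree gr n, f x = g x) : f = g := by
  have key : ∀ x : GSym gr, x ∈ ⨆ n, degree gr n := by
    intro x
    induction x using GSym.induction with
    | one => exact Submodule.mem_iSup_of_mem 0 one_mem_degree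
    | add x y hx hy => exact add_mem hx hy
    | smul c x hx => exact Submodule.smul_mem _ _ hx
    | mul i v hv x hx =>
      induction hx using Submodule.iSup_induction' with
      | mem n x hx => exact Submodule.mem_iSup_of_mem (i + n) (ι_mul_mem_degree hv hx rfl)
      | zero => simp
      | add x y _ _ hx hy => rw [mul_add]; exact add_mem hx hy
  ext x
  induction key x using Submodule.iSup_induction' with
  | mem n x hx => exact h n x hx
  | zero => simp
  | add x y _ _ hx hy => simp [hx, hy]

theorem sgn_of_mem [Decomposition gr] (m : ℤ) {n : ℤ} {x : GSym gr} (hx : x ∈ degree gr n) :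
    sgn m x = (-1 : K) ^ (m * n) • x := by
  induction hx using degree_induction with
  | one => simp
  | zero n => simp
  | add n x y _ _ hx hy => simp [hx, hy]
  | smul n c x _ hx => simp [hx, smul_smul, mul_comm]
  | mul i n v hv x _ hx =>
    rw [map_mul, hx, sgn_ι _ hv, smul_mul_smul_comm, mul_add,
      zpow_add₀ (neg_ne_zero.2 one_ne_zero)]

section proj

/-- The operator `(c, w, z) ↦ (0, c v, b (v, w))`. -/
def quadOp {M : Type*} [AddCommGroup M] [Module K M] (b : V →ₗ[K] V →ₗ[K] M) :
    V →ₗ[K] Module.End K (K × V × M) :=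
  LinearMap.mk₂ K (fun v p => (0, p.1 • v, b v p.2.1))
    (by intros; ext <;> simp) (by intros; ext <;> simp [smul_smul, mul_comm])
    (by intros; ext <;> simp [add_smul]) (by intros; ext <;> simp [mul_smul])

@[simp] theorem quadOp_apply {M : Type*} [AddCommGroup M] [Module K M] (b : V →ₗ[K] V →ₗ[K] M)
    (v : V) (p : K × V × M) : quadOp b v p = (0, p.1 • v, b v p.2.1) := rfl

variable {M : Type*} [AddCommGroup M] [Module K M] (b : V →ₗ[K] V →ₗ[K] M)
  (hb : ∀ i j x y, x ∈ gr i → y ∈ gr j → b x y = (-1 : K) ^ (i * j) • b y x)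

/-- Auxiliary: `x ↦ (x₀, x₁, b(x₂))`, where `x_n` is the component of `x` in `⊙^n V`. -/
def quadAux : GSym gr →ₗ[K] K × V × M :=
  LinearMap.applyₗ ((1, 0, 0) : K × V × M) ∘ₗ (lift (gr := gr) (quadOp b) (by
    intro i j x y hx hy
    refine LinearMap.ext fun p => ?_
    ext <;> simp
    rw [hb i j x y hx hy, smul_comm])).toLinearMap

theorem quadAux_one : quadAux b hb 1 = (1, 0, 0) := by simp [quadAux]

theorem quadAux_ι_mul (v : V) (x : GSym gr) :
    quadAux b hb (ι gr v * x) = (0, (quadAux b hb x).1 • v, b v (quadAux b hb x).2.1) := by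
  simp [quadAux]

/-- The projection `⨁ ⊙^n V → ⊙^1 V = V`. -/
def proj : GSym gr →ₗ[K] V :=
  LinearMap.fst K V V ∘ₗ LinearMap.snd K K (V × V) ∘ₗ
    quadAux (M := V) (0 : V →ₗ[K] V →ₗ[K] V) (by simp)

/-- The map `⨁ ⊙^n V → M` which is the graded symmetric bilinear map `b` on `⊙^2 V`, and zero
on `⊙^n V` for `n ≠ 2`. -/
def quad : GSym gr →ₗ[K] M :=
  LinearMap.snd K V M ∘ₗ LinearMap.snd K K (V × M) ∘ₗ quadAux b hb

@[simp] theorem proj_one : proj (1 : GSym gr) = 0 := by simp [proj, quadAux_one]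
@[simp] theorem quad_one : quad b hb (1 : GSym gr) = 0 := by simp [quad, quadAux_one]

variable [Decomposition gr]

theorem quadAux_fst (x : GSym gr) : (quadAux b hb x).1 = counit x := by
  induction x using GSym.induction with
  | one => simp [quadAux_one]
  | add x y hx hy => simp [hx, hy]
  | smul c x hx => simp [hx]
  | mul i v hv x hx => simp [quadAux_ι_mul]

@[simp] theorem proj_ι_mul (v : V) (x : GSym gr) : proj (ι gr v * x) = counit x • v := by
  simp [proj, quadAux_ι_mul, quadAux_fst]

@[simp] theorem proj_ι (v : V) : proj (ι gr v) = v := by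
  simpa using proj_ι_mul v (1 : GSym gr)

theorem quadAux_snd (x : GSym gr) : (quadAux b hb x).2.1 = proj x := by
  induction x using GSym.induction with
  | one => simp [quadAux_one]
  | add x y hx hy => simp [hx, hy]
  | smul c x hx => simp [hx]
  | mul i v hv x hx => simp [quadAux_ι_mul, quadAux_fst]

@[simp] theorem quad_ι_mul (v : V) (x : GSym gr) : quad b hb (ι gr v * x) = b v (proj x) := by
  simp [quad, quadAux_ι_mul, quadAux_snd]

@[simp] theorem quad_ι (v : V) : quad b hb (ι gr v) = 0 := by
  simpa using quad_ι_mul b hb v (1 : GSym gr)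

theorem ι_injective : Function.Injective (ι gr) :=
  Function.LeftInverse.injective (g := proj) proj_ι

end proj

theorem counit_of_mem {n : ℤ} {x : GSym gr} (hx : x ∈ degree gr n) (hn : n ≠ 0) :
    counit x = 0 := by
  revert hn
  · induction hx using degree_induction with
    | one => simp
    | zero n => simp
    | add n x y _ _ hx hy => intro h; simp [hx h, hy h]
    | smul n c x _ hx => intro h; simp [hx h]
    | mul i n v hv x _ hx => simp

section conv
variable [Decomposition gr]

/-- A linear map `⨁ ⊙^n V → V` is of degree `e`. -/
def HasDegree (f : GSym gr →ₗ[K] V) (e : ℤ) : Prop :=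
  ∀ n, ∀ x ∈ degree gr n, f x ∈ gr (n + e)

theorem hasDegree_proj : HasDegree (proj (gr := gr)) 0 := by
  intro n x hx
  rw [add_zero]
  induction hx using degree_induction with
  | one => simp
  | zero n => simp
  | add n x y _ _ hx hy => rw [map_add]; exact add_mem hx hy
  | smul n c x _ hx => rw [map_smul]; exact Submodule.smul_mem _ _ hx
  | mul i n v hv x hx' hx =>
    rw [proj_ι_mul]
    by_cases h : n = 0
    · subst h; rw [add_zero]; exact Submodule.smul_mem _ _ hv
    · rw [counit_of_mem hx' h, zero_smul]; exact zero_mem _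

theorem HasDegree.comp_mulLeft {f : GSym gr →ₗ[K] V} {e i : ℤ} (hf : HasDegree f e) {v : V}
    (hv : v ∈ gr i) : HasDegree (f ∘ₗ LinearMap.mulLeft K (ι gr v)) (e + i) := by
  intro n x hx
  have := hf (i + n) _ (ι_mul_mem_degree hv hx rfl)
  rw [show n + (e + i) = i + n + e by ring]
  exact this

/-- The extension of a linear map `f` from `⨁ ⊙^n V` to `V` given on products by
`v₁ ⊙ ⋯ ⊙ vₙ ↦ ∑_k ∑_{σ ∈ S(k,n-k)} ε(σ) f(v_σ(1) ⊙ ⋯ ⊙ v_σ(k)) ⊙ v_σ(k+1) ⊙ ⋯ ⊙ v_σ(n)`,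
where `S(k,n-k)` are the unshuffles and `ε` is the Koszul sign; that is, `x ↦ ∑ f(x₁) ⊙ x₂`
with `Δ x = ∑ x₁ ⊗ x₂`. It is the coderivation with corestriction `f`. -/
def coder (f : GSym gr →ₗ[K] V) : GSym gr →ₗ[K] GSym gr :=
  LinearMap.mul' K (GSym gr) ∘ₗ TensorProduct.map (ι gr ∘ₗ f) LinearMap.id ∘ₗ comul

@[simp] theorem coder_one (f : GSym gr →ₗ[K] V) : coder f 1 = ι gr (f 1) := by
  simp [coder]

theorem coder_ι_mul {f : GSym gr →ₗ[K] V} {e : ℤ} (hf : HasDegree f e) {i : ℤ} {v : V}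
    (hv : v ∈ gr i) (x : GSym gr) : coder f (ι gr v * x) =
      coder (f ∘ₗ LinearMap.mulLeft K (ι gr v)) x + (-1 : K) ^ (i * e) • (ι gr v * coder f x) := by
  have key : LinearMap.mulRight K (ι gr v) ∘ₗ ι gr ∘ₗ f ∘ₗ (sgn i).toLinearMap =
      (-1 : K) ^ (i * e) • (LinearMap.mulLeft K (ι gr v) ∘ₗ ι gr ∘ₗ f) := by
    refine hom_ext_degree fun n x hx => ?_
    simp only [LinearMap.comp_apply, AlgHom.toLinearMap_apply, sgn_of_mem i hx, map_smul,
      LinearMap.mulRight_apply, LinearMap.smul_apply, LinearMap.mulLeft_apply]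
    rw [ι_comm hv (hf n x hx), smul_smul, mul_add, zpow_add₀ (neg_ne_zero.2 one_ne_zero),
      mul_left_comm, ← mul_zpow]
    simp
  simp only [coder, LinearMap.comp_apply, comul_ι_mul]
  generalize comul x = z
  induction z with
  | zero => simp
  | add x y hx hy => simp only [map_add, hx, hy, mul_add, smul_add]; abel
  | tmul a b =>
    have := LinearMap.congr_fun key a
    simp only [LinearMap.comp_apply, AlgHom.toLinearMap_apply, LinearMap.smul_apply,
      LinearMap.mulRight_apply, LinearMap.mulLeft_apply] at this
    simp only [coact_tmul hv, map_add, TensorProduct.map_tmul, LinearMap.comp_apply,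
      LinearMap.mul'_apply, LinearMap.id_apply, LinearMap.mulLeft_apply]
    rw [← mul_assoc (ι gr (f (sgn i a))), this, smul_mul_assoc, mul_assoc]

theorem coder_counit (u : V) (x : GSym gr) :
    coder (counit.toLinearMap.smulRight u) x = ι gr u * x := by
  have := Coalgebra.rTensor_counit_comul (R := K) x
  change counit.toLinearMap.rTensor _ (comul x) = _ at this
  have h2 : ∀ z : GSym gr ⊗[K] GSym gr, LinearMap.mul' K (GSym gr) (TensorProduct.map
      (ι gr ∘ₗ counit.toLinearMap.smulRight u) LinearMap.id z) =
      ι gr u * TensorProduct.lid K (GSym gr) (counit.toLinearMap.rTensor _ z) := by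
    intro z
    induction z with
    | zero => simp
    | add x y hx hy => simp only [map_add, hx, hy, mul_add]
    | tmul a b => simp
  simp only [coder, LinearMap.comp_apply]
  rw [h2, this]
  simp

theorem coder_ι {f : GSym gr →ₗ[K] V} (h1 : f 1 = 0) (v : V) :
    coder f (ι gr v) = ι gr (f (ι gr v)) := by
  simp [coder, comul_ι, h1]

/-- The primitive elements of `⨁ ⊙^n V` lie in `V`. -/
theorem eq_ι_of_primitive [CharZero K] {x : GSym gr} (h0 : counit x = 0)
    (h : comul x = x ⊗ₜ 1 + 1 ⊗ₜ x) : x = ι gr (proj x) := by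
  set N : Module.End K (GSym gr) := coder proj with hN
  have hmul : ∀ v x, N (ι gr v * x) = ι gr v * x + ι gr v * N x := by
    intro v x
    suffices e : (N ∘ₗ LinearMap.mulRight K x) ∘ₗ ι gr =
        (LinearMap.mulRight K x + LinearMap.mulRight K (N x)) ∘ₗ ι gr from
      LinearMap.congr_fun e v
    refine ghom_ext (gr := gr) fun i v hv => ?_
    have e : proj ∘ₗ LinearMap.mulLeft K (ι gr v) = counit.toLinearMap.smulRight v := by
      ext x; simp
    simp [hN, coder_ι_mul hasDegree_proj hv, e, coder_counit]
  have hι : ∀ v, N (ι gr v) = ι gr v := fun v => by simp [hN, coder_ι]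
  have hx : N x = ι gr (proj x) := by simp [hN, coder, h]
  set y := x - ι gr (proj x) with hy
  have hNy : N y = 0 := by rw [hy, map_sub, hx, hι, sub_self]
  have hU : y ∈ Submodule.span K {1} ⊔ ⨆ n : ℕ, N.eigenspace ((n : K) + 1) := by
    generalize y = y
    induction y using GSym.induction with
    | one => exact Submodule.mem_sup_left (Submodule.mem_span_singleton_self 1)
    | add x y hx hy => exact add_mem hx hy
    | smul c x hx => exact Submodule.smul_mem _ _ hx
    | mul i v hv x hx =>
      obtain ⟨a, ha, b, hb, rfl⟩ := Submodule.mem_sup.1 hx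
      obtain ⟨c, rfl⟩ := Submodule.mem_span_singleton.1 ha
      rw [mul_add, mul_smul_comm, mul_one]
      refine Submodule.mem_sup_right (add_mem (Submodule.smul_mem _ _ ?_) ?_)
      · exact Submodule.mem_iSup_of_mem 0 (by simp [hι])
      · clear hx
        induction hb using Submodule.iSup_induction' with
        | zero => simp
        | add x y _ _ hx hy => rw [mul_add]; exact add_mem hx hy
        | mem n x hx =>
          refine Submodule.mem_iSup_of_mem (n + 1) ?_
          rw [Module.End.mem_eigenspace_iff] at hx ⊢
          rw [hmul, hx, mul_smul_comm]
          push_cast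
          module
  obtain ⟨a, ha, b, hb, hab⟩ := Submodule.mem_sup.1 hU
  obtain ⟨c, rfl⟩ := Submodule.mem_span_singleton.1 ha
  have hN1 : N 1 = 0 := by simp [hN]
  have hb0 : b = 0 := by
    have h1 : b ∈ N.eigenspace 0 := by
      rw [Module.End.mem_eigenspace_iff, zero_smul, ← hNy, ← hab, map_add, map_smul, hN1,
        smul_zero, zero_add]
    have h2 : b ∈ ⨆ μ : K, ⨆ _ : μ ≠ 0, N.eigenspace μ := by
      refine (iSup_le fun n => ?_ : (⨆ n : ℕ, N.eigenspace ((n : K) + 1)) ≤ _) hb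
      exact le_iSup₂_of_le ((n : K) + 1) (Nat.cast_add_one_ne_zero n) le_rfl
    exact Submodule.disjoint_def.1 (N.eigenspaces_iSupIndep 0) b h1 h2
  have hc : c = 0 := by
    have : counit y = 0 := by rw [hy, map_sub, h0, counit_ι, sub_zero]
    rw [← hab, hb0] at this
    simpa using this
  rw [hb0, hc, zero_smul, zero_add] at hab
  exact sub_eq_zero.1 hab.symm

end conv

section map
variable {W : Type*} [AddCommGroup W] [Module K W] {gr' : ℤ → Submodule K W}

/-- The algebra homomorphism `⨁ ⊙^n V → ⨁ ⊙^n W` induced by a degree preserving `φ : V → W`. -/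
def map (φ : V →ₗ[K] W) (hφ : ∀ i, ∀ v ∈ gr i, φ v ∈ gr' i) : GSym gr →ₐ[K] GSym gr' :=
  lift (ι gr' ∘ₗ φ) fun i j x y hx hy => ι_comm (hφ i x hx) (hφ j y hy)

@[simp] theorem map_ι (φ : V →ₗ[K] W) (hφ) (v : V) :
    map (gr := gr) (gr' := gr') φ hφ (ι gr v) = ι gr' (φ v) := by
  simp [map]

variable [Decomposition gr] [Decomposition gr'] (φ : V →ₗ[K] W)
  (hφ : ∀ i, ∀ v ∈ gr i, φ v ∈ gr' i)

theorem map_sgn (n : ℤ) (x : GSym gr) : map φ hφ (sgn n x) = sgn n (map φ hφ x) := by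
  induction x using GSym.induction with
  | one => simp
  | add x y hx hy => simp [hx, hy]
  | smul c x hx => simp [hx]
  | mul i v hv x hx => simp [sgn_ι _ hv, sgn_ι _ (hφ i v hv), hx]

theorem counit_map (x : GSym gr) : counit (map φ hφ x) = counit x := by
  induction x using GSym.induction with
  | one => simp
  | add x y hx hy => simp [hx, hy]
  | smul c x hx => simp [hx]
  | mul i v hv x hx => simp

theorem proj_map (x : GSym gr) : proj (map φ hφ x) = φ (proj x) := by
  induction x using GSym.induction with
  | one => simp
  | add x y hx hy => simp [hx, hy]
  | smul c x hx => simp [hx]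
  | mul i v hv x hx => simp [counit_map]

theorem comul_map (x : GSym gr) : comul (map φ hφ x) =
    TensorProduct.map (map φ hφ).toLinearMap (map φ hφ).toLinearMap (comul x) := by
  induction x using GSym.induction with
  | one => simp
  | add x y hx hy => simp [hx, hy]
  | smul c x hx => simp [hx]
  | mul i v hv x hx =>
    rw [map_mul, map_ι, comul_ι_mul, comul_ι_mul, hx]
    generalize comul x = z
    induction z with
    | zero => simp
    | add x y hx hy => simp_all
    | tmul a b => simp [coact_tmul hv, coact_tmul (hφ i v hv), map_sgn]

theorem map_mem_degree {n : ℤ} {x : GSym gr} (hx : x ∈ degree gr n) :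
    map φ hφ x ∈ degree gr' n := by
  induction hx using degree_induction with
  | one => simpa using one_mem_degree
  | zero n => simp
  | add n x y _ _ hx hy => rw [map_add]; exact add_mem hx hy
  | smul n c x _ hx => rw [map_smul]; exact Submodule.smul_mem _ _ hx
  | mul i n v hv x _ hx =>
    rw [map_mul, map_ι]
    exact ι_mul_mem_degree (hφ i v hv) hx rfl

theorem coder_map {f : GSym gr →ₗ[K] V} {g : GSym gr' →ₗ[K] W}
    (h : ∀ x, φ (f x) = g (map φ hφ x)) (x : GSym gr) :
    map φ hφ (coder f x) = coder g (map φ hφ x) := by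
  simp only [coder, LinearMap.comp_apply, comul_map]
  generalize comul x = z
  induction z with
  | zero => simp
  | add x y hx hy => simp only [map_add, hx, hy]
  | tmul a b => simp [h]

theorem map_eq_self (φ : V →ₗ[K] V) (hφ : ∀ i, ∀ v ∈ gr i, φ v ∈ gr i) (h : ∀ v, φ v = v)
    (x : GSym gr) : map φ hφ x = x := by
  induction x using GSym.induction with
  | one => simp
  | add x y hx hy => rw [map_add, hx, hy]
  | smul c x hx => rw [map_smul, hx]
  | mul i v hv x hx => rw [map_mul, hx, map_ι, h]

theorem map_map {X : Type*} [AddCommGroup X] [Module K X] {gr'' : ℤ → Submodule K X}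
    (ψ : W →ₗ[K] X) (hψ : ∀ i, ∀ v ∈ gr' i, ψ v ∈ gr'' i)
    (θ : V →ₗ[K] X) (hθ : ∀ i, ∀ v ∈ gr i, θ v ∈ gr'' i) (h : ∀ v, θ v = ψ (φ v))
    (x : GSym gr) : map (gr' := gr'') ψ hψ (map φ hφ x) = map θ hθ x := by
  induction x using GSym.induction with
  | one => simp
  | add x y hx hy => rw [map_add, map_add, map_add, hx, hy]
  | smul c x hx => rw [map_smul, map_smul, map_smul, hx]
  | mul i v hv x hx => rw [map_mul, map_mul, map_mul, hx, map_ι, map_ι, map_ι, h]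

/-- `GSym.map` as a morphism of coalgebras. -/
def mapCoalgHom : GSym gr →ₗc[K] GSym gr' where
  toLinearMap := (map φ hφ).toLinearMap
  counit_comp := LinearMap.ext (counit_map φ hφ)
  map_comp_comul := LinearMap.ext fun x => (comul_map φ hφ x).symm

@[simp] theorem mapCoalgHom_apply (x : GSym gr) : mapCoalgHom φ hφ x = map φ hφ x := rfl

end map

end GSym
end Sym

section quillen

variable {V : Type*} [AddCommGroup V] [Module K V] {gr : ℤ → Submodule K V} [Decomposition gr]

open GSym

theorem zs (n : ℤ) : (-1 : K) ^ n = 1 ∨ (-1 : K) ^ n = -1 := by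
  rcases Int.even_or_odd n with h | h
  · exact Or.inl h.neg_one_zpow
  · exact Or.inr h.neg_one_zpow

set_option maxHeartbeats 2000000 in
/-- The Quillen construction: for `q₁` and `q₂ = b` satisfying the axioms of a differential graded
Lie algebra in suspended form, the coderivation defined by `q₁ + q₂` squares to zero. -/
theorem coder_sq_of_quad (q₁ : V →ₗ[K] V) (b : V →ₗ[K] V →ₗ[K] V)
    (hq₁ : ∀ i, ∀ v ∈ gr i, q₁ v ∈ gr (i + 1))
    (hb : ∀ i j x y, x ∈ gr i → y ∈ gr j → b x y = (-1 : K) ^ (i * j) • b y x)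
    (hq : HasDegree (q₁ ∘ₗ proj + quad b hb) 1)
    (hbd : ∀ i j x y, x ∈ gr i → y ∈ gr j → b x y ∈ gr (i + j + 1))
    (h0 : ∀ v, q₁ (q₁ v) = 0)
    (h1 : ∀ i j v w, v ∈ gr i → w ∈ gr j →
      q₁ (b v w) + b (q₁ v) w + (-1 : K) ^ i • b v (q₁ w) = 0)
    (h2 : ∀ i j k v w u, v ∈ gr i → w ∈ gr j → u ∈ gr k →
      b (b v w) u + (-1 : K) ^ (j * (i + 1)) • b w (b v u) + (-1 : K) ^ i • b v (b w u) = 0) :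
    coder (q₁ ∘ₗ proj + quad b hb) ∘ₗ coder (q₁ ∘ₗ proj + quad b hb) = 0 := by
  set q := q₁ ∘ₗ proj + quad b hb with hqdef
  have n0 : (-1 : K) ≠ 0 := neg_ne_zero.2 one_ne_zero
  -- `A v = [Q, v]`
  let A : V → GSym gr →ₗ[K] GSym gr := fun v => coder (q ∘ₗ LinearMap.mulLeft K (ι gr v))
  have hA1 : ∀ v, A v 1 = ι gr (q₁ v) := by
    intro v; simp [A, hqdef]
  have hQ1 : coder q 1 = 0 := by simp [hqdef]
  have hQ : ∀ i v, v ∈ gr i → ∀ x,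
      coder q (ι gr v * x) = A v x + (-1 : K) ^ i • (ι gr v * coder q x) := by
    intro i v hv x
    simpa using coder_ι_mul hq hv x
  have hA : ∀ i j v w, v ∈ gr i → w ∈ gr j → ∀ x, A v (ι gr w * x) =
      ι gr (b v w) * x + (-1 : K) ^ (j * (1 + i)) • (ι gr w * A v x) := by
    intro i j v w hv hw x
    have e : (q ∘ₗ LinearMap.mulLeft K (ι gr v)) ∘ₗ LinearMap.mulLeft K (ι gr w) =
        counit.toLinearMap.smulRight (b v w) := by
      ext y; simp [hqdef]
    rw [← coder_counit (b v w), ← e]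
    exact coder_ι_mul (hq.comp_mulLeft hv) hw x
  have hQι : ∀ v, coder q (ι gr v) = ι gr (q₁ v) := by
    intro v
    rw [coder_ι (by simp [hqdef])]
    simp [hqdef]
  have hC : ∀ i j v w, v ∈ gr i → w ∈ gr j → ∀ x, A (b v w) x +
      (-1 : K) ^ (j * (i + 1)) • A w (A v x) + (-1 : K) ^ i • A v (A w x) = 0 := by
    intro i j v w hv hw x
    induction x using GSym.induction with
    | one =>
      have e1 := hA j (i + 1) w (q₁ v) hw (hq₁ i v hv) 1
      have e2 := hA i (j + 1) v (q₁ w) hv (hq₁ j w hw) 1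
      rw [mul_one, mul_one, hA1] at e1 e2
      have e3 := congrArg (ι gr) (h1 i j v w hv hw)
      rw [hA1, hA1, hA1, e1, e2, hb j (i + 1) w (q₁ v) hw (hq₁ i v hv),
        ι_comm (hq₁ i v hv) (hq₁ j w hw)]
      simp only [map_add, map_smul, map_zero, mul_add, add_mul, one_mul, mul_one,
        zpow_add₀ n0, zpow_one, mul_comm j i] at e3 ⊢
      linear_combination (norm := skip) e3
      rcases zs (K := K) i with a | a <;> rcases zs (K := K) j with c | c <;>
        rcases zs (K := K) (i * j) with d | d <;> simp only [a, c, d] <;> module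
    | add x y hx hy =>
      have := congrArg₂ (· + ·) hx hy
      simp only [map_add, smul_add, add_zero] at this ⊢
      rw [← this]; abel
    | smul c x hx =>
      have := congrArg (c • ·) hx
      simp only [map_smul, smul_add, smul_zero] at this ⊢
      rw [← this]; module
    | mul k u hu x hx =>
      have e3 := congrArg (fun y => ι gr y * x) (h2 i j k v w u hv hw hu)
      rw [hA _ k _ u (hbd i j v w hv hw) hu, hA i k v u hv hu, hA j k w u hw hu]
      simp only [map_add, map_smul]
      rw [hA j _ w _ hw (hbd i k v u hv hu), hA i _ v _ hv (hbd j k w u hw hu),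
        hA j k w u hw hu, hA i k v u hv hu]
      have e4 := congrArg (fun y => ι gr u * y) hx
      simp only [map_add, map_smul, map_zero, mul_add, add_mul, one_mul, mul_one, mul_zero,
        zero_mul, smul_mul_assoc, mul_smul_comm,
        zpow_add₀ n0, zpow_one, mul_comm j i, mul_comm k i, mul_comm k j] at e3 e4 ⊢
      linear_combination (norm := skip) e3 + ((-1 : K) ^ (i * k) * (-1 : K) ^ (j * k)) • e4
      rcases zs (K := K) i with a | a <;> rcases zs (K := K) j with c | c <;>
        rcases zs (K := K) k with d | d <;> rcases zs (K := K) (i * j) with e | e <;>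
        rcases zs (K := K) (i * k) with f | f <;> rcases zs (K := K) (j * k) with g | g <;>
        simp only [a, c, d, e, f, g] <;> module
  have hB : ∀ i v, v ∈ gr i → ∀ x,
      coder q (A v x) + (-1 : K) ^ i • A v (coder q x) = 0 := by
    intro i v hv x
    induction x using GSym.induction with
    | one => simp [hA1, hQ1, hQι, h0]
    | add x y hx hy =>
      have := congrArg₂ (· + ·) hx hy
      simp only [map_add, smul_add, add_zero] at this ⊢
      rw [← this]; abel
    | smul c x hx =>
      have := congrArg (c • ·) hx
      simp only [map_smul, smul_add, smul_zero] at this ⊢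
      rw [← this]; module
    | mul j w hw x hx =>
      have e3 := hC i j v w hv hw x
      rw [hA i j v w hv hw, hQ j w hw]
      simp only [map_add, map_smul]
      rw [hQ _ _ (hbd i j v w hv hw), hQ j w hw, hA i j v w hv hw]
      have e4 := congrArg (fun y => ι gr w * y) hx
      simp only [mul_add, mul_one, mul_zero, mul_smul_comm, zpow_add₀ n0, zpow_one,
        mul_comm j i] at e3 e4 ⊢
      linear_combination (norm := skip) e3 + ((-1 : K) ^ (i * j)) • e4
      rcases zs (K := K) i with a | a <;> rcases zs (K := K) j with c | c <;>
        rcases zs (K := K) (i * j) with d | d <;> simp only [a, c, d] <;> module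
  refine hom_ext ?_ ?_
  · simp [hQ1]
  · intro i v hv x hx
    simp only [LinearMap.comp_apply, LinearMap.zero_apply] at hx ⊢
    rw [hQ i v hv, map_add, map_smul, hQ i v hv, hx]
    have := hB i v hv x
    simpa using this

end quillen

open GSym

/-- Differential graded vector spaces `(⨁ V^i, d)`. -/
structure DG (K : Type u) [Field K] where
  carrier : Type v
  [addCommGroup : AddCommGroup carrier]
  [module : Module K carrier]
  gr : ℤ → Submodule K carrier
  [dec : Decomposition gr]
  d : carrier →ₗ[K] carrier
  d_mem : ∀ i, ∀ x ∈ gr i, d x ∈ gr (i + 1)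
  d_d : ∀ x, d (d x) = 0

namespace DG

attribute [instance] DG.addCommGroup DG.module DG.dec

/-- Degree preserving linear maps commuting with the differentials. -/
@[ext] structure Hom {K : Type u} [Field K] (A B : DG.{u, v} K) where
  toLin : A.carrier →ₗ[K] B.carrier
  mem : ∀ i, ∀ x ∈ A.gr i, toLin x ∈ B.gr i
  comm : ∀ x, toLin (A.d x) = B.d (toLin x)

instance {K : Type u} [Field K] : Category (DG.{u, v} K) where
  Hom := Hom
  id A := ⟨LinearMap.id, fun _ _ h => h, fun _ => rfl⟩
  comp f g := ⟨g.toLin ∘ₗ f.toLin, fun i x h => g.mem i _ (f.mem i x h),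
    fun x => by simp [f.comm, g.comm]⟩

end DG

/-- Differential graded Lie algebras. -/
structure DGLA (K : Type u) [Field K] where
  carrier : Type v
  [addCommGroup : AddCommGroup carrier]
  [module : Module K carrier]
  gr : ℤ → Submodule K carrier
  [dec : Decomposition gr]
  d : carrier →ₗ[K] carrier
  bracket : carrier →ₗ[K] carrier →ₗ[K] carrier
  d_mem : ∀ i, ∀ x ∈ gr i, d x ∈ gr (i + 1)
  d_d : ∀ x, d (d x) = 0
  bracket_mem : ∀ i j x y, x ∈ gr i → y ∈ gr j → bracket x y ∈ gr (i + j)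
  skew : ∀ i j x y, x ∈ gr i → y ∈ gr j → bracket x y = -((-1 : K) ^ (i * j) • bracket y x)
  jacobi : ∀ i j x y z, x ∈ gr i → y ∈ gr j →
    bracket x (bracket y z) = bracket (bracket x y) z + (-1 : K) ^ (i * j) • bracket y (bracket x z)
  leibniz : ∀ i x y, x ∈ gr i → d (bracket x y) = bracket (d x) y + (-1 : K) ^ i • bracket x (d y)

namespace DGLA

attribute [instance] DGLA.addCommGroup DGLA.module DGLA.dec

/-- Degree preserving linear maps commuting with differentials and brackets. -/
@[ext] structure Hom {K : Type u} [Field K] (A B : DGLA.{u, v} K) where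
  toLin : A.carrier →ₗ[K] B.carrier
  mem : ∀ i, ∀ x ∈ A.gr i, toLin x ∈ B.gr i
  comm : ∀ x, toLin (A.d x) = B.d (toLin x)
  map_bracket : ∀ x y, toLin (A.bracket x y) = B.bracket (toLin x) (toLin y)

instance {K : Type u} [Field K] : Category (DGLA.{u, v} K) where
  Hom := Hom
  id A := ⟨LinearMap.id, fun _ _ h => h, fun _ => rfl, fun _ _ => rfl⟩
  comp f g := ⟨g.toLin ∘ₗ f.toLin, fun i x h => g.mem i _ (f.mem i x h),
    fun x => by simp [f.comm, g.comm], fun x y => by simp [f.map_bracket, g.map_bracket]⟩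

/-- The grading of the zero space. -/
def zeroGr (K : Type u) [Field K] (_ : ℤ) : Submodule K PUnit.{v + 1} := ⊤

instance (K : Type u) [Field K] : Decomposition (zeroGr.{u, v} K) :=
  decompositionOfLift (zeroGr.{u, v} K) (0 : PUnit.{v + 1} →ₗ[K] ⨁ i, zeroGr.{u, v} K i)
    (fun _ => rfl) (fun i _ _ => (map_zero (DirectSum.lof K ℤ (fun i => zeroGr.{u, v} K i) i)).symm)

/-- The zero DGLA. -/
def zero (K : Type u) [Field K] : DGLA.{u, v} K where
  carrier := PUnit.{v + 1}
  gr := zeroGr K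
  d := 0
  bracket := 0
  d_mem _ _ _ := trivial
  d_d _ := rfl
  bracket_mem _ _ _ _ _ _ := trivial
  skew _ _ _ _ _ _ := rfl
  jacobi _ _ _ _ _ _ _ := rfl
  leibniz _ _ _ _ := rfl

variable {K : Type u} [Field K]

/-- The morphism `L → 0`. -/
def toZero (L : DGLA.{u, v} K) : L ⟶ zero.{u, v} K :=
  Hom.mk 0 (fun _ _ _ => trivial) (fun _ => rfl) (fun _ _ => rfl)

/-- The grading `C^i = L^i ⊕ M^(i-1)` of `L ⊕ M`. -/
def coneGr (L M : DGLA.{u, v} K) (i : ℤ) : Submodule K (L.carrier × M.carrier) :=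
  (L.gr i).prod (M.gr (i - 1))

theorem mem_coneGr {L M : DGLA.{u, v} K} {i : ℤ} {x : L.carrier × M.carrier} :
    x ∈ coneGr L M i ↔ x.1 ∈ L.gr i ∧ x.2 ∈ M.gr (i - 1) := Iff.rfl

/-- The inclusion of `L^i` into `C^i`. -/
def coneInl (L M : DGLA.{u, v} K) (i : ℤ) : L.gr i →ₗ[K] coneGr L M i :=
  (LinearMap.inl K L.carrier M.carrier ∘ₗ (L.gr i).subtype).codRestrict (coneGr L M i)
    fun x => mem_coneGr.2 ⟨x.2, zero_mem _⟩

/-- The inclusion of `M^i` into `C^(i+1)`. -/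
def coneInr (L M : DGLA.{u, v} K) (i : ℤ) : M.gr i →ₗ[K] coneGr L M (i + 1) :=
  (LinearMap.inr K L.carrier M.carrier ∘ₗ (M.gr i).subtype).codRestrict (coneGr L M (i + 1))
    fun x => mem_coneGr.2 ⟨zero_mem _, by simp⟩

/-- The decomposition map of `L ⊕ M`. -/
def coneDecompose (L M : DGLA.{u, v} K) : L.carrier × M.carrier →ₗ[K] ⨁ i, coneGr L M i :=
  LinearMap.coprod
    (glift L.gr fun i => DirectSum.lof K ℤ (fun i => coneGr L M i) i ∘ₗ coneInl L M i)
    (glift M.gr fun i => DirectSum.lof K ℤ (fun i => coneGr L M i) (i + 1) ∘ₗ coneInr L M i)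

instance (L M : DGLA.{u, v} K) : Decomposition (coneGr L M) :=
  decompositionOfLift (coneGr L M) (coneDecompose L M)
    (by
      refine LinearMap.congr_fun (f := DirectSum.coeLinearMap _ ∘ₗ _) (g := LinearMap.id) ?_
      refine LinearMap.prod_ext (ghom_ext (gr := L.gr) fun i x hx => ?_)
        (ghom_ext (gr := M.gr) fun i x hx => ?_)
      · simp [coneDecompose, glift_of_mem _ hx, coneInl]
      · simp [coneDecompose, glift_of_mem _ hx, coneInr])
    (by
      rintro i ⟨x, y⟩ h
      obtain ⟨hx, hy⟩ := mem_coneGr.1 h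
      rw [coneDecompose, LinearMap.coprod_apply, glift_of_mem _ hx, glift_of_mem _ hy]
      simp only [LinearMap.comp_apply]
      have e := lof_eq (coneGr L M) (sub_add_cancel i 1)
        (v := ((0 : L.carrier), y)) (mem_coneGr.2 ⟨zero_mem _, by simpa using hy⟩)
        (mem_coneGr.2 ⟨zero_mem _, hy⟩)
      refine (congrArg₂ (· + ·) rfl e).trans ?_
      rw [← map_add]
      congr 1
      ext <;> simp [coneInl])

/-- The functor `DGLA → DGLA²`, `L ↦ (L → 0)`, where `DGLA²` is the category of morphisms
of DGLAs, with commutative squares as morphisms. -/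
def toArrow (K : Type u) [Field K] : DGLA.{u, v} K ⥤ Arrow (DGLA.{u, v} K) where
  obj L := Arrow.mk L.toZero
  map f := Arrow.homMk f (𝟙 _) rfl

/-- The suspended mapping cone: `C^i = L^i ⊕ M^(i-1)` and `δ (l, m) = (d l, χ l - d m)`. -/
def cone {L M : DGLA.{u, v} K} (χ : L ⟶ M) : DG.{u, v} K where
  carrier := L.carrier × M.carrier
  gr := coneGr L M
  d := (L.d ∘ₗ LinearMap.fst K _ _).prod
    (Hom.toLin χ ∘ₗ LinearMap.fst K _ _ - M.d ∘ₗ LinearMap.snd K _ _)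
  d_mem := by
    rintro i ⟨x, y⟩ ⟨hx, hy⟩
    refine ⟨L.d_mem i x hx, ?_⟩
    have := M.d_mem _ y hy
    rw [sub_add_cancel] at this
    change _ ∈ M.gr (i + 1 - 1)
    rw [add_sub_cancel_right]
    exact sub_mem (Hom.mem χ i x hx) this
  d_d := by
    rintro ⟨x, y⟩
    simp [L.d_d, M.d_d, Hom.comm χ]

/-- The functor `DGLA² → DG`, `χ ↦ (C_χ, δ)`, with `(f, g) ↦ f ⊕ g` on morphisms. -/
def coneFunctor (K : Type u) [Field K] : Arrow (DGLA.{u, v} K) ⥤ DG.{u, v} K where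
  obj χ := cone χ.hom
  map {χ χ'} f :=
    { toLin := LinearMap.prodMap (Hom.toLin f.left) (Hom.toLin f.right)
      mem := fun i x hx => ⟨Hom.mem f.left i _ hx.1, Hom.mem f.right _ _ hx.2⟩
      comm := by
        rintro ⟨x, y⟩
        have h : ∀ x, Hom.toLin χ'.hom (Hom.toLin f.left x) =
          Hom.toLin f.right (Hom.toLin χ.hom x) := fun x =>
            LinearMap.congr_fun (congrArg Hom.toLin f.w) x
        refine Prod.ext (Hom.comm f.left x) ?_
        change Hom.toLin f.right (Hom.toLin χ.hom x - χ.right.d y) =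
          Hom.toLin χ'.hom (Hom.toLin f.left x) - χ'.right.d (Hom.toLin f.right y)
        rw [map_sub, h]
        exact congrArg _ (Hom.comm f.right y) }

/-- The canonical identification of `C_{L → 0} = L ⊕ 0` with `L`. -/
def coneToZero (L : DGLA.{u, v} K) :
    ((coneFunctor K).obj ((toArrow K).obj L)).carrier →ₗ[K] L.carrier :=
  LinearMap.fst K L.carrier PUnit.{v + 1}

end DGLA

/-- `L_∞`-algebras: a graded vector space `V` with linear maps `q_n : ⊙^n V[1] → V[1]`, `n ≥ 1`,
of degree 1 (collected into one map `q` on `⨁_{n ≥ 0} ⊙^n V[1]`, zero for `n = 0`), such that the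
induced coderivation `Q` on the symmetric coalgebra satisfies `Q Q = 0`. -/
structure LInfAlg (K : Type u) [Field K] where
  carrier : Type v
  [addCommGroup : AddCommGroup carrier]
  [module : Module K carrier]
  gr : ℤ → Submodule K carrier
  [dec : Decomposition gr]
  q : GSym (shift gr 1) →ₗ[K] carrier
  q_one : q 1 = 0
  q_degree : HasDegree q 1
  coder_sq : coder q ∘ₗ coder q = 0

namespace LInfAlg

attribute [instance] LInfAlg.addCommGroup LInfAlg.module LInfAlg.dec

/-- The symmetric coalgebra `⨁_{n ≥ 0} ⊙^n V[1]`. -/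
abbrev S {K : Type u} [Field K] (A : LInfAlg.{u, v} K) : Type _ := GSym (shift A.gr 1)

/-- The codifferential. -/
def Q {K : Type u} [Field K] (A : LInfAlg.{u, v} K) : A.S →ₗ[K] A.S := coder A.q

/-- `L_∞`-morphisms: degree preserving morphisms between the symmetric coalgebras (with `1 ↦ 1`,
that is, morphisms between the reduced symmetric coalgebras) commuting with the codifferentials. -/
@[ext] structure Hom {K : Type u} [Field K] (A B : LInfAlg.{u, v} K) where
  toCoalgHom : A.S →ₗc[K] B.S
  map_one : toCoalgHom 1 = 1
  map_degree : ∀ n, ∀ x ∈ degree (shift A.gr 1) n, toCoalgHom x ∈ degree (shift B.gr 1) n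
  comm : ∀ x, toCoalgHom (A.Q x) = B.Q (toCoalgHom x)

instance {K : Type u} [Field K] : Category (LInfAlg.{u, v} K) where
  Hom := Hom
  id A := ⟨CoalgHom.id K _, rfl, fun _ _ h => h, fun _ => rfl⟩
  comp f g := ⟨g.toCoalgHom.comp f.toCoalgHom, by simp [f.map_one, g.map_one],
    fun n x h => g.map_degree n _ (f.map_degree n x h), fun x => by simp [f.comm, g.comm]⟩

variable {K : Type u} [Field K]

/-- The components of an `L_∞`-morphism, `∑ f_n : ⨁ ⊙^n V[1] → W[1]`. -/
def corestriction {A B : LInfAlg.{u, v} K} (f : A ⟶ B) : A.S →ₗ[K] B.carrier :=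
  proj ∘ₗ (Hom.toCoalgHom f).toLinearMap

/-- The linear part `f₁ : V → W` of an `L_∞`-morphism. -/
def linearPart {A B : LInfAlg.{u, v} K} (f : A ⟶ B) : A.carrier →ₗ[K] B.carrier :=
  corestriction f ∘ₗ ι (shift A.gr 1)

/-- An `L_∞`-morphism is linear if `f_n = 0` for `n ≥ 2`. -/
def IsLinear {A B : LInfAlg.{u, v} K} (f : A ⟶ B) : Prop :=
  ∀ v w x, corestriction f (ι _ v * ι _ w * x) = 0

theorem Q_ι (A : LInfAlg.{u, v} K) (v : A.carrier) : A.Q (ι _ v) = ι _ (A.q (ι _ v)) :=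
  coder_ι A.q_one v

theorem map_ι [CharZero K] {A B : LInfAlg.{u, v} K} (f : A ⟶ B) (v : A.carrier) :
    Hom.toCoalgHom f (ι _ v) = ι _ (linearPart f v) := by
  refine eq_ι_of_primitive ?_ ?_
  · have := LinearMap.congr_fun (Hom.toCoalgHom f).counit_comp (ι _ v)
    exact this.trans (counit_ι v)
  · have := LinearMap.congr_fun (Hom.toCoalgHom f).map_comp_comul (ι _ v)
    refine this.symm.trans ?_
    simp only [LinearMap.comp_apply]
    refine (congrArg _ (comul_ι v)).trans ?_
    rw [map_add, TensorProduct.map_tmul, TensorProduct.map_tmul]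
    have h1 := Hom.map_one f
    change (Hom.toCoalgHom f) _ ⊗ₜ (Hom.toCoalgHom f) _ + (Hom.toCoalgHom f) _ ⊗ₜ
      (Hom.toCoalgHom f) _ = _
    rw [h1]

theorem mem_shift_one {A : LInfAlg.{u, v} K} {i : ℤ} {x : A.carrier} :
    x ∈ shift A.gr 1 (i - 1) ↔ x ∈ A.gr i := by
  rw [mem_shift, sub_add_cancel]

theorem linearPart_mem {A B : LInfAlg.{u, v} K} (f : A ⟶ B) (i : ℤ) (x : A.carrier)
    (hx : x ∈ A.gr i) : linearPart f x ∈ B.gr i := by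
  have h := Hom.map_degree f _ _ (ι_mem_degree (mem_shift_one.2 hx))
  have h2 := hasDegree_proj (gr := shift B.gr 1) _ _ h
  rw [add_zero] at h2
  exact mem_shift_one.1 h2

theorem linearPart_q [CharZero K] {A B : LInfAlg.{u, v} K} (f : A ⟶ B) (x : A.carrier) :
    linearPart f (A.q (ι _ x)) = B.q (ι _ (linearPart f x)) := by
  have := Hom.comm f (ι _ x)
  rw [Q_ι, map_ι, map_ι, Q_ι] at this
  exact ι_injective this

theorem linearPart_id (A : LInfAlg.{u, v} K) : linearPart (𝟙 A) = LinearMap.id :=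
  LinearMap.ext fun x => proj_ι (gr := shift A.gr 1) x

theorem linearPart_comp [CharZero K] {A B C : LInfAlg.{u, v} K} (f : A ⟶ B) (g : B ⟶ C) :
    linearPart (f ≫ g) = linearPart g ∘ₗ linearPart f := by
  refine LinearMap.ext fun x => ?_
  change proj (Hom.toCoalgHom g (Hom.toCoalgHom f (ι _ x))) = _
  rw [map_ι, map_ι, proj_ι]
  rfl

/-- The functor `L_∞ → DG` forgetting the higher brackets: `(V, q₁, q₂, …) ↦ (V, d)` with `q₁`
the suspension of `d`, that is, `q₁ = -d`, and `f ↦ f₁` on morphisms. -/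
def forget (K : Type u) [Field K] [CharZero K] : LInfAlg.{u, v} K ⥤ DG.{u, v} K where
  obj A :=
    { carrier := A.carrier
      gr := A.gr
      d := -(A.q ∘ₗ ι _)
      d_mem := by
        intro i x hx
        have := A.q_degree _ _ (ι_mem_degree (mem_shift_one.2 hx))
        rw [mem_shift, sub_add_cancel] at this
        exact neg_mem this
      d_d := by
        intro x
        have := LinearMap.congr_fun A.coder_sq (ι _ x)
        simp only [LinearMap.comp_apply, coder_ι A.q_one, LinearMap.zero_apply] at this
        have := ι_injective (this.trans (map_zero _).symm)
        simpa using this }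
  map {A B} f :=
    { toLin := linearPart f
      mem := linearPart_mem f
      comm := fun x => (map_neg _ _).trans (congrArg Neg.neg (linearPart_q f x)) }
  map_id A := DG.Hom.ext (linearPart_id A)
  map_comp f g := DG.Hom.ext (linearPart_comp f g)

end LInfAlg

namespace DGLA
variable {K : Type u} [Field K] (L : DGLA.{u, v} K)

/-- `q₂(x ⊙ y) = (-1)^(deg x) [x, y]`. -/
def q₂ : L.carrier →ₗ[K] L.carrier →ₗ[K] L.carrier :=
  glift L.gr fun i => (-1 : K) ^ i • (L.bracket ∘ₗ (L.gr i).subtype)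

theorem q₂_apply {i : ℤ} {x : L.carrier} (hx : x ∈ L.gr i) (y : L.carrier) :
    L.q₂ x y = (-1 : K) ^ i • L.bracket x y := by
  simp [q₂, glift_of_mem _ hx]

theorem q₂_symm (i j : ℤ) (x y : L.carrier) (hx : x ∈ shift L.gr 1 i) (hy : y ∈ shift L.gr 1 j) :
    L.q₂ x y = (-1 : K) ^ (i * j) • L.q₂ y x := by
  have n0 : (-1 : K) ≠ 0 := neg_ne_zero.2 one_ne_zero
  rw [mem_shift] at hx hy
  rw [L.q₂_apply hx, L.q₂_apply hy, L.skew _ _ _ _ hx hy]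
  simp only [mul_add, add_mul, one_mul, mul_one, zpow_add₀ n0, zpow_one]
  rcases zs (K := K) i with a | a <;> rcases zs (K := K) j with c | c <;>
    rcases zs (K := K) (i * j) with d | d <;> simp only [a, c, d] <;> module

theorem q₂_mem (i j : ℤ) (x y : L.carrier) (hx : x ∈ shift L.gr 1 i) (hy : y ∈ shift L.gr 1 j) :
    L.q₂ x y ∈ shift L.gr 1 (i + j + 1) := by
  rw [mem_shift] at hx hy ⊢
  rw [L.q₂_apply hx]
  have := L.bracket_mem _ _ _ _ hx hy
  rw [show i + 1 + (j + 1) = i + j + 1 + 1 by ring] at this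
  exact Submodule.smul_mem _ _ this

/-- The map `q₁ + q₂` with `q₁(x) = -dx`, `q₂(x ⊙ y) = (-1)^(deg x) [x, y]`. -/
def q : GSym (shift L.gr 1) →ₗ[K] L.carrier := -L.d ∘ₗ proj + quad L.q₂ L.q₂_symm

theorem q_degree : HasDegree L.q 1 := by
  intro n x hx
  rw [q, LinearMap.add_apply]
  refine add_mem ?_ ?_
  · have := hasDegree_proj _ _ hx
    rw [add_zero] at this
    exact neg_mem (L.d_mem _ _ this)
  · induction hx using degree_induction with
    | one => simp
    | zero n => simp
    | add n x y _ _ hx hy => rw [map_add]; exact add_mem hx hy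
    | smul n c x _ hx => rw [map_smul]; exact Submodule.smul_mem _ _ hx
    | mul i n v hv x hx' hx =>
      rw [quad_ι_mul]
      have := hasDegree_proj _ _ hx'
      rw [add_zero] at this
      exact L.q₂_mem _ _ _ _ hv this

/-- The Quillen construction: the `L_∞`-structure with `q₁(x) = -dx`,
`q₂(x ⊙ y) = (-1)^(deg x) [x, y]` and `q_n = 0` for `n ≥ 3`. -/
def toLInf : LInfAlg.{u, v} K where
  carrier := L.carrier
  gr := L.gr
  q := L.q
  q_one := by simp [q]
  q_degree := L.q_degree
  coder_sq := by
    have n0 : (-1 : K) ≠ 0 := neg_ne_zero.2 one_ne_zero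
    refine coder_sq_of_quad (-L.d) L.q₂ ?_ L.q₂_symm L.q_degree L.q₂_mem ?_ ?_ ?_
    · exact fun i x hx => neg_mem (L.d_mem _ x hx)
    · intro x; simp [L.d_d]
    · intro i j x y hx hy
      rw [mem_shift] at hx hy
      simp only [LinearMap.neg_apply, map_neg]
      rw [L.q₂_apply hx, L.q₂_apply hx, L.q₂_apply (L.d_mem _ _ hx), map_smul,
        L.leibniz _ _ _ hx]
      simp only [zpow_add₀ n0, zpow_one]
      rcases zs (K := K) i with a | a <;> simp only [a] <;> module
    · intro i j k x y z hx hy hz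
      rw [mem_shift] at hx hy hz
      rw [L.q₂_apply hx, L.q₂_apply hx, L.q₂_apply hx, L.q₂_apply hy, L.q₂_apply hy]
      simp only [map_smul, LinearMap.smul_apply]
      rw [L.q₂_apply (L.bracket_mem _ _ _ _ hx hy), L.jacobi _ _ x y z hx hy]
      simp only [mul_add, add_mul, one_mul, mul_one, zpow_add₀ n0, zpow_one, mul_comm j i]
      rcases zs (K := K) i with a | a <;> rcases zs (K := K) j with c | c <;>
        rcases zs (K := K) (i * j) with d | d <;> simp only [a, c, d] <;> module

theorem Hom.mem_shift {L M : DGLA.{u, v} K} (f : L ⟶ M) (i : ℤ) (x : L.carrier)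
    (hx : x ∈ shift L.gr 1 i) : Hom.toLin f x ∈ shift M.gr 1 i :=
  Hom.mem f (i + 1) x hx

theorem map_q₂ {L M : DGLA.{u, v} K} (f : L ⟶ M) (x y : L.carrier) :
    Hom.toLin f (L.q₂ x y) = M.q₂ (Hom.toLin f x) (Hom.toLin f y) := by
  suffices h : ∀ y, Hom.toLin f ∘ₗ L.q₂.flip y = M.q₂.flip (Hom.toLin f y) ∘ₗ Hom.toLin f from
    LinearMap.congr_fun (h y) x
  refine fun y => ghom_ext (gr := L.gr) fun i x hx => ?_
  simp [L.q₂_apply hx, M.q₂_apply (Hom.mem f i x hx), Hom.map_bracket f]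

theorem map_q {L M : DGLA.{u, v} K} (f : L ⟶ M) (x : GSym (shift L.gr 1)) :
    Hom.toLin f (L.q x) = M.q (GSym.map (gr := shift L.gr 1) (gr' := shift M.gr 1)
      (Hom.toLin f) (Hom.mem_shift f) x) := by
  simp only [q, LinearMap.add_apply, LinearMap.comp_apply, LinearMap.neg_apply, map_add,
    map_neg]
  refine congrArg₂ (· + ·) ?_ ?_
  · rw [Hom.comm f, proj_map]
  · induction x using GSym.induction with
    | one => simp
    | add x y hx hy => simp only [map_add, hx, hy]
    | smul c x hx => simp only [map_smul, hx]
    | mul i v hv x hx => rw [quad_ι_mul, map_mul, GSym.map_ι, quad_ι_mul, map_q₂, proj_map]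

/-- The Quillen functor `DGLA → L_∞`, sending a morphism `f` to the linear `L_∞`-morphism
with linear part `f`. -/
def quillen (K : Type u) [Field K] : DGLA.{u, v} K ⥤ LInfAlg.{u, v} K where
  obj L := L.toLInf
  map {L M} f :=
    { toCoalgHom := mapCoalgHom (gr := shift L.gr 1) (gr' := shift M.gr 1) (Hom.toLin f)
        (Hom.mem_shift f)
      map_one := map_one (GSym.map _ _)
      map_degree := fun _ _ hx => map_mem_degree _ _ hx
      comm := coder_map _ _ (map_q f) }
  map_id L := LInfAlg.Hom.ext (CoalgHom.ext fun x =>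
    GSym.map_eq_self (gr := shift L.gr 1) _ _ (fun _ => rfl) x)
  map_comp {L M N} _ _ := LInfAlg.Hom.ext (CoalgHom.ext fun x =>
    (GSym.map_map (gr := shift L.gr 1) (gr' := shift M.gr 1) (gr'' := shift N.gr 1)
      _ _ _ _ _ _ (fun _ => rfl) x).symm)

end DGLA

end LInf

end

/-! Existence. The model for the structure on `C_χ` is the homotopy fibre `fibre χ`, the DGLA of
pairs of `l` in `L` and a polynomial form `a + dt b` on `M` with `a(0) = 0` and `a(1) = χ l`.
Integration in `t` contracts it naturally onto the suspended mapping cone (`fibre_homotopy`), and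
homotopy transfer carries its Quillen structure to the cone. When `M = 0` the homotopy vanishes, so
the transferred structure is the Quillen structure of `L`.

The transfer is spectral. For a contraction `(s, p, h)` of an `L_∞`-algebra with codifferential `Q`,
let `η` be the coderivation extending `h`, and let `D = Q η + η Q`. This is a coderivation of degree
`0` commuting with `Q`, with linear part the idempotent `1 - s p`. Relative to the filtration by
word length it is triangular, and its diagonal part `D₀` counts the letters in the contractible
summand. Hence `D` is locally finite with eigenvalues in `ℕ` (`hasNatSpectrum_D`). The projection
onto the generalized `0`-eigenspace commutes with `Q`. It is also a morphism of coalgebras, because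
two natural numbers with sum zero are both zero (`nilProj_tensorOp`). The map `S(p)` identifies that
eigenspace with the symmetric coalgebra of the retract, and `Q` is carried across. No side
conditions on `h` are needed, and functoriality holds because a map intertwining the operators `D`
respects generalized eigenspaces.

Uniqueness. Let `F` make both triangles commute up to natural isomorphism. At `L → 0` the two
identifications of the underlying graded space with `L` differ by a natural automorphism `θ`
(`discrepancy`), which need not be the identity. Naturality for sub-DGLAs of `L[t]` forces `θ` to
multiply each homogeneous element by a scalar (`exists_smul_of_natural`). Consider the arrows
`(fibre χ → 0) ⟶ (path χ → M) ⟵ (L → M)`. The cone of the middle object contracts onto `fibre χ`, so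
`F` of the middle object transfers to a structure on `fibre χ`. The left arrow compares this with
the Quillen structure by a morphism with linear part `θ`, which is an isomorphism since an
`L_∞`-morphism with bijective linear part is invertible (`isIso_of_linearPart`). The right arrow
then yields a morphism from `F χ` to the transferred structure on the cone. Up to the identification
of `F χ` with the cone, its linear part is `p θ⁻¹ s`. This multiplies homogeneous elements by
nonzero scalars, so it is bijective. -/

noncomputable section

namespace LInf.GSym

variable {K : Type*} [Field K]
variable {V : Type*} [AddCommGroup V] [Module K V] {gr : ℤ → Submodule K V}

/-! ### Filtration of the symmetric coalgebra by word length -/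

section filtration

/-- The span of the products of at most `n` vectors. -/
def wordFil (gr : ℤ → Submodule K V) (n : ℕ) : Submodule K (GSym gr) :=
  (1 ⊔ LinearMap.range (ι gr)) ^ n

theorem wordFil_zero : wordFil gr 0 = 1 := pow_zero _

theorem mem_wordFil_zero {x : GSym gr} : x ∈ wordFil gr 0 ↔ ∃ c : K, x = c • 1 := by
  rw [wordFil_zero, Submodule.mem_one]
  simp [Algebra.algebraMap_eq_smul_one, eq_comm]

theorem one_mem_wordFil (n : ℕ) : (1 : GSym gr) ∈ wordFil gr n :=
  Submodule.one_le.1 (one_le_pow_of_one_le' le_sup_left n)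

theorem wordFil_mono {m n : ℕ} (h : m ≤ n) : wordFil gr m ≤ wordFil gr n :=
  pow_le_pow_right' le_sup_left h

theorem mul_mem_wordFil {m n : ℕ} {x y : GSym gr} (hx : x ∈ wordFil gr m) (hy : y ∈ wordFil gr n) :
    x * y ∈ wordFil gr (m + n) := by
  rw [wordFil, pow_add]
  exact Submodule.mul_mem_mul hx hy

theorem ι_mem_wordFil (v : V) : ι gr v ∈ wordFil gr 1 := by
  rw [wordFil, pow_one]
  exact Submodule.mem_sup_right ⟨v, rfl⟩

theorem ι_mul_mem_wordFil (v : V) {n : ℕ} {x : GSym gr} (hx : x ∈ wordFil gr n) :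
    ι gr v * x ∈ wordFil gr (n + 1) := by
  rw [add_comm]; exact mul_mem_wordFil (ι_mem_wordFil v) hx

theorem wordFil_succ_le {n : ℕ} {Z : Submodule K (GSym gr)} (h0 : wordFil gr n ≤ Z)
    (h1 : ∀ v, ∀ x ∈ wordFil gr n, ι gr v * x ∈ Z) : wordFil gr (n + 1) ≤ Z := by
  rw [wordFil, pow_succ', Submodule.mul_le]
  intro a ha x hx
  obtain ⟨b, hb, c, ⟨v, rfl⟩, rfl⟩ := Submodule.mem_sup.1 ha
  obtain ⟨r, rfl⟩ := Submodule.mem_one.1 hb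
  rw [add_mul]
  refine add_mem ?_ (h1 v x hx)
  rw [← Algebra.smul_def]
  exact Z.smul_mem _ (h0 hx)

theorem wordFil_one_le {Z : Submodule K (GSym gr)} (h0 : (1 : GSym gr) ∈ Z)
    (h1 : ∀ v, ι gr v ∈ Z) : wordFil gr 1 ≤ Z := by
  refine wordFil_succ_le (n := 0) ?_ ?_
  · intro x hx
    obtain ⟨c, rfl⟩ := mem_wordFil_zero.1 hx
    exact Z.smul_mem _ h0
  · intro v x hx
    obtain ⟨c, rfl⟩ := mem_wordFil_zero.1 hx
    rw [mul_smul_comm, mul_one]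
    exact Z.smul_mem _ (h1 v)

variable [Decomposition gr]

theorem exists_mem_wordFil (x : GSym gr) : ∃ n, x ∈ wordFil gr n := by
  induction x using GSym.induction with
  | one => exact ⟨0, one_mem_wordFil 0⟩
  | add x y hx hy =>
    obtain ⟨m, hx⟩ := hx
    obtain ⟨n, hy⟩ := hy
    exact ⟨max m n, add_mem (wordFil_mono (le_max_left _ _) hx)
      (wordFil_mono (le_max_right _ _) hy)⟩
  | smul c x hx => exact hx.imp fun n h => Submodule.smul_mem _ c h
  | mul i v hv x hx => exact hx.imp' (· + 1) fun n h => ι_mul_mem_wordFil v h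

theorem sgn_mem_wordFil (m : ℤ) {n : ℕ} {x : GSym gr} (hx : x ∈ wordFil gr n) :
    sgn m x ∈ wordFil gr n := by
  induction n generalizing x with
  | zero =>
    obtain ⟨c, rfl⟩ := mem_wordFil_zero.1 hx
    simpa using Submodule.smul_mem _ c (one_mem_wordFil 0)
  | succ n ih =>
    suffices h : wordFil gr (n + 1) ≤ (wordFil gr (n + 1)).comap (sgn m).toLinearMap from h hx
    refine wordFil_succ_le (fun x hx => wordFil_mono n.le_succ (ih hx)) fun v x hx => ?_
    induction v using Decomposition.inductionOn gr with
    | zero => simp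
    | homogeneous v =>
      simp only [Submodule.mem_comap, AlgHom.toLinearMap_apply, map_mul, sgn_ι _ v.2,
        smul_mul_assoc]
      exact Submodule.smul_mem _ _ (ι_mul_mem_wordFil _ (ih hx))
    | add a b ha hb => rw [map_add, add_mul]; exact add_mem ha hb

/-- An additional letter lands in one of the two tensor factors, so the lengths of the factors add
up to the length of the word. Testing against a map `Φ`, which the induction replaces by `Φ ∘ₗ coact
v`, avoids subspaces of the tensor square. -/
theorem apply_comul_mem {Y : Type*} [AddCommGroup Y] [Module K Y] {Z : Submodule K Y} {n : ℕ}
    (Φ : GSym gr ⊗[K] GSym gr →ₗ[K] Y)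
    (h : ∀ i j, i + j = n → ∀ a ∈ wordFil gr i, ∀ b ∈ wordFil gr j, Φ (a ⊗ₜ b) ∈ Z)
    {x : GSym gr} (hx : x ∈ wordFil gr n) : Φ (comul x) ∈ Z := by
  induction n generalizing x Φ with
  | zero =>
    obtain ⟨c, rfl⟩ := mem_wordFil_zero.1 hx
    rw [map_smul, map_smul, comul_one]
    exact Z.smul_mem _ (h 0 0 rfl 1 (one_mem_wordFil 0) 1 (one_mem_wordFil 0))
  | succ n ih =>
    suffices h : wordFil gr (n + 1) ≤ Z.comap (Φ ∘ₗ comul) from h hx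
    refine wordFil_succ_le (fun x hx => ih Φ (fun i j hij a ha b hb => ?_) hx) fun v x hx => ?_
    · exact h (i + 1) j (by omega) a (wordFil_mono i.le_succ ha) b hb
    · induction v using Decomposition.inductionOn gr with
      | zero => simp
      | homogeneous v =>
        simp only [Submodule.mem_comap, LinearMap.comp_apply, comul_ι_mul]
        refine ih (Φ ∘ₗ coact (v : V)) (fun i j hij a ha b hb => ?_) hx
        rw [LinearMap.comp_apply, coact_tmul v.2, map_add]
        exact add_mem (h (i + 1) j (by omega) _ (ι_mul_mem_wordFil _ ha) _ hb)
          (h i (j + 1) (by omega) _ (sgn_mem_wordFil _ ha) _ (ι_mul_mem_wordFil _ hb))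
      | add a b ha hb => rw [map_add, add_mul]; exact add_mem ha hb

end filtration

/-! ### Convolution and the Euler coderivation -/

section conv

variable [Decomposition gr] {A : Type*} [Ring A] [Algebra K A]

/-- The convolution product of linear maps from the symmetric coalgebra to an algebra. -/
def conv (f g : GSym gr →ₗ[K] A) : GSym gr →ₗ[K] A :=
  LinearMap.mul' K A ∘ₗ TensorProduct.map f g ∘ₗ comul

theorem conv_mem {f g : GSym gr →ₗ[K] A} {Z : Submodule K A} {n : ℕ}
    (h : ∀ i j, i + j = n → ∀ a ∈ wordFil gr i, ∀ b ∈ wordFil gr j, f a * g b ∈ Z)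
    {x : GSym gr} (hx : x ∈ wordFil gr n) : conv f g x ∈ Z := by
  refine apply_comul_mem (LinearMap.mul' K A ∘ₗ TensorProduct.map f g) ?_ hx
  simpa using h

theorem conv_add_left (f f' g : GSym gr →ₗ[K] A) : conv (f + f') g = conv f g + conv f' g := by
  simp [conv, TensorProduct.map_add_left, LinearMap.add_comp, LinearMap.comp_add]

theorem conv_sub_left (f f' g : GSym gr →ₗ[K] A) : conv (f - f') g = conv f g - conv f' g := by
  rw [eq_sub_iff_add_eq, ← conv_add_left, sub_add_cancel]

theorem conv_add_right (f g g' : GSym gr →ₗ[K] A) : conv f (g + g') = conv f g + conv f g' := by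
  simp [conv, TensorProduct.map_add_right, LinearMap.add_comp, LinearMap.comp_add]

theorem conv_sub_right (f g g' : GSym gr →ₗ[K] A) : conv f (g - g') = conv f g - conv f g' := by
  rw [eq_sub_iff_add_eq, ← conv_add_right, sub_add_cancel]

theorem coder_eq_conv (f : GSym gr →ₗ[K] V) : coder f = conv (ι gr ∘ₗ f) LinearMap.id := rfl

theorem coder_sub (f g : GSym gr →ₗ[K] V) : coder (f - g) = coder f - coder g := by
  rw [coder_eq_conv, LinearMap.comp_sub, conv_sub_left]; rfl

theorem coder_mem_wordFil {f : GSym gr →ₗ[K] V} (h : f 1 = 0) {n : ℕ} {x : GSym gr}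
    (hx : x ∈ wordFil gr n) : coder f x ∈ wordFil gr n := by
  refine conv_mem (fun i j hij a ha b hb => ?_) hx
  cases i with
  | zero =>
    obtain ⟨c, rfl⟩ := mem_wordFil_zero.1 ha
    simp [h]
  | succ i => exact wordFil_mono (by omega) (ι_mul_mem_wordFil _ hb)

/-- Such a coderivation consumes at least two letters and produces one, so it shortens words. This
makes `D - D₀` strictly triangular later. -/
theorem coder_mem_wordFil_of_linear_zero {f : GSym gr →ₗ[K] V} (h : f 1 = 0)
    (h' : ∀ v, f (ι gr v) = 0) {n : ℕ} {x : GSym gr}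
    (hx : x ∈ wordFil gr (n + 1)) : coder f x ∈ wordFil gr n := by
  refine conv_mem (fun i j hij a ha b hb => ?_) hx
  rcases i with - | - | i
  · obtain ⟨c, rfl⟩ := mem_wordFil_zero.1 ha
    simp [h]
  · have : f a = 0 := wordFil_one_le (Z := LinearMap.ker f) h h' ha
    simp [this]
  · exact wordFil_mono (by omega) (ι_mul_mem_wordFil _ hb)

theorem hasDegree_comp_proj {g : V →ₗ[K] V} {e : ℤ} (hg : ∀ i, ∀ v ∈ gr i, g v ∈ gr (i + e)) :
    HasDegree (g ∘ₗ proj (gr := gr)) e := by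
  intro n x hx
  have := hasDegree_proj n x hx
  rw [add_zero] at this
  exact hg n _ this

/-- In degree `0` no Koszul signs appear, and the coderivation extending `g` is also the derivation
of the algebra extending `g`. The operators `euler`, `degOp` and `D₀` are all of this kind and are
computed letter by letter through this rule. -/
theorem coder_comp_proj_ι_mul {g : V →ₗ[K] V} (hg : ∀ i, ∀ v ∈ gr i, g v ∈ gr i) (v : V)
    (x : GSym gr) : coder (g ∘ₗ proj) (ι gr v * x) =
      ι gr (g v) * x + ι gr v * coder (g ∘ₗ proj) x := by
  have hd : HasDegree (g ∘ₗ proj (gr := gr)) 0 := hasDegree_comp_proj (by simpa using hg)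
  induction v using Decomposition.inductionOn gr with
  | zero => simp
  | homogeneous v =>
    have e : (g ∘ₗ proj) ∘ₗ LinearMap.mulLeft K (ι gr (v : V)) =
        counit.toLinearMap.smulRight (g v) := by
      ext x; simp
    rw [coder_ι_mul hd v.2, e, coder_counit]
    simp
  | add a b ha hb => simp only [map_add, add_mul, ha, hb]; abel

theorem coder_comp_proj_one (g : V →ₗ[K] V) : coder (g ∘ₗ proj) (1 : GSym gr) = 0 := by simp

variable (gr) in
/-- The Euler coderivation, multiplication by `n` on `⊙^n V`. -/
def euler : GSym gr →ₗ[K] GSym gr := coder proj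

theorem euler_one : euler gr 1 = 0 := by simp [euler]

theorem euler_ι_mul (v : V) (x : GSym gr) :
    euler gr (ι gr v * x) = ι gr v * x + ι gr v * euler gr x := by
  simpa [euler] using
    coder_comp_proj_ι_mul (gr := gr) (g := LinearMap.id) (fun _ _ h => h) v x

theorem euler_mem_wordFil {n : ℕ} {x : GSym gr} (hx : x ∈ wordFil gr n) :
    euler gr x ∈ wordFil gr n := coder_mem_wordFil proj_one hx

/-- Every letter contributes one to the eigenvalue. Knowing this modulo shorter words is enough
below, so no grading by word length has to be constructed. -/
theorem euler_sub_smul_mem {n : ℕ} {x : GSym gr} (hx : x ∈ wordFil gr (n + 1)) :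
    euler gr x - ((n + 1 : ℕ) : K) • x ∈ wordFil gr n := by
  induction n generalizing x with
  | zero =>
    suffices h : wordFil gr 1 ≤ (wordFil gr 0).comap (euler gr - ((0 + 1 : ℕ) : K) • LinearMap.id)
      from h hx
    refine wordFil_one_le ?_ ?_
    · simpa [euler_one] using one_mem_wordFil 0
    · intro v
      have := euler_ι_mul v (1 : GSym gr)
      rw [mul_one, euler_one] at this
      simp [this]
  | succ n ih =>
    suffices h : wordFil gr (n + 1 + 1) ≤
        (wordFil gr (n + 1)).comap (euler gr - ((n + 1 + 1 : ℕ) : K) • LinearMap.id) from h hx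
    refine wordFil_succ_le ?_ ?_
    · intro x hx
      exact sub_mem (euler_mem_wordFil hx) (Submodule.smul_mem _ _ hx)
    · intro v x hx
      have := ι_mul_mem_wordFil v (ih hx)
      rw [mul_sub, mul_smul_comm] at this
      rw [Submodule.mem_comap, LinearMap.sub_apply, euler_ι_mul]
      convert this using 1
      simp only [LinearMap.smul_apply, LinearMap.id_apply]
      push_cast
      module

variable [CharZero K]

/-- If `y` has length at most `M + 1` with `m ≤ M`, then `euler` multiplies its top part by `M + 1`,
which is invertible in characteristic `0`. As `euler gr y` is shorter, so is `y`, and the bound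
descends to `m`. -/
theorem mem_wordFil_of_euler_mem {m : ℕ} {y : GSym gr} (hy : euler gr y ∈ wordFil gr m) :
    y ∈ wordFil gr m := by
  obtain ⟨M, hM⟩ := exists_mem_wordFil y
  induction M with
  | zero => exact wordFil_mono (Nat.zero_le m) hM
  | succ M ih =>
    rcases le_or_gt (M + 1) m with h | h
    · exact wordFil_mono h hM
    · refine ih ?_
      have h1 := sub_mem (wordFil_mono (by omega : m ≤ M) hy) (euler_sub_smul_mem hM)
      rw [sub_sub_cancel] at h1
      exact (Submodule.smul_mem_iff _ (Nat.cast_ne_zero.2 M.succ_ne_zero)).1 h1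

theorem eq_smul_one_of_euler_eq_zero {y : GSym gr} (hy : euler gr y = 0) :
    ∃ c : K, y = c • 1 :=
  mem_wordFil_zero.1 (mem_wordFil_of_euler_mem (hy ▸ zero_mem _))

end conv

/-! ### Morphisms of symmetric coalgebras and word length -/

section coalgHom

variable [Decomposition gr]
variable {W : Type*} [AddCommGroup W] [Module K W] {gr' : ℤ → Submodule K W} [Decomposition gr']

theorem comul_coalgHom (φ : GSym gr →ₗc[K] GSym gr') (x : GSym gr) :
    comul (φ x) = TensorProduct.map (φ : GSym gr →ₗ[K] GSym gr') (φ : GSym gr →ₗ[K] GSym gr')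
      (comul x) :=
  (LinearMap.congr_fun φ.map_comp_comul x).symm

/-- Compatibility with coproducts turns the Euler operator into a recursion expressing `φ` through
its corestriction. When `φ 1 = 1` the left factor kills scalars, so `φ` on the right only sees
strictly shorter words. The inductions on word length below rest on this. -/
theorem euler_coalgHom (φ : GSym gr →ₗc[K] GSym gr') (x : GSym gr) :
    euler gr' (φ x) =
      conv (ι gr' ∘ₗ proj ∘ₗ (φ : GSym gr →ₗ[K] GSym gr')) (φ : GSym gr →ₗ[K] GSym gr') x := by
  simp only [euler, coder, conv, LinearMap.comp_apply, comul_coalgHom]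
  rw [← LinearMap.comp_apply (TensorProduct.map _ _), ← TensorProduct.map_comp]
  rfl

variable [CharZero K]

theorem coalgHom_mem_wordFil {φ : GSym gr →ₗc[K] GSym gr'} (h1 : φ 1 = 1) {n : ℕ} {x : GSym gr}
    (hx : x ∈ wordFil gr n) : φ x ∈ wordFil gr' n := by
  induction n using Nat.strong_induction_on generalizing x with
  | _ n ih =>
    refine mem_wordFil_of_euler_mem ?_
    rw [euler_coalgHom]
    refine conv_mem (fun i j hij a ha b hb => ?_) hx
    cases i with
    | zero =>
      obtain ⟨c, rfl⟩ := mem_wordFil_zero.1 ha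
      simp [h1]
    | succ i =>
      exact wordFil_mono (by omega) (ι_mul_mem_wordFil _ (ih j (by omega) hb))

theorem unipotent_sub_mem {ψ : GSym gr →ₗc[K] GSym gr} (h1 : ψ 1 = 1)
    (hι : ∀ v, ψ (ι gr v) = ι gr v) {n : ℕ} {x : GSym gr} (hx : x ∈ wordFil gr (n + 1)) :
    ψ x - x ∈ wordFil gr n := by
  induction n using Nat.strong_induction_on generalizing x with
  | _ n ih =>
    refine mem_wordFil_of_euler_mem ?_
    set ψ' : GSym gr →ₗ[K] GSym gr := ψ.toLinearMap with hψ'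
    -- The difference of the two convolutions is telescoped. In the first summand the left factor
    -- vanishes on words of length at most one, and in the second the right factor is covered by the
    -- induction hypothesis.
    have e : euler gr (ψ x - x) = conv (ι gr ∘ₗ (proj ∘ₗ ψ' - proj)) ψ' x +
        conv (ι gr ∘ₗ proj) (ψ' - LinearMap.id) x := by
      rw [map_sub, euler_coalgHom, LinearMap.comp_sub, conv_sub_left, conv_sub_right]
      simp only [LinearMap.sub_apply, sub_add_sub_cancel]
      rfl
    rw [e]
    refine add_mem (conv_mem (fun i j hij a ha b hb => ?_) hx)
      (conv_mem (fun i j hij a ha b hb => ?_) hx)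
    · have hb' : ψ' b ∈ wordFil gr j := coalgHom_mem_wordFil h1 hb
      rcases i with - | - | i
      · obtain ⟨c, rfl⟩ := mem_wordFil_zero.1 ha
        simp [hψ', h1]
      · have : (proj ∘ₗ ψ' - proj : GSym gr →ₗ[K] V) a = 0 :=
          wordFil_one_le (Z := LinearMap.ker (proj ∘ₗ ψ' - proj : GSym gr →ₗ[K] V)) (by simp [hψ', h1])
            (by simp [hψ', hι]) ha
        rw [LinearMap.comp_apply, this]
        simp
      · exact wordFil_mono (by omega) (ι_mul_mem_wordFil _ hb')
    · cases i with
      | zero =>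
        obtain ⟨c, rfl⟩ := mem_wordFil_zero.1 ha
        simp
      | succ i =>
        cases j with
        | zero =>
          obtain ⟨c, rfl⟩ := mem_wordFil_zero.1 hb
          simp [hψ', h1]
        | succ j =>
          exact wordFil_mono (by omega) (ι_mul_mem_wordFil _ (ih j (by omega) hb))

/-- A unital endomorphism of the symmetric coalgebra that is the identity on `V` is bijective. -/
theorem unipotent_bijective {ψ : GSym gr →ₗc[K] GSym gr} (h1 : ψ 1 = 1)
    (hι : ∀ v, ψ (ι gr v) = ι gr v) : Function.Bijective ψ := by
  constructor
  · refine (injective_iff_map_eq_zero ψ).2 fun x hx => ?_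
    obtain ⟨n, hn⟩ := exists_mem_wordFil x
    induction n with
    | zero =>
      obtain ⟨c, rfl⟩ := mem_wordFil_zero.1 hn
      rwa [map_smul, h1] at hx
    | succ n ih =>
      refine ih ?_
      have := unipotent_sub_mem h1 hι hn
      rwa [hx, zero_sub, neg_mem_iff] at this
  · intro x
    obtain ⟨n, hn⟩ := exists_mem_wordFil x
    induction n generalizing x with
    | zero =>
      obtain ⟨c, rfl⟩ := mem_wordFil_zero.1 hn
      exact ⟨c • 1, by rw [map_smul, h1]⟩
    | succ n ih =>
      -- Successive approximation: `x` is its own preimage up to the shorter error `ψ x - x`, which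
      -- already has a preimage.
      obtain ⟨y, hy⟩ := ih _ (unipotent_sub_mem h1 hι hn)
      exact ⟨x - y, by rw [map_sub, hy, sub_sub_cancel]⟩

end coalgHom

end LInf.GSym

end

noncomputable section

namespace LInf.GSym

variable {K : Type*} [Field K]
variable {V : Type*} [AddCommGroup V] [Module K V] {gr : ℤ → Submodule K V} [Decomposition gr]
variable {W : Type*} [AddCommGroup W] [Module K W] {gr' : ℤ → Submodule K W} [Decomposition gr']

/-! ### Coderivations and their corestrictions -/

section coder

theorem coder_mem_degree {f : GSym gr →ₗ[K] V} {e : ℤ} (hf : HasDegree f e) {n : ℤ}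
    {x : GSym gr} (hx : x ∈ degree gr n) : coder f x ∈ degree gr (n + e) := by
  induction hx using degree_induction generalizing f e with
  | one =>
    rw [coder_one]
    exact ι_mem_degree (hf 0 1 one_mem_degree)
  | zero n => simp
  | add n x y _ _ hx hy => rw [map_add]; exact add_mem (hx hf) (hy hf)
  | smul n c x _ hx => rw [map_smul]; exact Submodule.smul_mem _ _ (hx hf)
  | mul i n v hv x _ hx =>
    rw [coder_ι_mul hf hv]
    refine add_mem ?_ (Submodule.smul_mem _ _ (ι_mul_mem_degree hv (hx hf) (by ring)))
    have := hx (hf.comp_mulLeft hv)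
    rwa [show n + (e + i) = i + n + e by ring] at this

theorem apply_sgn {Θ : GSym gr →ₗ[K] GSym gr'} {e : ℤ}
    (hΘ : ∀ n, ∀ x ∈ degree gr n, Θ x ∈ degree gr' (n + e)) (i : ℤ) (x : GSym gr) :
    Θ (sgn i x) = (-1 : K) ^ (i * e) • sgn i (Θ x) := by
  refine LinearMap.congr_fun (f := Θ ∘ₗ (sgn i).toLinearMap)
    (g := (-1 : K) ^ (i * e) • ((sgn i).toLinearMap ∘ₗ Θ)) (hom_ext_degree fun n x hx => ?_) x
  simp only [LinearMap.comp_apply, AlgHom.toLinearMap_apply, LinearMap.smul_apply,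
    sgn_of_mem i hx, sgn_of_mem i (hΘ n x hx), map_smul, smul_smul]
  rw [mul_add, zpow_add₀ (neg_ne_zero.2 one_ne_zero), mul_left_comm, ← mul_zpow]
  simp

/-- `Θ ⊗ 1 + 1 ⊗ Θ` with the Koszul signs of a map `Θ` of degree `e`. -/
def leibnizMap (e : ℤ) (Θ : GSym gr →ₗ[K] GSym gr) :
    GSym gr ⊗[K] GSym gr →ₗ[K] GSym gr ⊗[K] GSym gr :=
  TensorProduct.map Θ LinearMap.id + TensorProduct.map (sgn e).toLinearMap Θ

theorem leibnizMap_tmul (e : ℤ) (Θ : GSym gr →ₗ[K] GSym gr) (a b : GSym gr) :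
    leibnizMap e Θ (a ⊗ₜ b) = Θ a ⊗ₜ b + sgn e a ⊗ₜ Θ b := rfl

/-- `Θ` is a coderivation of degree `e`. -/
def IsCoder (e : ℤ) (Θ : GSym gr →ₗ[K] GSym gr) : Prop :=
  ∀ x, comul (Θ x) = leibnizMap e Θ (comul x)

/-- Passing a letter `v` of degree `i` through `coder f` produces the coderivation of `f ∘ₗ
LinearMap.mulLeft K (ι gr v)`, which has degree `e + i`. The induction on words therefore has to be
uniform in `f` and `e`. -/
theorem isCoder_coder {f : GSym gr →ₗ[K] V} {e : ℤ} (hf : HasDegree f e) :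
    IsCoder e (coder f) := by
  intro x
  induction x using GSym.induction generalizing f e with
  | one =>
    rw [coder_one, comul_ι]
    simp [leibnizMap_tmul]
  | add x y hx hy => simp only [map_add, hx hf, hy hf]
  | smul c x hx => simp only [map_smul, hx hf]
  | mul i v hv x hx =>
    rw [coder_ι_mul hf hv, map_add, map_smul, comul_ι_mul, comul_ι_mul, hx hf,
      hx (hf.comp_mulLeft hv)]
    have hs := apply_sgn (fun _ _ h => coder_mem_degree hf h) i
    generalize comul x = z
    induction z with
    | zero => simp
    | add x y hx hy =>
      simp only [map_add, smul_add] at hx hy ⊢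
      rw [← hx, ← hy]; abel
    | tmul a b =>
      have h1 : sgn e (ι gr v * a) = (-1 : K) ^ (i * e) • (ι gr v * sgn e a) := by
        rw [map_mul, sgn_ι _ hv, smul_mul_assoc, mul_comm]
      have h2 : sgn (e + i) a = sgn e (sgn i a) := by
        refine LinearMap.congr_fun (f := (sgn (e + i)).toLinearMap)
          (g := (sgn e).toLinearMap ∘ₗ (sgn i).toLinearMap) (hom_ext_degree fun n x hx => ?_) a
        simp only [LinearMap.comp_apply, AlgHom.toLinearMap_apply, sgn_of_mem _ hx, map_smul,
          smul_smul]
        rw [add_mul, zpow_add₀ (neg_ne_zero.2 one_ne_zero), mul_comm]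
      simp only [leibnizMap_tmul, coact_tmul hv, map_add,
        coder_ι_mul hf hv, h1, h2, hs,
        TensorProduct.add_tmul, TensorProduct.tmul_add, smul_add, TensorProduct.smul_tmul',
        TensorProduct.tmul_smul, sgn_comm i e]
      abel

/-- Applying the counit to both factors of the co-Leibniz rule gives `ε (Θ x) = ε (Θ x) + ε (Θ x)`.
-/
theorem counit_of_isCoder {e : ℤ} {Θ : GSym gr →ₗ[K] GSym gr} (h : IsCoder e Θ) (x : GSym gr) :
    counit (Θ x) = 0 := by
  have hc : ∀ y : GSym gr, LinearMap.mul' K K (TensorProduct.map counit.toLinearMap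
      counit.toLinearMap (comul y)) = counit y := by
    intro y
    have h1 := congrArg (counit ∘ TensorProduct.lid K _) (Coalgebra.rTensor_counit_comul (R := K) y)
    have h2 : ∀ z : GSym gr ⊗[K] GSym gr, LinearMap.mul' K K (TensorProduct.map
        counit.toLinearMap counit.toLinearMap z) =
        counit (TensorProduct.lid K (GSym gr) (counit.toLinearMap.rTensor (GSym gr) z)) := by
      intro z
      induction z with
      | zero => simp
      | add x y hx hy => simp only [map_add, hx, hy]
      | tmul a b => simp
    rw [h2]
    refine h1.trans ?_
    simp
  have hr := hc (Θ x)
  rw [h] at hr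
  have h1 : ∀ z : GSym gr ⊗[K] GSym gr, LinearMap.mul' K K (TensorProduct.map counit.toLinearMap
      counit.toLinearMap (leibnizMap e Θ z)) =
      counit (Θ (TensorProduct.rid K (GSym gr) (counit.toLinearMap.lTensor (GSym gr) z))) +
      counit (Θ (TensorProduct.lid K (GSym gr) (counit.toLinearMap.rTensor (GSym gr) z))) := by
    intro z
    induction z with
    | zero => simp
    | add x y hx hy => simp only [map_add, hx, hy]; ring
    | tmul a b =>
      simp only [leibnizMap_tmul, TensorProduct.map_tmul, map_add, AlgHom.toLinearMap_apply,
        LinearMap.mul'_apply, counit_sgn, LinearMap.lTensor_tmul,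
        LinearMap.rTensor_tmul, TensorProduct.rid_tmul, TensorProduct.lid_tmul, map_smul,
        smul_eq_mul]
      ring
  rw [h1] at hr
  have e1 : (counit.toLinearMap.rTensor (GSym gr)) (comul x) = _ :=
    Coalgebra.rTensor_counit_comul (R := K) x
  have e2 : (counit.toLinearMap.lTensor (GSym gr)) (comul x) = _ :=
    Coalgebra.lTensor_counit_comul (R := K) x
  rw [e1, e2] at hr
  simpa using hr

theorem proj_coder (x : GSym gr) (f : GSym gr →ₗ[K] V) : proj (coder f x) = f x := by
  have : ∀ z : GSym gr ⊗[K] GSym gr, proj (LinearMap.mul' K (GSym gr)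
      (TensorProduct.map (ι gr ∘ₗ f) LinearMap.id z)) =
      f (TensorProduct.rid K (GSym gr) (counit.toLinearMap.lTensor (GSym gr) z)) := by
    intro z
    induction z with
    | zero => simp
    | add x y hx hy => simp only [map_add, hx, hy]
    | tmul a b => simp
  have e2 : (counit.toLinearMap.lTensor (GSym gr)) (comul x) = _ :=
    Coalgebra.lTensor_counit_comul (R := K) x
  simp only [coder, LinearMap.comp_apply]
  rw [this, e2]
  simp

/-- A coderivation is determined by its corestriction. The difference of two coderivations with the
same corestriction satisfies the co-Leibniz rule with zero corestriction. By induction on word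
length the Euler operator kills its values, so these are scalars, and the counit kills them too. -/
theorem coder_proj_eq [CharZero K] {e : ℤ} {Θ : GSym gr →ₗ[K] GSym gr} (h : IsCoder e Θ)
    (hd : HasDegree (proj ∘ₗ Θ) e) : coder (proj ∘ₗ Θ) = Θ := by
  suffices H : ∀ n, ∀ x ∈ wordFil gr n, (coder (proj ∘ₗ Θ) - Θ) x = 0 by
    ext x
    obtain ⟨n, hn⟩ := exists_mem_wordFil x
    exact sub_eq_zero.1 (H n x hn)
  have hc := isCoder_coder hd
  set Ξ := coder (proj ∘ₗ Θ) with hΞ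
  have he : ∀ Θ' : GSym gr →ₗ[K] GSym gr, IsCoder e Θ' → ∀ x, euler gr (Θ' x) =
      coder (proj ∘ₗ Θ') x + conv (ι gr ∘ₗ proj ∘ₗ (sgn e).toLinearMap) Θ' x := by
    intro Θ' h' x
    simp only [euler, coder, conv, LinearMap.comp_apply, h' x]
    generalize comul x = z
    induction z with
    | zero => simp
    | add x y hx hy => simp only [map_add, hx, hy]; abel
    | tmul a b => simp [leibnizMap_tmul]
  have hΔ : ∀ x, comul ((Ξ - Θ) x) = leibnizMap e (Ξ - Θ) (comul x) := by
    intro x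
    rw [LinearMap.sub_apply, map_sub, hc, h]
    generalize comul x = z
    induction z with
    | zero => simp
    | add x y hx hy => rw [map_add, map_add, map_add, ← hx, ← hy]; abel
    | tmul a b =>
      simp only [leibnizMap_tmul, LinearMap.sub_apply, TensorProduct.sub_tmul,
        TensorProduct.tmul_sub]
      abel
  have hp : proj ∘ₗ Ξ = proj ∘ₗ Θ := by
    ext x
    simp [hΞ, proj_coder]
  intro n
  induction n using Nat.strong_induction_on with
  | _ n ih =>
    intro x hx
    -- Only the convolution term survives. Its left factor kills scalars, so the right factor is
    -- evaluated on words shorter than `n`.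
    have e1 : euler gr ((Ξ - Θ) x) ∈ (⊥ : Submodule K (GSym gr)) := by
      rw [he _ hΔ, LinearMap.comp_sub, hp, sub_self]
      have : coder (0 : GSym gr →ₗ[K] V) x = 0 := by simp [coder]
      rw [this, zero_add]
      refine conv_mem (fun i j hij a ha b hb => ?_) hx
      cases i with
      | zero =>
        obtain ⟨c, rfl⟩ := mem_wordFil_zero.1 ha
        simp
      | succ i => rw [ih j (by omega) b hb]; simp
    obtain ⟨c, hc'⟩ := eq_smul_one_of_euler_eq_zero (by simpa only [Submodule.mem_bot] using e1)
    have := counit_of_isCoder hΔ x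
    rw [hc', map_smul, map_one, smul_eq_mul, mul_one] at this
    rw [hc', this, zero_smul]

/-- The graded commutator of coderivations of degree `1` and `-1`. -/
theorem isCoder_anticomm {f g : GSym gr →ₗ[K] V} (hf : HasDegree f 1) (hg : HasDegree g (-1)) :
    IsCoder 0 (coder f ∘ₗ coder g + coder g ∘ₗ coder f) := by
  have s0 : ∀ a : GSym gr, sgn 0 a = a := fun a =>
    LinearMap.congr_fun (f := (sgn 0).toLinearMap) (g := LinearMap.id)
      (hom_ext_degree fun n x hx => by simp [sgn_of_mem 0 hx]) a
  have s1 : ∀ a : GSym gr, sgn 1 (sgn (-1) a) = a := fun a =>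
    LinearMap.congr_fun (f := (sgn 1).toLinearMap ∘ₗ (sgn (-1)).toLinearMap) (g := LinearMap.id)
      (hom_ext_degree fun n x hx => by
        simp only [LinearMap.comp_apply, AlgHom.toLinearMap_apply, sgn_of_mem _ hx, map_smul,
          smul_smul, LinearMap.id_apply]
        rw [← zpow_add₀ (neg_ne_zero.2 one_ne_zero)]
        simp) a
  have s2 : ∀ a : GSym gr, sgn (-1) a = sgn 1 a := fun a =>
    LinearMap.congr_fun (f := (sgn (-1)).toLinearMap) (g := (sgn 1).toLinearMap)
      (hom_ext_degree fun n x hx => by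
        rcases zs (K := K) n with h | h <;> simp [sgn_of_mem _ hx, h]) a
  have a1 : ∀ a, coder f (sgn 1 a) = - sgn 1 (coder f a) := fun a => by
    simpa using apply_sgn (fun _ _ h => coder_mem_degree hf h) 1 a
  have a2 : ∀ a, coder g (sgn 1 a) = - sgn 1 (coder g a) := fun a => by
    have := apply_sgn (fun _ _ h => coder_mem_degree hg h) 1 a
    rw [this]; simp
  intro x
  rw [LinearMap.add_apply, LinearMap.comp_apply, LinearMap.comp_apply, map_add,
    isCoder_coder hf, isCoder_coder hg, isCoder_coder hg, isCoder_coder hf]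
  generalize comul x = z
  induction z with
  | zero => simp
  | add x y hx hy =>
    simp only [map_add] at hx hy ⊢
    rw [← hx, ← hy]; abel
  | tmul a b =>
    have h1 := s1 a
    rw [s2] at h1
    simp only [leibnizMap_tmul, map_add,
      LinearMap.add_apply, LinearMap.comp_apply, s2, a1, a2, s0, h1, TensorProduct.neg_tmul,
      TensorProduct.add_tmul, TensorProduct.tmul_add]
    abel

end coder

/-! ### Degree as an eigenvalue -/

section degree

variable (gr) in
/-- The coderivation of multiplication by `n` on elements of degree `n`. -/
def degOp : GSym gr →ₗ[K] GSym gr :=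
  coder (glift gr (fun i => (i : K) • (gr i).subtype) ∘ₗ proj)

theorem degOp_one : degOp gr 1 = 0 := by simp [degOp]

theorem degOp_ι_mul {i : ℤ} {v : V} (hv : v ∈ gr i) (x : GSym gr) :
    degOp gr (ι gr v * x) = (i : K) • (ι gr v * x) + ι gr v * degOp gr x := by
  have h : ∀ j, ∀ w ∈ gr j, glift gr (fun i => (i : K) • (gr i).subtype) w ∈ gr j := by
    intro j w hw
    rw [glift_of_mem _ hw]
    exact Submodule.smul_mem _ _ hw
  rw [degOp, coder_comp_proj_ι_mul h, glift_of_mem _ hv]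
  simp

theorem degOp_of_mem {n : ℤ} {x : GSym gr} (hx : x ∈ degree gr n) :
    degOp gr x = (n : K) • x := by
  induction hx using degree_induction with
  | one => simp [degOp_one]
  | zero n => simp
  | add n x y _ _ hx hy => simp [hx, hy]
  | smul n c x _ hx => rw [map_smul, hx, smul_comm]
  | mul i n v hv x _ hx =>
    rw [degOp_ι_mul hv, hx, mul_smul_comm, ← add_smul]
    push_cast; rfl

theorem iSup_degree : ⨆ n, degree gr n = ⊤ := by
  have := hom_ext_degree (gr := gr) (f := (⨆ n, degree gr n).mkQ) (g := 0) fun n x hx => by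
    simpa using Submodule.mem_iSup_of_mem n hx
  rw [← Submodule.ker_mkQ (⨆ n, degree gr n), this, LinearMap.ker_zero]

/-- The homogeneous elements span everything, and distinct integers stay distinct in characteristic
`0`. Independence of eigenspaces then leaves no room in the eigenspace of `n` beyond `degree gr n`.
-/
theorem mem_degree_iff [CharZero K] {n : ℤ} {x : GSym gr} :
    x ∈ degree gr n ↔ degOp gr x = (n : K) • x := by
  refine ⟨degOp_of_mem, fun h => ?_⟩
  have hx : x ∈ ⨆ n, degree gr n := iSup_degree (gr := gr) ▸ Submodule.mem_top
  have hx : x ∈ degree gr n ⊔ ⨆ m, ⨆ _ : m ≠ n, degree gr m := by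
    refine (iSup_le fun m => ?_ : (⨆ n, degree gr n) ≤ _) hx
    by_cases hm : m = n
    · subst hm; exact le_sup_left
    · exact le_sup_of_le_right (le_iSup₂_of_le m hm le_rfl)
  obtain ⟨a, ha, b, hb, rfl⟩ := Submodule.mem_sup.1 hx
  have hb1 : b ∈ Module.End.eigenspace (degOp gr) (n : K) := by
    rw [Module.End.mem_eigenspace_iff]
    rw [map_add, degOp_of_mem ha, smul_add] at h
    exact add_left_cancel h
  have hb2 : b ∈ ⨆ μ : K, ⨆ _ : μ ≠ n, Module.End.eigenspace (degOp gr) μ := by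
    refine (iSup₂_le fun m hm => ?_ : (⨆ m, ⨆ _ : m ≠ n, degree gr m) ≤ _) hb
    refine le_iSup₂_of_le (m : K) (by exact_mod_cast hm) fun y hy => ?_
    rw [Module.End.mem_eigenspace_iff]
    exact degOp_of_mem hy
  have := Submodule.disjoint_def.1 (Module.End.eigenspaces_iSupIndep (degOp gr) (n : K)) b hb1 hb2
  rw [this, add_zero]
  exact ha

theorem comm_degOp {Θ : GSym gr →ₗ[K] GSym gr'} (h : ∀ n, ∀ x ∈ degree gr n, Θ x ∈ degree gr' n)
    (x : GSym gr) : Θ (degOp gr x) = degOp gr' (Θ x) :=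
  LinearMap.congr_fun (f := Θ ∘ₗ degOp gr) (g := degOp gr' ∘ₗ Θ)
    (hom_ext_degree fun n x hx => by simp [degOp_of_mem hx, degOp_of_mem (h n x hx)]) x

/-- This is how degree preservation is checked for maps obtained by inversion or by spectral
projection, for which there is no formula on words. -/
theorem mem_degree_of_comm [CharZero K] {Θ : GSym gr →ₗ[K] GSym gr'}
    (h : ∀ x, Θ (degOp gr x) = degOp gr' (Θ x)) {n : ℤ} {x : GSym gr} (hx : x ∈ degree gr n) :
    Θ x ∈ degree gr' n := by
  rw [mem_degree_iff, ← h, degOp_of_mem hx, map_smul]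

end degree

end LInf.GSym

end

noncomputable section

namespace LInf

/-! ### Locally finite operators with eigenvalues in the natural numbers -/

section spectral

open Module.End

variable {K : Type*} [Field K]
variable {M : Type*} [AddCommGroup M] [Module K M]
variable {M' : Type*} [AddCommGroup M'] [Module K M']

theorem mem_maxGenEigenspace_of_apply_mem {T : M →ₗ[K] M} {μ : K} {x : M}
    (h : T x - μ • x ∈ maxGenEigenspace T μ) : x ∈ maxGenEigenspace T μ := by
  obtain ⟨n, hn⟩ := (mem_maxGenEigenspace T μ _).1 h
  refine (mem_maxGenEigenspace T μ _).2 ⟨n + 1, ?_⟩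
  rw [pow_succ, Module.End.mul_apply]
  simpa using hn

theorem mem_maxGenEigenspace_of_apply_eq {T : M →ₗ[K] M} {μ : K} {x : M}
    (h : T x = μ • x) : x ∈ maxGenEigenspace T μ :=
  mem_maxGenEigenspace_of_apply_mem (by rw [h, sub_self]; exact zero_mem _)

theorem maxGenEigenspace_intertwine {T : M →ₗ[K] M} {T' : M' →ₗ[K] M'} {f : M →ₗ[K] M'}
    (hf : ∀ x, f (T x) = T' (f x)) {μ : K} {x : M} (hx : x ∈ maxGenEigenspace T μ) :
    f x ∈ maxGenEigenspace T' μ := by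
  obtain ⟨n, hn⟩ := (mem_maxGenEigenspace T μ _).1 hx
  induction n generalizing x with
  | zero =>
    rw [pow_zero, Module.End.one_apply] at hn
    rw [hn, map_zero]
    exact zero_mem _
  | succ n ih =>
    rw [pow_succ, Module.End.mul_apply] at hn
    have := ih ((mem_maxGenEigenspace T μ _).2 ⟨n, hn⟩) hn
    refine mem_maxGenEigenspace_of_apply_mem ?_
    rw [← hf]
    simpa using this

/-- On the generalized `μ`-eigenspace, `T - ν` is the nonzero scalar `μ - ν` plus the locally
nilpotent `T - μ`, hence surjective. The preimage is built by induction on the order of nilpotency.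
-/
theorem exists_sub_smul_eq {T : M →ₗ[K] M} {μ ν : K} (h : μ ≠ ν) {x : M}
    (hx : x ∈ maxGenEigenspace T μ) : ∃ z ∈ maxGenEigenspace T μ, T z - ν • z = x := by
  obtain ⟨n, hn⟩ := (mem_maxGenEigenspace T μ _).1 hx
  induction n generalizing x with
  | zero =>
    rw [pow_zero, Module.End.one_apply] at hn
    exact ⟨0, zero_mem _, by simp [hn]⟩
  | succ n ih =>
    rw [pow_succ, Module.End.mul_apply] at hn
    have hm := (mem_maxGenEigenspace T μ _).2 ⟨n, hn⟩
    obtain ⟨z, hz, e⟩ := ih hm hn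
    have h0 : μ - ν ≠ 0 := sub_ne_zero.2 h
    refine ⟨(μ - ν)⁻¹ • (x - z), Submodule.smul_mem _ _ (sub_mem hx hz), ?_⟩
    rw [map_smul, map_sub, smul_comm ν, ← smul_sub, smul_sub ν, inv_smul_eq_iff₀ h0]
    have e2 : T z = T x - μ • x + ν • z := by
      rw [← sub_eq_iff_eq_add, e]; simp
    rw [e2]
    module

/-- `T` is locally finite with spectrum in the natural numbers. -/
def HasNatSpectrum (T : M →ₗ[K] M) : Prop :=
  ∀ x, x ∈ ⨆ k : ℕ, maxGenEigenspace T (k : K)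

/-- On the generalized eigenspaces for other eigenvalues `T - k` is surjective. So `T x - k x`
equals `T z - k z` modulo the generalized `k`-eigenspace for some `z` in the sum, and then `x - z`
lies in that eigenspace. This is the inductive step for proving `HasNatSpectrum` along a filtration
on which `T` is triangular. -/
theorem mem_iSup_of_sub_smul_mem {T : M →ₗ[K] M} (k : ℕ) {x : M}
    (h : T x - (k : K) • x ∈ ⨆ k : ℕ, maxGenEigenspace T (k : K)) :
    x ∈ ⨆ k : ℕ, maxGenEigenspace T (k : K) := by
  have key : ∀ u ∈ ⨆ k : ℕ, maxGenEigenspace T (k : K),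
      ∃ z ∈ ⨆ k : ℕ, maxGenEigenspace T (k : K),
        u - (T z - (k : K) • z) ∈ maxGenEigenspace T (k : K) := by
    intro u hu
    induction hu using Submodule.iSup_induction' with
    | mem j u hu =>
      by_cases hj : (j : K) = k
      · exact ⟨0, zero_mem _, by simpa [hj] using hu⟩
      · obtain ⟨z, hz, e⟩ := exists_sub_smul_eq hj hu
        exact ⟨z, Submodule.mem_iSup_of_mem j hz, by rw [e, sub_self]; exact zero_mem _⟩
    | zero => exact ⟨0, zero_mem _, by simp⟩
    | add a b _ _ ha hb =>
      obtain ⟨y, hy, e⟩ := ha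
      obtain ⟨z, hz, e'⟩ := hb
      refine ⟨y + z, add_mem hy hz, ?_⟩
      have := add_mem e e'
      rw [map_add]
      convert this using 1
      module
  obtain ⟨z, hz, e⟩ := key _ h
  have : x - z ∈ maxGenEigenspace T (k : K) := by
    refine mem_maxGenEigenspace_of_apply_mem ?_
    rw [map_sub]
    convert e using 1
    module
  have := add_mem (Submodule.mem_iSup_of_mem (p := fun k : ℕ => maxGenEigenspace T (k : K)) k this) hz
  rwa [sub_add_cancel] at this

/-- The sum of the generalized eigenspaces for positive natural numbers. -/
def posPart (T : M →ₗ[K] M) : Submodule K M := ⨆ k : ℕ, maxGenEigenspace T ((k + 1 : ℕ) : K)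

theorem isCompl_posPart [CharZero K] {T : M →ₗ[K] M} (h : HasNatSpectrum T) :
    IsCompl (maxGenEigenspace T (0 : K)) (posPart T) := by
  constructor
  · refine (Module.End.independent_maxGenEigenspace T 0).mono_right (iSup_le fun k => ?_)
    exact le_iSup₂_of_le ((k + 1 : ℕ) : K) (Nat.cast_ne_zero.2 k.succ_ne_zero) le_rfl
  · rw [codisjoint_iff, eq_top_iff]
    intro x _
    refine (iSup_le fun k => ?_ : (⨆ k : ℕ, maxGenEigenspace T (k : K)) ≤ _) (h x)
    cases k with
    | zero => rw [Nat.cast_zero]; exact le_sup_left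
    | succ k => exact le_sup_of_le_right (le_iSup_of_le k le_rfl)

/-- The projection onto the generalized `0`-eigenspace along the positive ones. -/
def nilProj [CharZero K] {T : M →ₗ[K] M} (h : HasNatSpectrum T) : M →ₗ[K] M :=
  (maxGenEigenspace T (0 : K)).projection (posPart T) (isCompl_posPart h)

section
variable [CharZero K] {T : M →ₗ[K] M} (h : HasNatSpectrum T)

theorem nilProj_mem (x : M) : nilProj h x ∈ maxGenEigenspace T (0 : K) :=
  Submodule.projection_apply_mem _ _

theorem nilProj_of_mem {x : M} (hx : x ∈ maxGenEigenspace T (0 : K)) : nilProj h x = x :=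
  Submodule.projection_apply_of_mem_left _ hx

theorem nilProj_of_mem_posPart {x : M} (hx : x ∈ posPart T) : nilProj h x = 0 :=
  (Submodule.projection_apply_eq_zero_iff _).2 hx

theorem nilProj_of_mem_succ {k : ℕ} {x : M} (hx : x ∈ maxGenEigenspace T ((k + 1 : ℕ) : K)) :
    nilProj h x = 0 :=
  nilProj_of_mem_posPart h
    (Submodule.mem_iSup_of_mem (p := fun k : ℕ => maxGenEigenspace T ((k + 1 : ℕ) : K)) k hx)

/-- Intertwining maps respect each generalized eigenspace, hence both summands of the decomposition.
Compatibility of the spectral projection with codifferentials, coproducts, degrees and functoriality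
is always deduced from this. -/
theorem nilProj_intertwine {T' : M' →ₗ[K] M'} (h' : HasNatSpectrum T') {f : M →ₗ[K] M'}
    (hf : ∀ x, f (T x) = T' (f x)) (x : M) : f (nilProj h x) = nilProj h' (f x) := by
  induction h x using Submodule.iSup_induction' with
  | mem k x hx =>
    cases k with
    | zero =>
      rw [Nat.cast_zero] at hx
      rw [nilProj_of_mem h hx, nilProj_of_mem h' (maxGenEigenspace_intertwine hf hx)]
    | succ k =>
      rw [nilProj_of_mem_succ h hx, nilProj_of_mem_succ h' (maxGenEigenspace_intertwine hf hx),
        map_zero]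
  | zero => simp
  | add a b _ _ ha hb => simp only [map_add, ha, hb]

end

/-- The operator `T ⊗ 1 + 1 ⊗ T`. -/
def tensorOp (T : M →ₗ[K] M) : M ⊗[K] M →ₗ[K] M ⊗[K] M :=
  TensorProduct.map T LinearMap.id + TensorProduct.map LinearMap.id T

theorem tensorOp_tmul (T : M →ₗ[K] M) (x y : M) :
    tensorOp T (x ⊗ₜ y) = T x ⊗ₜ y + x ⊗ₜ T y := rfl

/-- The operator `tensorOp T - (μ + ν)` is the sum of `(T - μ) ⊗ 1` and `1 ⊗ (T - ν)`, each lowering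
one of the two orders of nilpotency. This gives a double induction. -/
theorem tmul_mem_maxGenEigenspace {T : M →ₗ[K] M} {μ ν : K} {x y : M}
    (hx : x ∈ maxGenEigenspace T μ) (hy : y ∈ maxGenEigenspace T ν) :
    x ⊗ₜ[K] y ∈ maxGenEigenspace (tensorOp T) (μ + ν) := by
  obtain ⟨m, hm⟩ := (mem_maxGenEigenspace T μ _).1 hx
  obtain ⟨n, hn⟩ := (mem_maxGenEigenspace T ν _).1 hy
  clear hx hy
  induction m generalizing x y n with
  | zero =>
    rw [pow_zero, Module.End.one_apply] at hm
    rw [hm, TensorProduct.zero_tmul]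
    exact zero_mem _
  | succ m ih =>
    induction n generalizing y with
    | zero =>
      rw [pow_zero, Module.End.one_apply] at hn
      rw [hn, TensorProduct.tmul_zero]
      exact zero_mem _
    | succ n ih' =>
      refine mem_maxGenEigenspace_of_apply_mem ?_
      have h1 := ih (x := (T - μ • 1) x) (y := y)
        (by rwa [pow_succ, Module.End.mul_apply] at hm) (n + 1) hn
      have h2 := ih' (y := (T - ν • 1) y) (by rwa [pow_succ, Module.End.mul_apply] at hn)
      convert add_mem h1 h2 using 1
      simp only [tensorOp_tmul, LinearMap.sub_apply, LinearMap.smul_apply, Module.End.one_apply,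
        TensorProduct.sub_tmul, TensorProduct.tmul_sub, TensorProduct.smul_tmul',
        TensorProduct.tmul_smul, add_smul]
      abel

theorem iSup_induction_tmul {T : M →ₗ[K] M} (h : HasNatSpectrum T)
    {p : M ⊗[K] M → Prop} (zero : p 0) (add : ∀ x y, p x → p y → p (x + y))
    (tmul : ∀ i j : ℕ, ∀ x ∈ maxGenEigenspace T (i : K), ∀ y ∈ maxGenEigenspace T (j : K),
      p (x ⊗ₜ y)) (z : M ⊗[K] M) : p z := by
  induction z with
  | zero => exact zero
  | add x y hx hy => exact add x y hx hy
  | tmul x y =>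
    induction h x using Submodule.iSup_induction' with
    | zero => rwa [TensorProduct.zero_tmul]
    | add a b _ _ ha hb => rw [TensorProduct.add_tmul]; exact add _ _ ha hb
    | mem i x hx =>
      induction h y using Submodule.iSup_induction' with
      | zero => rwa [TensorProduct.tmul_zero]
      | add a b _ _ ha hb => rw [TensorProduct.tmul_add]; exact add _ _ ha hb
      | mem j y hy => exact tmul i j x hx y hy

theorem hasNatSpectrum_tensorOp {T : M →ₗ[K] M} (h : HasNatSpectrum T) :
    HasNatSpectrum (tensorOp T) := by
  refine iSup_induction_tmul h (zero_mem _) (fun _ _ => add_mem) fun i j x hx y hy => ?_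
  refine Submodule.mem_iSup_of_mem (i + j) ?_
  rw [Nat.cast_add]
  exact tmul_mem_maxGenEigenspace hx hy

/-- A tensor with eigenvalues `i` and `j` has eigenvalue `i + j`, which for natural numbers vanishes
only if both do. Spectra in `ℕ` are needed exactly here: opposite nonzero eigenvalues would
contribute to the left side only. -/
theorem nilProj_tensorOp [CharZero K] {T : M →ₗ[K] M} (h : HasNatSpectrum T)
    (h' : HasNatSpectrum (tensorOp T)) (z : M ⊗[K] M) :
    nilProj h' z = TensorProduct.map (nilProj h) (nilProj h) z := by
  induction z using iSup_induction_tmul h with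
  | zero => simp
  | add x y hx hy => rw [map_add, map_add, hx, hy]
  | tmul i j x hx y hy =>
    have := tmul_mem_maxGenEigenspace hx hy
    rw [← Nat.cast_add] at this
    rw [TensorProduct.map_tmul]
    rcases i with - | i
    · rcases j with - | j
      · simp only [Nat.cast_zero, add_zero] at hx hy this
        rw [nilProj_of_mem h' this, nilProj_of_mem h hx, nilProj_of_mem h hy]
      · rw [nilProj_of_mem_succ h hy, TensorProduct.tmul_zero]
        exact nilProj_of_mem_succ h' (k := j) (by rwa [zero_add] at this)
    · rw [nilProj_of_mem_succ h hx, TensorProduct.zero_tmul]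
      exact nilProj_of_mem_succ h' (k := i + j) (by rwa [Nat.add_right_comm] at this)

end spectral

end LInf

end

/-! ### Homotopy transfer along a contraction -/

noncomputable section

namespace LInf

open GSym Module.End

/-- A contraction of the complex underlying an `L_∞`-algebra onto a graded space: the maps `s` and
`p` are degree preserving with `p s = 1`, and `h` is a homotopy from `s p` to the identity. -/
structure Contraction {K : Type u} [Field K] (A : LInfAlg.{u, v} K) where
  carrier : Type v
  [addCommGroup : AddCommGroup carrier]
  [module : Module K carrier]
  gr : ℤ → Submodule K carrier
  [dec : Decomposition gr]
  s : carrier →ₗ[K] A.carrier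
  p : A.carrier →ₗ[K] carrier
  h : A.carrier →ₗ[K] A.carrier
  s_mem : ∀ i, ∀ x ∈ gr i, s x ∈ A.gr i
  p_mem : ∀ i, ∀ x ∈ A.gr i, p x ∈ gr i
  h_mem : ∀ i, ∀ x ∈ A.gr i, h x ∈ A.gr (i - 1)
  p_s : ∀ x, p (s x) = x
  homotopy : ∀ x, A.q (ι _ (h x)) + h (A.q (ι _ x)) = x - s (p x)

namespace Contraction

attribute [instance] Contraction.addCommGroup Contraction.module Contraction.dec

section field
variable {K : Type u} [Field K] {A : LInfAlg.{u, v} K} (C : Contraction A)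

/-- The symmetric coalgebra of the retract. -/
abbrev S : Type _ := GSym (shift C.gr 1)

theorem s_mem_shift (i : ℤ) (x : C.carrier) (hx : x ∈ shift C.gr 1 i) :
    C.s x ∈ shift A.gr 1 i := C.s_mem _ x hx

theorem p_mem_shift (i : ℤ) (x : A.carrier) (hx : x ∈ shift A.gr 1 i) :
    C.p x ∈ shift C.gr 1 i := C.p_mem _ x hx

/-- The algebra homomorphism induced by `s`. -/
def mapS : C.S →ₐ[K] A.S := GSym.map C.s C.s_mem_shift

/-- The algebra homomorphism induced by `p`. -/
def mapP : A.S →ₐ[K] C.S := GSym.map C.p C.p_mem_shift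

theorem mapS_ι (x : C.carrier) : C.mapS (ι _ x) = ι _ (C.s x) := GSym.map_ι _ _ x

theorem mapP_ι (x : A.carrier) : C.mapP (ι _ x) = ι _ (C.p x) := GSym.map_ι _ _ x

theorem mapP_mapS (x : C.S) : C.mapP (C.mapS x) = x := by
  induction x using GSym.induction with
  | one => simp
  | add x y hx hy => simp only [map_add, hx, hy]
  | smul c x hx => simp only [map_smul, hx]
  | mul i v hv x hx => rw [map_mul, map_mul, hx, mapS_ι, mapP_ι, p_s]

/-- The projection onto the contractible summand. -/
def e : A.carrier →ₗ[K] A.carrier := LinearMap.id - C.s ∘ₗ C.p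

theorem e_apply (x : A.carrier) : C.e x = x - C.s (C.p x) := rfl

theorem e_s (x : C.carrier) : C.e (C.s x) = 0 := by rw [e_apply, p_s, sub_self]

theorem e_e (x : A.carrier) : C.e (C.e x) = C.e x := by
  conv_lhs => rw [C.e_apply x, map_sub, e_s, sub_zero]

theorem e_mem (i : ℤ) (x : A.carrier) (hx : x ∈ shift A.gr 1 i) : C.e x ∈ shift A.gr 1 i :=
  sub_mem hx (C.s_mem_shift i _ (C.p_mem_shift i x hx))

/-- The coderivation extending the homotopy. -/
def η : A.S →ₗ[K] A.S := coder (C.h ∘ₗ proj)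

theorem hasDegree_h : HasDegree (C.h ∘ₗ proj (gr := shift A.gr 1)) (-1) :=
  hasDegree_comp_proj fun i x hx => by
    have := C.h_mem _ x hx
    rwa [show i + 1 - 1 = i + -1 + 1 by ring] at this

/-- The commutator of the codifferential and the coderivation extending the homotopy. -/
def D : A.S →ₗ[K] A.S := A.Q ∘ₗ C.η + C.η ∘ₗ A.Q

theorem D_apply (x : A.S) : C.D x = A.Q (C.η x) + C.η (A.Q x) := rfl

theorem D_one : C.D 1 = 0 := by
  simp [D, η, LInfAlg.Q, A.q_one]

theorem D_ι (x : A.carrier) : C.D (ι _ x) = ι _ (C.e x) := by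
  have h1 : (C.h ∘ₗ proj) (1 : A.S) = 0 := by simp
  rw [D_apply, η, LInfAlg.Q_ι, coder_ι h1, coder_ι h1]
  simp only [LinearMap.comp_apply, proj_ι]
  rw [LInfAlg.Q_ι, ← map_add, C.homotopy, e_apply]

theorem Q_D (x : A.S) : A.Q (C.D x) = C.D (A.Q x) := by
  have h : ∀ y, A.Q (A.Q y) = 0 := LinearMap.congr_fun A.coder_sq
  simp [D_apply, h]

theorem isCoder_D : IsCoder 0 C.D := isCoder_anticomm A.q_degree C.hasDegree_h

theorem D_mem_degree (n : ℤ) (x : A.S) (hx : x ∈ degree (shift A.gr 1) n) :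
    C.D x ∈ degree (shift A.gr 1) n := by
  have h1 := coder_mem_degree A.q_degree (coder_mem_degree C.hasDegree_h hx)
  have h2 := coder_mem_degree C.hasDegree_h (coder_mem_degree A.q_degree hx)
  rw [show n + -1 + 1 = n by ring] at h1
  rw [show n + 1 + -1 = n by ring] at h2
  exact add_mem h1 h2

theorem comul_D (x : A.S) : comul (C.D x) = tensorOp C.D (comul x) := by
  rw [C.isCoder_D x]
  have s0 : ∀ a : A.S, sgn 0 a = a := fun a =>
    LinearMap.congr_fun (f := (sgn 0).toLinearMap) (g := LinearMap.id)
      (hom_ext_degree fun n x hx => by simp [sgn_of_mem 0 hx]) a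
  generalize comul x = z
  induction z with
  | zero => simp
  | add x y hx hy => rw [map_add, map_add, hx, hy]
  | tmul a b => rw [leibnizMap_tmul, tensorOp_tmul, s0]

/-- The coderivation extending `e`. -/
def D₀ : A.S →ₗ[K] A.S := coder (C.e ∘ₗ proj)

theorem D₀_one : C.D₀ 1 = 0 := coder_comp_proj_one _

theorem D₀_ι_mul (v : A.carrier) (x : A.S) :
    C.D₀ (ι _ v * x) = ι _ (C.e v) * x + ι _ v * C.D₀ x :=
  coder_comp_proj_ι_mul C.e_mem v x

theorem D₀_mapS (x : C.S) : C.D₀ (C.mapS x) = 0 := by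
  induction x using GSym.induction with
  | one => rw [map_one, D₀_one]
  | add x y hx hy => rw [map_add, map_add, hx, hy, add_zero]
  | smul c x hx => rw [map_smul, map_smul, hx, smul_zero]
  | mul i v hv x hx =>
    rw [map_mul, mapS_ι, D₀_ι_mul, hx, e_s, map_zero, zero_mul, mul_zero, add_zero]

/-- Every letter splits as `v = s (p v) + e v`, and `D₀` counts the letters of the second kind.
Words with none of them come from the retract, and prepending a letter raises the eigenvalue by `0`
or `1`. -/
theorem wordFil_le_eigenspaces (n : ℕ) : wordFil (shift A.gr 1) n ≤
    wordFil (shift A.gr 1) n ⊓ LinearMap.range C.mapS.toLinearMap ⊔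
      ⨆ k : ℕ, wordFil (shift A.gr 1) n ⊓ eigenspace C.D₀ ((k + 1 : ℕ) : K) := by
  induction n with
  | zero =>
    intro x hx
    obtain ⟨c, rfl⟩ := mem_wordFil_zero.1 hx
    exact Submodule.mem_sup_left ⟨hx, c • 1, by simp⟩
  | succ n ih =>
    refine wordFil_succ_le (ih.trans (sup_le_sup ?_ (iSup_mono fun k => ?_))) fun v x hx => ?_
    · exact inf_le_inf_right _ (wordFil_mono n.le_succ)
    · exact inf_le_inf_right _ (wordFil_mono n.le_succ)
    · set Z : Submodule K A.S := wordFil (shift A.gr 1) (n + 1) ⊓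
          LinearMap.range C.mapS.toLinearMap ⊔
        ⨆ k : ℕ, wordFil (shift A.gr 1) (n + 1) ⊓ eigenspace C.D₀ ((k + 1 : ℕ) : K) with hZ
      have heig : ∀ (k : ℕ) (y : A.S), y ∈ wordFil (shift A.gr 1) (n + 1) →
          C.D₀ y = ((k + 1 : ℕ) : K) • y → y ∈ Z := fun k y hy hy' =>
        Submodule.mem_sup_right (Submodule.mem_iSup_of_mem
          (p := fun k : ℕ => wordFil (shift A.gr 1) (n + 1) ⊓ eigenspace C.D₀ ((k + 1 : ℕ) : K)) k
          ⟨hy, mem_eigenspace_iff.2 hy'⟩)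
      have hv : v = C.s (C.p v) + C.e v := by rw [e_apply]; abel
      obtain ⟨a, ha, b, hb, rfl⟩ := Submodule.mem_sup.1 (ih hx)
      clear hx
      rw [mul_add]
      refine add_mem ?_ ?_
      · obtain ⟨ha', y, rfl⟩ := ha
        rw [hv, map_add, add_mul]
        refine add_mem (Submodule.mem_sup_left ⟨ι_mul_mem_wordFil _ ha', ?_⟩)
          (heig 0 _ (ι_mul_mem_wordFil _ ha') ?_)
        · exact ⟨ι _ (C.p v) * y, by simp [mapS_ι]⟩
        · rw [D₀_ι_mul, e_e, AlgHom.toLinearMap_apply, D₀_mapS]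
          simp
      · induction hb using Submodule.iSup_induction' with
        | zero => simp
        | add x y _ _ hx hy => rw [mul_add]; exact add_mem hx hy
        | mem k x hx =>
          obtain ⟨hx, hx'⟩ := hx
          replace hx' := mem_eigenspace_iff.1 hx'
          rw [hv, map_add, add_mul]
          refine add_mem (heig k _ (ι_mul_mem_wordFil _ hx) ?_)
            (heig (k + 1) _ (ι_mul_mem_wordFil _ hx) ?_)
          · rw [D₀_ι_mul, e_s, hx', map_zero, zero_mul, zero_add, mul_smul_comm]
          · rw [D₀_ι_mul, e_e, hx', mul_smul_comm]
            push_cast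
            module

end field

variable {K : Type u} [Field K] [CharZero K] {A : LInfAlg.{u, v} K} (C : Contraction A)

theorem D_eq_coder : coder (proj ∘ₗ C.D) = C.D :=
  coder_proj_eq C.isCoder_D fun n x hx => by
    have := hasDegree_proj n _ (C.D_mem_degree n x hx)
    simpa using this

theorem D_mem_wordFil {n : ℕ} {x : A.S} (hx : x ∈ wordFil (shift A.gr 1) n) :
    C.D x ∈ wordFil (shift A.gr 1) n := by
  rw [← D_eq_coder]
  exact coder_mem_wordFil (by simp [D_one]) hx

/-- The two coderivations agree on letters by `D_ι`, so the corestriction of their difference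
vanishes there and the difference shortens words. -/
theorem D_sub_D₀_mem {n : ℕ} {x : A.S} (hx : x ∈ wordFil (shift A.gr 1) (n + 1)) :
    C.D x - C.D₀ x ∈ wordFil (shift A.gr 1) n := by
  have : C.D x - C.D₀ x = coder (proj ∘ₗ C.D - C.e ∘ₗ proj) x := by
    rw [coder_sub, D_eq_coder]; rfl
  rw [this]
  exact coder_mem_wordFil_of_linear_zero (by simp [D_one]) (by simp [D_ι]) hx

/-- Modulo shorter words `D` agrees with `D₀`, which is diagonalizable with natural eigenvalues.
Induction on word length through `mem_iSup_of_sub_smul_mem` transports this to generalized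
eigenvectors of `D`. -/
theorem hasNatSpectrum_D : HasNatSpectrum C.D := by
  suffices h : ∀ n, wordFil (shift A.gr 1) n ≤ ⨆ k : ℕ, maxGenEigenspace C.D (k : K) by
    intro x
    obtain ⟨n, hn⟩ := exists_mem_wordFil x
    exact h n hn
  intro n
  induction n with
  | zero =>
    intro x hx
    obtain ⟨c, rfl⟩ := mem_wordFil_zero.1 hx
    exact mem_iSup_of_sub_smul_mem 0 (by simp [D_one])
  | succ n ih =>
    refine (C.wordFil_le_eigenspaces (n + 1)).trans (sup_le ?_ (iSup_le fun k => ?_))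
    · rintro x ⟨hx, y, rfl⟩
      refine mem_iSup_of_sub_smul_mem 0 (ih ?_)
      have := C.D_sub_D₀_mem hx
      rw [AlgHom.toLinearMap_apply, D₀_mapS] at this
      simpa using this
    · rintro x ⟨hx, hx'⟩
      refine mem_iSup_of_sub_smul_mem (k + 1) (ih ?_)
      rw [← mem_eigenspace_iff.1 hx']
      exact C.D_sub_D₀_mem hx

/-- The projection onto the generalized kernel of `D`, as a morphism of coalgebras. -/
def proj₀ : A.S →ₗc[K] A.S where
  toLinearMap := nilProj C.hasNatSpectrum_D
  counit_comp := by
    refine LinearMap.ext fun x => ?_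
    -- The counit kills the values of the coderivation `D`, so it intertwines `D` with the zero
    -- operator on `K`, whose spectral projection is the identity.
    have h0 : HasNatSpectrum (0 : K →ₗ[K] K) := fun x =>
      Submodule.mem_iSup_of_mem 0 (mem_maxGenEigenspace_of_apply_eq (by simp))
    have h1 : ∀ x : A.S, counit.toLinearMap (C.D x) = (0 : K →ₗ[K] K) (counit.toLinearMap x) :=
      fun x => counit_of_isCoder C.isCoder_D x
    refine (nilProj_intertwine C.hasNatSpectrum_D h0 h1 x).trans ?_
    exact nilProj_of_mem h0 (mem_maxGenEigenspace_of_apply_eq (by simp))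
  map_comp_comul := by
    refine LinearMap.ext fun x => ?_
    have h0 := hasNatSpectrum_tensorOp C.hasNatSpectrum_D
    refine ((nilProj_tensorOp C.hasNatSpectrum_D h0 (comul x)).symm).trans ?_
    exact (nilProj_intertwine C.hasNatSpectrum_D h0 C.comul_D x).symm

theorem proj₀_mem (x : A.S) : C.proj₀ x ∈ maxGenEigenspace C.D (0 : K) :=
  nilProj_mem C.hasNatSpectrum_D x

theorem proj₀_of_mem {x : A.S} (hx : x ∈ maxGenEigenspace C.D (0 : K)) : C.proj₀ x = x :=
  nilProj_of_mem C.hasNatSpectrum_D hx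

theorem proj₀_one : C.proj₀ 1 = 1 :=
  C.proj₀_of_mem (mem_maxGenEigenspace_of_apply_eq (by rw [D_one, zero_smul]))

theorem proj₀_comm {B : LInfAlg.{u, v} K} {C' : Contraction B} {f : A.S →ₗ[K] B.S}
    (hf : ∀ x, f (C.D x) = C'.D (f x)) (x : A.S) : f (C.proj₀ x) = C'.proj₀ (f x) :=
  nilProj_intertwine C.hasNatSpectrum_D C'.hasNatSpectrum_D hf x

theorem Q_proj₀ (x : A.S) : A.Q (C.proj₀ x) = C.proj₀ (A.Q x) := C.proj₀_comm C.Q_D x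

theorem degOp_proj₀ (x : A.S) :
    C.proj₀ (degOp _ x) = degOp _ (C.proj₀ x) :=
  (C.proj₀_comm (C' := C) (f := degOp _) (fun x => (comm_degOp C.D_mem_degree x).symm) x).symm

theorem D_proj₀ (x : A.S) : C.D (C.proj₀ x) = C.proj₀ (C.D x) := C.proj₀_comm (fun _ => rfl) x

theorem proj₀_ι (x : A.carrier) : C.proj₀ (ι _ x) = ι _ (C.s (C.p x)) := by
  have hx : ι (shift A.gr 1) x = ι _ (C.s (C.p x)) + ι _ (C.e x) := by
    rw [← map_add, e_apply, add_sub_cancel]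
  have h1 : C.proj₀ (ι _ (C.e x)) = 0 := nilProj_of_mem_succ C.hasNatSpectrum_D (k := 0)
    (mem_maxGenEigenspace_of_apply_eq (by rw [D_ι, e_e]; simp))
  rw [hx, map_add, h1, add_zero]
  exact C.proj₀_of_mem (mem_maxGenEigenspace_of_apply_eq (by rw [D_ι, e_s]; simp))

/-- The comparison of the symmetric coalgebra of the retract with the generalized kernel of `D`. -/
def J : C.S →ₗc[K] A.S := C.proj₀.comp (mapCoalgHom C.s C.s_mem_shift)

theorem J_apply (x : C.S) : C.J x = C.proj₀ (C.mapS x) := rfl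

theorem J_mem (x : C.S) : C.J x ∈ maxGenEigenspace C.D (0 : K) := C.proj₀_mem _

/-- The endomorphism `S(p) π S(s)`. -/
def U : C.S →ₗc[K] C.S := (mapCoalgHom C.p C.p_mem_shift).comp C.J

theorem U_apply (x : C.S) : C.U x = C.mapP (C.J x) := rfl

theorem J_ι (x : C.carrier) : C.J (ι _ x) = ι _ (C.s x) := by
  rw [J_apply, mapS_ι, proj₀_ι, p_s]

theorem J_one : C.J 1 = 1 := by rw [J_apply, map_one, proj₀_one]

theorem U_one : C.U 1 = 1 := by rw [U_apply, J_one, map_one]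

theorem U_ι (x : C.carrier) : C.U (ι _ x) = ι _ x := by rw [U_apply, J_ι, mapP_ι, p_s]

/-- The projection may add shorter words to `S(s) x`, so `U` need not be the identity. It fixes
letters, which is enough for bijectivity. -/
theorem U_bijective : Function.Bijective C.U := unipotent_bijective C.U_one C.U_ι

/-- On the `T`-stable span of `x` the operator `T` is nilpotent, so `T - c` is invertible there for
`c ≠ 0`; this persists modulo the stable subspace `Z`. -/
theorem mem_of_nilpotent {M : Type*} [AddCommGroup M] [Module K M] {T : M →ₗ[K] M}
    {Z : Submodule K M} (hZ : ∀ z ∈ Z, T z ∈ Z) {c : K} (hc : c ≠ 0) {x : M}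
    (hx : x ∈ maxGenEigenspace T (0 : K)) (h : T x - c • x ∈ Z) : x ∈ Z := by
  obtain ⟨m, hm⟩ := (mem_maxGenEigenspace T 0 _).1 hx
  rw [zero_smul, sub_zero] at hm
  clear hx
  induction m generalizing x with
  | zero =>
    rw [pow_zero, Module.End.one_apply] at hm
    rw [hm]; exact zero_mem _
  | succ m ih =>
    rw [pow_succ, Module.End.mul_apply] at hm
    have h1 : T x ∈ Z := ih (x := T x) (by simpa using hZ _ h) hm
    have h2 := sub_mem h1 h
    rw [sub_sub_cancel] at h2
    exact (Submodule.smul_mem_iff _ hc).1 h2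

/-- An eigenvector of `D₀` with eigenvalue `k + 1` satisfies `D x = (k + 1) x` modulo shorter words.
After projection `D` becomes nilpotent on it, so its projection already is the projection of a
shorter word. Thus only words from the retract matter. -/
theorem proj₀_mem_range_J (x : A.S) : C.proj₀ x ∈ LinearMap.range C.J.toLinearMap := by
  suffices h : ∀ n, wordFil (shift A.gr 1) n ≤
      (LinearMap.range C.J.toLinearMap).comap C.proj₀.toLinearMap by
    obtain ⟨n, hn⟩ := exists_mem_wordFil x
    exact h n hn
  intro n
  induction n with
  | zero =>
    intro x hx
    obtain ⟨c, rfl⟩ := mem_wordFil_zero.1 hx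
    refine Submodule.smul_mem _ c ⟨1, ?_⟩
    exact C.J_one.trans C.proj₀_one.symm
  | succ n ih =>
    refine (C.wordFil_le_eigenspaces (n + 1)).trans (sup_le ?_ (iSup_le fun k => ?_))
    · rintro x ⟨hx, y, rfl⟩
      exact ⟨y, rfl⟩
    · rintro x ⟨hx, hx'⟩
      have hk : C.D x - ((k + 1 : ℕ) : K) • x ∈ wordFil (shift A.gr 1) n := by
        rw [← mem_eigenspace_iff.1 hx']
        exact C.D_sub_D₀_mem hx
      have h1 : (wordFil (shift A.gr 1) n).map C.proj₀.toLinearMap ≤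
        LinearMap.range C.J.toLinearMap := Submodule.map_le_iff_le_comap.2 ih
      refine h1 (mem_of_nilpotent (T := C.D) (c := ((k + 1 : ℕ) : K)) ?_
        (Nat.cast_ne_zero.2 k.succ_ne_zero) (C.proj₀_mem x) ?_)
      · rintro _ ⟨z, hz, rfl⟩
        exact ⟨C.D z, C.D_mem_wordFil hz, (C.D_proj₀ z).symm⟩
      · refine ⟨_, hk, ?_⟩
        change C.proj₀ _ = C.D (C.proj₀ x) - ((k + 1 : ℕ) : K) • C.proj₀ x
        rw [map_sub, map_smul, D_proj₀]

/-- The generalized kernel is the image of `J`, and `S(p) J = U` is injective. -/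
theorem mapP_injOn {x y : A.S} (hx : x ∈ maxGenEigenspace C.D (0 : K))
    (hy : y ∈ maxGenEigenspace C.D (0 : K)) (h : C.mapP x = C.mapP y) : x = y := by
  obtain ⟨a, ha⟩ := C.proj₀_mem_range_J x
  obtain ⟨b, hb⟩ := C.proj₀_mem_range_J y
  rw [proj₀_of_mem C hx] at ha
  rw [proj₀_of_mem C hy] at hb
  have ha' : C.J a = x := ha
  have hb' : C.J b = y := hb
  have : C.U a = C.U b := by rw [U_apply, U_apply, ha', hb', h]
  rw [← ha', ← hb', C.U_bijective.1 this]

/-- The morphism from the symmetric coalgebra of the retract inverse to `S(p)` on the generalized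
kernel of `D`. -/
def incl : C.S →ₗc[K] A.S :=
  C.J.comp ((CoalgEquiv.ofBijective C.U_bijective).symm : C.S →ₗc[K] C.S)

theorem exists_incl (x : C.S) : ∃ y, x = C.U y ∧ C.incl x = C.J y :=
  ⟨(CoalgEquiv.ofBijective C.U_bijective).symm x,
    ((CoalgEquiv.ofBijective C.U_bijective).apply_symm_apply x).symm, rfl⟩

theorem incl_mem (x : C.S) : C.incl x ∈ maxGenEigenspace C.D (0 : K) := C.J_mem _

theorem mapP_incl (x : C.S) : C.mapP (C.incl x) = x := by
  obtain ⟨y, hy, e⟩ := C.exists_incl x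
  rw [e, hy, U_apply]

theorem eq_incl {x : C.S} {y : A.S} (hy : y ∈ maxGenEigenspace C.D (0 : K))
    (h : C.mapP y = x) : C.incl x = y :=
  C.mapP_injOn (C.incl_mem x) hy (by rw [mapP_incl, h])

theorem incl_mapP {x : A.S} (hx : x ∈ maxGenEigenspace C.D (0 : K)) :
    C.incl (C.mapP x) = x := C.eq_incl hx rfl

theorem incl_ι (x : C.carrier) : C.incl (ι _ x) = ι _ (C.s x) := by
  rw [← C.J_ι]
  exact C.eq_incl (C.J_mem _) (C.U_ι x)

theorem incl_one : C.incl 1 = 1 := by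
  rw [← C.J_one]
  exact C.eq_incl (C.J_mem _) C.U_one

theorem mapP_degOp (x : A.S) : C.mapP (degOp _ x) = degOp _ (C.mapP x) :=
  comm_degOp (Θ := C.mapP.toLinearMap) (fun _ _ hx => map_mem_degree _ _ hx) x

theorem degOp_mem {x : A.S} (hx : x ∈ maxGenEigenspace C.D (0 : K)) :
    degOp _ x ∈ maxGenEigenspace C.D (0 : K) := by
  rw [← C.proj₀_of_mem hx, ← degOp_proj₀]
  exact C.proj₀_mem _

/-- As `incl` involves the inverse of `U`, its degree is read off from commutation with `degOp`. The
generalized kernel is stable under `degOp`, and `S(p)` is injective on it. -/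
theorem incl_mem_degree (n : ℤ) (x : C.S) (hx : x ∈ degree (shift C.gr 1) n) :
    C.incl x ∈ degree (shift A.gr 1) n :=
  mem_degree_of_comm (Θ := C.incl.toLinearMap)
    (fun x => C.eq_incl (C.degOp_mem (C.incl_mem x))
      ((C.mapP_degOp _).trans (congrArg _ (C.mapP_incl x)))) hx

theorem proj₀_mem_degree (n : ℤ) (x : A.S) (hx : x ∈ degree (shift A.gr 1) n) :
    C.proj₀ x ∈ degree (shift A.gr 1) n :=
  mem_degree_of_comm (Θ := C.proj₀.toLinearMap) C.degOp_proj₀ hx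

theorem Q_mem {x : A.S} (hx : x ∈ maxGenEigenspace C.D (0 : K)) :
    A.Q x ∈ maxGenEigenspace C.D (0 : K) := by
  rw [← C.proj₀_of_mem hx, Q_proj₀]
  exact C.proj₀_mem _

/-- The transferred codifferential. -/
def transferQ : C.S →ₗ[K] C.S := C.mapP.toLinearMap ∘ₗ A.Q ∘ₗ C.incl.toLinearMap

theorem transferQ_apply (x : C.S) : C.transferQ x = C.mapP (A.Q (C.incl x)) := rfl

theorem transferQ_mem_degree (n : ℤ) (x : C.S) (hx : x ∈ degree (shift C.gr 1) n) :
    C.transferQ x ∈ degree (shift C.gr 1) (n + 1) :=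
  map_mem_degree _ _ (coder_mem_degree A.q_degree (C.incl_mem_degree n x hx))

/-- The co-Leibniz rule for `Q` passes through the coalgebra morphisms `incl` and `S(p)`. The
factors not touched by `Q` are restored because `S(p)` undoes `incl`. -/
theorem isCoder_transferQ : IsCoder 1 C.transferQ := by
  intro x
  rw [transferQ_apply, mapP, comul_map, LInfAlg.Q, isCoder_coder A.q_degree, comul_coalgHom]
  generalize comul x = z
  induction z with
  | zero => simp
  | add x y hx hy => simp only [map_add, hx, hy]
  | tmul a b =>
    rw [TensorProduct.map_tmul, leibnizMap_tmul, leibnizMap_tmul, map_add, TensorProduct.map_tmul,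
      TensorProduct.map_tmul]
    refine congrArg₂ (· + ·) (congrArg₂ _ rfl (C.mapP_incl b)) (congrArg₂ _ ?_ rfl)
    exact (map_sgn _ _ 1 _).trans (congrArg (sgn 1) (C.mapP_incl a))

theorem coder_transferQ : coder (proj ∘ₗ C.transferQ) = C.transferQ :=
  coder_proj_eq C.isCoder_transferQ fun n x hx => by
    have := hasDegree_proj _ _ (C.transferQ_mem_degree n x hx)
    rwa [add_zero] at this

/-- Since `Q` commutes with `D`, it preserves the generalized kernel, where `incl` undoes `S(p)`.
This makes the transferred operator square to zero and `incl` an `L_∞`-morphism. -/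
theorem incl_transferQ (x : C.S) : C.incl (C.transferQ x) = A.Q (C.incl x) :=
  C.incl_mapP (C.Q_mem (C.incl_mem x))

/-- The transferred `L_∞`-structure. -/
def transfer : LInfAlg.{u, v} K where
  carrier := C.carrier
  gr := C.gr
  q := proj ∘ₗ C.transferQ
  q_one := by
    simp [transferQ_apply, incl_one, LInfAlg.Q, A.q_one]
  q_degree := fun n x hx => by
    have := hasDegree_proj _ _ (C.transferQ_mem_degree n x hx)
    rwa [add_zero] at this
  coder_sq := by
    rw [coder_transferQ]
    refine LinearMap.ext fun x => ?_
    have h : ∀ y, A.Q (A.Q y) = 0 := LinearMap.congr_fun A.coder_sq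
    rw [LinearMap.comp_apply, transferQ_apply, incl_transferQ, h, map_zero]
    rfl

theorem transfer_Q : C.transfer.Q = C.transferQ := C.coder_transferQ

/-- The `L_∞`-morphism from the transferred structure extending `s`. -/
def inclHom : C.transfer ⟶ A :=
  LInfAlg.Hom.mk C.incl C.incl_one C.incl_mem_degree fun x =>
    (congrArg C.incl (LinearMap.congr_fun C.transfer_Q x)).trans (C.incl_transferQ x)

/-- The `L_∞`-morphism to the transferred structure extending `p`. -/
def projHom : A ⟶ C.transfer :=
  LInfAlg.Hom.mk ((mapCoalgHom C.p C.p_mem_shift).comp C.proj₀)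
    ((congrArg C.mapP C.proj₀_one).trans (map_one _))
    (fun n x hx => map_mem_degree _ _ (C.proj₀_mem_degree n x hx))
    fun x => by
      refine Eq.trans ?_ (LinearMap.congr_fun C.transfer_Q _).symm
      -- `S(p)` alone is not claimed to respect codifferentials. Preceded by the spectral
      -- projection, it is applied only on the generalized kernel, where `incl` inverts it.
      change C.mapP (C.proj₀ (A.Q x)) = C.mapP (A.Q (C.incl (C.mapP (C.proj₀ x))))
      rw [C.incl_mapP (C.proj₀_mem x), Q_proj₀]

theorem linearPart_projHom (x : A.carrier) : LInfAlg.linearPart C.projHom x = C.p x := by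
  change proj (C.mapP (C.proj₀ (ι _ x))) = _
  rw [proj₀_ι, mapP_ι, p_s, proj_ι]

theorem transfer_q_ι (x : C.carrier) :
    C.transfer.q (ι _ x) = C.p (A.q (ι _ (C.s x))) := by
  change proj (C.mapP (A.Q (C.incl (ι _ x)))) = _
  rw [incl_ι, LInfAlg.Q_ι, mapP_ι, proj_ι]

end Contraction

end LInf

end

noncomputable section

namespace LInf

open GSym

/-! ### Homogeneous components -/

section decomposition

variable {K : Type*} [Field K]
variable {V : Type*} [AddCommGroup V] [Module K V] {gr : ℤ → Submodule K V} [Decomposition gr]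
variable {W : Type*} [AddCommGroup W] [Module K W] {gr' : ℤ → Submodule K W} [Decomposition gr']

theorem decompose_apply_map {l : V →ₗ[K] W} (hl : ∀ i, ∀ x ∈ gr i, l x ∈ gr' i) (x : V) (j : ℤ) :
    (decompose gr' (l x) j : W) = l (decompose gr x j) := by
  induction x using Decomposition.inductionOn gr with
  | zero => simp
  | @homogeneous i m =>
    rw [decompose_of_mem _ (hl _ _ m.2), decompose_coe]
    by_cases h : i = j
    · subst h
      rw [DirectSum.of_eq_same, DirectSum.of_eq_same]
    · rw [DirectSum.of_eq_of_ne _ _ _ (Ne.symm h), DirectSum.of_eq_of_ne _ _ _ (Ne.symm h)]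
      simp
  | add a b ha hb => simp [ha, hb]

theorem mem_of_map_mem {l : V →ₗ[K] W} (hl : ∀ i, ∀ x ∈ gr i, l x ∈ gr' i)
    (hi : Function.Injective l) {i : ℤ} {x : V} (hx : l x ∈ gr' i) : x ∈ gr i := by
  suffices h : x = decompose gr x i by
    rw [h]; exact (decompose gr x i).2
  apply hi
  rw [← decompose_apply_map hl, decompose_of_mem_same _ hx]

/-- A family of submodules with compatible projections is a decomposition. -/
@[reducible]
def decompositionOfProj (gr : ℤ → Submodule K V) (π : ℤ → V →ₗ[K] V)
    (h₁ : ∀ i, ∀ x ∈ gr i, π i x = x) (h₂ : ∀ i j, i ≠ j → ∀ x ∈ gr j, π i x = 0)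
    (h₃ : ⨆ i, gr i = ⊤) : Decomposition gr := by
  refine (isInternal_submodule_of_iSupIndep_of_iSup_eq_top (A := gr) ?_ h₃).chooseDecomposition
  refine fun i => Submodule.disjoint_def.2 fun x hx hx' => ?_
  rw [← h₁ i x hx]
  have : (⨆ j, ⨆ _ : j ≠ i, gr j) ≤ LinearMap.ker (π i) :=
    iSup₂_le fun j hj y hy => h₂ i j hj.symm y hy
  exact this hx'

theorem mem_iSup_of_decompose {p : Submodule K V} (x : V)
    (h : ∀ i, (decompose gr x i : V) ∈ p) : x ∈ p := by
  classical
  rw [← DirectSum.sum_support_decompose gr x]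
  exact sum_mem fun i _ => h i

variable (gr) in
/-- The projection onto the homogeneous elements of degree `i`. -/
def gproj (i : ℤ) : V →ₗ[K] V :=
  (gr i).subtype ∘ₗ DirectSum.component K ℤ (fun i => gr i) i ∘ₗ
    (decomposeLinearEquiv gr).toLinearMap

theorem gproj_apply (i : ℤ) (x : V) : gproj gr i x = decompose gr x i := rfl

theorem gproj_mem (i : ℤ) (x : V) : gproj gr i x ∈ gr i := (decompose gr x i).2

theorem gproj_of_mem {i : ℤ} {x : V} (hx : x ∈ gr i) : gproj gr i x = x :=
  decompose_of_mem_same _ hx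

theorem gproj_of_mem_ne {i j : ℤ} (h : i ≠ j) {x : V} (hx : x ∈ gr j) : gproj gr i x = 0 :=
  decompose_of_mem_ne _ hx h.symm

theorem gproj_map {l : V →ₗ[K] W} (hl : ∀ i, ∀ x ∈ gr i, l x ∈ gr' i) (x : V) (j : ℤ) :
    gproj gr' j (l x) = l (gproj gr j x) := decompose_apply_map hl x j

end decomposition

/-! ### Isomorphisms of `L_∞`-algebras detected on linear parts -/

namespace LInfAlg

variable {K : Type u} [Field K] [CharZero K] {A B : LInfAlg.{u, v} K}

/-- Composing with the coalgebra isomorphism induced by the inverse of the linear part reduces to a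
coalgebra endomorphism fixing letters, which `unipotent_bijective` inverts. -/
theorem bijective_of_linearPart {f : A ⟶ B} (h : Function.Bijective (linearPart f)) :
    Function.Bijective (Hom.toCoalgHom f) := by
  let l : A.carrier ≃ₗ[K] B.carrier := LinearEquiv.ofBijective _ h
  have hl : ∀ i, ∀ x ∈ shift A.gr 1 i, l.toLinearMap x ∈ shift B.gr 1 i :=
    fun i x hx => linearPart_mem f _ x hx
  have hl' : ∀ i, ∀ x ∈ shift B.gr 1 i, l.symm.toLinearMap x ∈ shift A.gr 1 i := fun i x hx =>
    mem_of_map_mem hl l.injective (by simpa using hx)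
  have hll : ∀ y : B.S, GSym.map (gr' := shift B.gr 1) l.toLinearMap hl
      (GSym.map (gr' := shift A.gr 1) l.symm.toLinearMap hl' y) = y := fun y => by
    rw [GSym.map_map (θ := LinearMap.id) (hθ := fun _ _ h => h) (h := fun v => by simp)]
    exact GSym.map_eq_self _ _ (fun _ => rfl) y
  have hll' : ∀ y : A.S, GSym.map (gr' := shift A.gr 1) l.symm.toLinearMap hl'
      (GSym.map (gr' := shift B.gr 1) l.toLinearMap hl y) = y := fun y => by
    rw [GSym.map_map (θ := LinearMap.id) (hθ := fun _ _ h => h) (h := fun v => by simp)]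
    exact GSym.map_eq_self _ _ (fun _ => rfl) y
  let ψ : A.S →ₗc[K] A.S := (mapCoalgHom (gr' := shift A.gr 1) l.symm.toLinearMap hl').comp
    (Hom.toCoalgHom f)
  have hψ : Function.Bijective ψ := by
    refine unipotent_bijective ?_ fun v => ?_
    · exact (congrArg (GSym.map _ hl') (Hom.map_one f)).trans (map_one _)
    · change GSym.map _ hl' (Hom.toCoalgHom f _) = _
      rw [LInfAlg.map_ι, GSym.map_ι]
      exact congrArg _ (l.symm_apply_apply v)
  constructor
  · exact fun x y hxy => hψ.1 (congrArg (GSym.map _ hl') hxy)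
  · intro y
    obtain ⟨x, hx⟩ := hψ.2 (GSym.map (gr' := shift A.gr 1) l.symm.toLinearMap hl' y)
    refine ⟨x, ?_⟩
    have := congrArg (GSym.map (gr' := shift B.gr 1) l.toLinearMap hl) hx
    rw [hll] at this
    exact (hll _).symm.trans this

/-- The inverse of a bijective `L_∞`-morphism. -/
def Hom.inverse (f : A ⟶ B) (h : Function.Bijective (Hom.toCoalgHom f)) : B ⟶ A :=
  Hom.mk ((CoalgEquiv.ofBijective h).symm : B.S →ₗc[K] A.S)
    (h.1 (((CoalgEquiv.ofBijective h).apply_symm_apply 1).trans (Hom.map_one f).symm))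
    (fun n x hx => mem_degree_of_comm
      (Θ := ((CoalgEquiv.ofBijective h).symm : B.S →ₗc[K] A.S).toLinearMap) (fun y => by
        apply h.1
        refine ((CoalgEquiv.ofBijective h).apply_symm_apply _).trans ?_
        refine Eq.trans ?_ (comm_degOp (Θ := (Hom.toCoalgHom f).toLinearMap)
          (Hom.map_degree f) _).symm
        exact congrArg _ ((CoalgEquiv.ofBijective h).apply_symm_apply _).symm) hx)
    fun y => by
      apply h.1
      refine ((CoalgEquiv.ofBijective h).apply_symm_apply _).trans ?_
      refine Eq.trans ?_ (Hom.comm f _).symm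
      exact congrArg _ ((CoalgEquiv.ofBijective h).apply_symm_apply _).symm

/-- An `L_∞`-morphism with bijective linear part is an isomorphism. -/
theorem isIso_of_linearPart {f : A ⟶ B} (h : Function.Bijective (linearPart f)) : IsIso f := by
  have hb := bijective_of_linearPart h
  refine ⟨Hom.inverse f hb, Hom.ext (CoalgHom.ext fun x => ?_), Hom.ext (CoalgHom.ext fun x => ?_)⟩
  · exact (CoalgEquiv.ofBijective hb).symm_apply_apply x
  · exact (CoalgEquiv.ofBijective hb).apply_symm_apply x

end LInfAlg

end LInf

end

/-! ### Constructions of DGLAs: subalgebras, products, forms, polynomials -/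

noncomputable section

namespace LInf

namespace DGLA

variable {K : Type u} [Field K]

section sub

/-- The graded pieces of a subspace. -/
def subGr (L : DGLA.{u, v} K) (p : Submodule K L.carrier) (i : ℤ) : Submodule K p :=
  (L.gr i).comap p.subtype

theorem mem_subGr {L : DGLA.{u, v} K} {p : Submodule K L.carrier} {i : ℤ} {x : p} :
    x ∈ subGr L p i ↔ (x : L.carrier) ∈ L.gr i := Iff.rfl

/-- The decomposition of a homogeneous subspace. -/
@[reducible]
def subDecomposition (L : DGLA.{u, v} K) (p : Submodule K L.carrier)
    (hp : ∀ x ∈ p, ∀ i, gproj L.gr i x ∈ p) : Decomposition (subGr L p) :=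
  decompositionOfProj (subGr L p) (fun i => (gproj L.gr i).restrict fun x hx => hp x hx i)
    (fun i x hx => Subtype.ext (gproj_of_mem hx))
    (fun i j h x hx => Subtype.ext (gproj_of_mem_ne h hx))
    (by
      rw [eq_top_iff]
      rintro ⟨x, hx⟩ -
      classical
      have h := DirectSum.sum_support_decompose L.gr x
      have : (⟨x, hx⟩ : p) = ∑ i ∈ (decompose L.gr x).support, ⟨gproj L.gr i x, hp x hx i⟩ := by
        apply Subtype.ext
        simpa [gproj_apply] using h.symm
      rw [this]
      exact sum_mem fun i _ => Submodule.mem_iSup_of_mem i (mem_subGr.2 (gproj_mem i x)))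

/-- The sub-DGLA on a homogeneous subspace closed under the differential and the bracket. -/
def sub (L : DGLA.{u, v} K) (p : Submodule K L.carrier)
    (hp : ∀ x ∈ p, ∀ i, gproj L.gr i x ∈ p) (hd : ∀ x ∈ p, L.d x ∈ p)
    (hb : ∀ x ∈ p, ∀ y ∈ p, L.bracket x y ∈ p) : DGLA.{u, v} K :=
  letI := subDecomposition L p hp
  { carrier := p
    gr := subGr L p
    d := L.d.restrict hd
    bracket := LinearMap.mk₂ K (fun x y => ⟨L.bracket x y, hb x x.2 y y.2⟩)
      (fun _ _ _ => Subtype.ext (by simp)) (fun _ _ _ => Subtype.ext (by simp))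
      (fun _ _ _ => Subtype.ext (by simp)) (fun _ _ _ => Subtype.ext (by simp))
    d_mem := fun i x hx => L.d_mem i x hx
    d_d := fun x => Subtype.ext (L.d_d x)
    bracket_mem := fun i j x y hx hy => L.bracket_mem i j x y hx hy
    skew := fun i j x y hx hy => Subtype.ext (L.skew i j x y hx hy)
    jacobi := fun i j x y z hx hy => Subtype.ext (L.jacobi i j x y z hx hy)
    leibniz := fun i x y hx => Subtype.ext (L.leibniz i x y hx) }

end sub

section prod

/-- The graded pieces of a product. -/
def prodGr (L M : DGLA.{u, v} K) (i : ℤ) : Submodule K (L.carrier × M.carrier) :=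
  (L.gr i).prod (M.gr i)

instance (L M : DGLA.{u, v} K) : Decomposition (prodGr L M) :=
  decompositionOfProj (prodGr L M) (fun i => (gproj L.gr i).prodMap (gproj M.gr i))
    (fun i x hx => Prod.ext (gproj_of_mem hx.1) (gproj_of_mem hx.2))
    (fun i j h x hx => Prod.ext (gproj_of_mem_ne h hx.1) (gproj_of_mem_ne h hx.2))
    (by
      rw [eq_top_iff]
      rintro ⟨x, y⟩ -
      have h1 : LinearMap.inl K L.carrier M.carrier x ∈ ⨆ i, prodGr L M i :=
        mem_iSup_of_decompose (p := (⨆ i, prodGr L M i).comap (LinearMap.inl K _ _)) (gr := L.gr) x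
          fun i => Submodule.mem_iSup_of_mem i ⟨(decompose L.gr x i).2, zero_mem _⟩
      have h2 : LinearMap.inr K L.carrier M.carrier y ∈ ⨆ i, prodGr L M i :=
        mem_iSup_of_decompose (p := (⨆ i, prodGr L M i).comap (LinearMap.inr K _ _)) (gr := M.gr) y
          fun i => Submodule.mem_iSup_of_mem i ⟨zero_mem _, (decompose M.gr y i).2⟩
      simpa using add_mem h1 h2)

/-- The product of two DGLAs. -/
def prod (L M : DGLA.{u, v} K) : DGLA.{u, v} K where
  carrier := L.carrier × M.carrier
  gr := prodGr L M
  d := L.d.prodMap M.d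
  bracket := LinearMap.mk₂ K (fun x y => (L.bracket x.1 y.1, M.bracket x.2 y.2))
    (fun _ _ _ => by ext <;> simp) (fun _ _ _ => by ext <;> simp)
    (fun _ _ _ => by ext <;> simp) (fun _ _ _ => by ext <;> simp)
  d_mem i x hx := ⟨L.d_mem i _ hx.1, M.d_mem i _ hx.2⟩
  d_d x := Prod.ext (L.d_d _) (M.d_d _)
  bracket_mem i j x y hx hy := ⟨L.bracket_mem i j _ _ hx.1 hy.1, M.bracket_mem i j _ _ hx.2 hy.2⟩
  skew i j x y hx hy := Prod.ext (L.skew i j _ _ hx.1 hy.1) (M.skew i j _ _ hx.2 hy.2)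
  jacobi i j x y z hx hy := Prod.ext (L.jacobi i j _ _ _ hx.1 hy.1) (M.jacobi i j _ _ _ hx.2 hy.2)
  leibniz i x y hx := Prod.ext (L.leibniz i _ _ hx.1) (M.leibniz i _ _ hx.2)

end prod

section forms

/-- Derivations of degree `0` commuting with the differential. -/
structure Der (N : DGLA.{u, v} K) where
  toLin : N.carrier →ₗ[K] N.carrier
  mem : ∀ i, ∀ x ∈ N.gr i, toLin x ∈ N.gr i
  comm : ∀ x, toLin (N.d x) = N.d (toLin x)
  map_bracket : ∀ x y, toLin (N.bracket x y) = N.bracket (toLin x) y + N.bracket x (toLin y)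

variable (N : DGLA.{u, v} K) (D : N.Der)

/-- The DGLA of forms `a + dt b`, where `d a` has `dt`-component given by the derivation `D`. -/
def forms : DGLA.{u, v} K where
  carrier := N.carrier × N.carrier
  gr := coneGr N N
  d := (N.d ∘ₗ LinearMap.fst K _ _).prod (D.toLin ∘ₗ LinearMap.fst K _ _ - N.d ∘ₗ LinearMap.snd K _ _)
  bracket := LinearMap.mk₂ K
    -- The second component is `[b, a'] + (-1)^(deg a) [a, b']`. The sign from moving `dt` past `a`
    -- is the one built into `q₂`, which is reused for it.
    (fun x y => (N.bracket x.1 y.1, N.bracket x.2 y.1 + N.q₂ x.1 y.2))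
    (fun _ _ _ => by ext <;> simp; abel) (fun _ _ _ => by ext <;> simp)
    (fun _ _ _ => by ext <;> simp; abel) (fun _ _ _ => by ext <;> simp)
  d_mem := by
    rintro i ⟨x, y⟩ ⟨hx, hy⟩
    refine ⟨N.d_mem i x hx, ?_⟩
    have := N.d_mem _ y hy
    rw [sub_add_cancel] at this
    change _ ∈ N.gr (i + 1 - 1)
    rw [add_sub_cancel_right]
    exact sub_mem (D.mem i x hx) this
  d_d := by
    rintro ⟨x, y⟩
    simp [N.d_d, D.comm]
  bracket_mem := by
    rintro i j ⟨a, b⟩ ⟨a', b'⟩ ⟨ha, hb⟩ ⟨ha', hb'⟩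
    refine ⟨N.bracket_mem i j _ _ ha ha', add_mem ?_ ?_⟩
    · have := N.bracket_mem _ _ _ _ hb ha'
      rwa [show i - 1 + j = i + j - 1 by ring] at this
    · have := N.bracket_mem _ _ _ _ ha hb'
      rw [show i + (j - 1) = i + j - 1 by ring] at this
      rw [N.q₂_apply ha]
      exact Submodule.smul_mem _ _ this
  skew := by
    rintro i j ⟨a, b⟩ ⟨a', b'⟩ ⟨ha, hb⟩ ⟨ha', hb'⟩
    have n0 : (-1 : K) ≠ 0 := neg_ne_zero.2 one_ne_zero
    refine Prod.ext (N.skew i j _ _ ha ha') ?_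
    simp only [LinearMap.mk₂_apply, Prod.snd_neg, Prod.smul_snd, N.q₂_apply ha, N.q₂_apply ha']
    rw [N.skew _ _ _ _ hb ha', N.skew _ _ _ _ ha hb']
    simp only [mul_sub, sub_mul, one_mul, mul_one, zpow_sub₀ n0]
    rcases LInf.zs (K := K) i with a | a <;> rcases LInf.zs (K := K) j with c | c <;>
      rcases LInf.zs (K := K) (i * j) with d | d <;> simp only [a, c, d] <;> module
  jacobi := by
    rintro i j ⟨a, b⟩ ⟨a', b'⟩ ⟨a'', b''⟩ ⟨ha, hb⟩ ⟨ha', hb'⟩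
    have n0 : (-1 : K) ≠ 0 := neg_ne_zero.2 one_ne_zero
    refine Prod.ext (N.jacobi i j _ _ _ ha ha') ?_
    simp only [LinearMap.mk₂_apply, Prod.snd_add, Prod.smul_snd, N.q₂_apply ha, N.q₂_apply ha',
      N.q₂_apply (N.bracket_mem _ _ _ _ ha ha'), map_add, map_smul, LinearMap.add_apply,
      LinearMap.smul_apply]
    rw [N.jacobi _ _ _ _ _ hb ha', N.jacobi _ _ _ _ _ ha hb', N.jacobi _ _ _ _ _ ha ha']
    simp only [mul_sub, sub_mul, one_mul, mul_one, zpow_sub₀ n0, zpow_add₀ n0]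
    rcases LInf.zs (K := K) i with a | a <;> rcases LInf.zs (K := K) j with c | c <;>
      rcases LInf.zs (K := K) (i * j) with d | d <;> simp only [a, c, d] <;> module
  leibniz := by
    rintro i ⟨a, b⟩ ⟨a', b'⟩ ⟨ha, hb⟩
    have n0 : (-1 : K) ≠ 0 := neg_ne_zero.2 one_ne_zero
    refine Prod.ext (N.leibniz i _ _ ha) ?_
    change D.toLin (N.bracket a a') - N.d (N.bracket b a' + N.q₂ a b') =
      N.bracket (D.toLin a - N.d b) a' + N.q₂ (N.d a) b' +
        (-1 : K) ^ i • (N.bracket b (N.d a') + N.q₂ a (D.toLin a' - N.d b'))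
    simp only [N.q₂_apply ha, N.q₂_apply (N.d_mem _ _ ha), map_add, map_sub, map_smul, D.map_bracket,
      LinearMap.sub_apply]
    rw [N.leibniz _ _ _ hb, N.leibniz _ _ _ ha]
    simp only [zpow_sub₀ n0, zpow_one, zpow_add₀ n0]
    rcases LInf.zs (K := K) i with a | a <;> simp only [a] <;> module

variable {N D}

/-- The form `a + dt b`. -/
def formsMk : N.carrier × N.carrier →ₗ[K] (N.forms D).carrier := LinearMap.id

/-- The component `b` of a form `a + dt b`. -/
def formsSnd : (N.forms D).carrier →ₗ[K] N.carrier := LinearMap.snd K _ _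

/-- The projection `a + dt b ↦ a`. -/
def formsFst : N.forms D ⟶ N :=
  Hom.mk (LinearMap.fst K _ _) (fun _ _ h => h.1) (fun _ => rfl) (fun _ _ => rfl)

theorem forms_ext {x y : (N.forms D).carrier} (h₁ : Hom.toLin formsFst x = Hom.toLin formsFst y)
    (h₂ : formsSnd x = formsSnd y) : x = y := Prod.ext h₁ h₂

/-- The morphism `x ↦ f x + dt 0` for a morphism `f` with `D f = 0`. -/
def formsInl {M : DGLA.{u, v} K} (f : M ⟶ N) (h : ∀ x, D.toLin (Hom.toLin f x) = 0) :
    M ⟶ N.forms D :=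
  Hom.mk (LinearMap.inl K _ _ ∘ₗ Hom.toLin f) (fun i x hx => ⟨Hom.mem f i x hx, zero_mem _⟩)
    (fun x => by
      refine Prod.ext (Hom.comm f x) ?_
      change (0 : N.carrier) = D.toLin (Hom.toLin f x) - N.d 0
      rw [h, map_zero, sub_zero])
    (fun x y => by
      refine Prod.ext (Hom.map_bracket f x y) ?_
      change (0 : N.carrier) = N.bracket 0 (Hom.toLin f y) + N.q₂ (Hom.toLin f x) 0
      rw [map_zero, map_zero, LinearMap.zero_apply, add_zero])

/-- The morphism of forms induced by a morphism `f` with `f D = D' f`. -/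
def formsMap {N' : DGLA.{u, v} K} {D' : N'.Der} (f : N ⟶ N')
    (h : ∀ x, Hom.toLin f (D.toLin x) = D'.toLin (Hom.toLin f x)) : N.forms D ⟶ N'.forms D' :=
  Hom.mk ((Hom.toLin f).prodMap (Hom.toLin f))
    (fun i x hx => ⟨Hom.mem f i _ hx.1, Hom.mem f _ _ hx.2⟩)
    (fun x => by
      refine Prod.ext (Hom.comm f x.1) ?_
      change Hom.toLin f (D.toLin x.1 - N.d x.2) =
        D'.toLin (Hom.toLin f x.1) - N'.d (Hom.toLin f x.2)
      rw [map_sub, h, Hom.comm f])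
    (fun x y => by
      refine Prod.ext (Hom.map_bracket f x.1 y.1) ?_
      change Hom.toLin f (N.bracket x.2 y.1 + N.q₂ x.1 y.2) = N'.bracket (Hom.toLin f x.2)
        (Hom.toLin f y.1) + N'.q₂ (Hom.toLin f x.1) (Hom.toLin f y.2)
      rw [map_add, Hom.map_bracket f, map_q₂])

end forms

section poly

variable {V W X : Type*} [AddCommGroup V] [Module K V] [AddCommGroup W] [Module K W]
  [AddCommGroup X] [Module K X]

/-- The extension of a bilinear map to polynomials. -/
def polyBilin (b : V →ₗ[K] W →ₗ[K] X) : (ℕ →₀ V) →ₗ[K] (ℕ →₀ W) →ₗ[K] (ℕ →₀ X) :=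
  Finsupp.lsum K fun i => LinearMap.flip (Finsupp.lsum K fun j =>
    LinearMap.flip (b.compr₂ (Finsupp.lsingle (i + j))))

theorem polyBilin_single (b : V →ₗ[K] W →ₗ[K] X) (i j : ℕ) (x : V) (y : W) :
    polyBilin b (Finsupp.single i x) (Finsupp.single j y) = Finsupp.single (i + j) (b x y) := by
  simp [polyBilin]

/-- The graded pieces of `V[t]`. -/
def polyGr (gr : ℤ → Submodule K V) (i : ℤ) : Submodule K (ℕ →₀ V) where
  carrier := {a | ∀ k, a k ∈ gr i}
  add_mem' ha hb k := add_mem (ha k) (hb k)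
  zero_mem' _ := zero_mem _
  smul_mem' c _ ha k := Submodule.smul_mem _ c (ha k)

variable {gr : ℤ → Submodule K V}

theorem single_mem_polyGr {i : ℤ} {x : V} (hx : x ∈ gr i) (k : ℕ) :
    Finsupp.single k x ∈ polyGr gr i := by
  intro j
  rw [Finsupp.single_apply]
  split_ifs
  · exact hx
  · exact zero_mem _

theorem polyGr_induction {i : ℤ} {p : (ℕ →₀ V) → Prop} (zero : p 0)
    (add : ∀ a b, p a → p b → p (a + b)) (single : ∀ k, ∀ x ∈ gr i, p (Finsupp.single k x))
    {a : ℕ →₀ V} (ha : a ∈ polyGr gr i) : p a := by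
  rw [← Finsupp.sum_single a]
  exact Finset.sum_induction _ p add zero fun k _ => single k _ (ha k)

theorem map_mem_polyGr {Y : Submodule K X} {i : ℤ} (f : (ℕ →₀ V) →ₗ[K] X)
    (h : ∀ k, ∀ x ∈ gr i, f (Finsupp.single k x) ∈ Y) {a : ℕ →₀ V} (ha : a ∈ polyGr gr i) :
    f a ∈ Y :=
  polyGr_induction (p := fun a => f a ∈ Y) (by simp)
    (fun a b ha hb => by rw [map_add]; exact add_mem ha hb) h ha

instance [Decomposition gr] : Decomposition (polyGr gr) :=
  decompositionOfProj (polyGr gr) (fun i => Finsupp.mapRange.linearMap (gproj gr i))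
    (fun i x hx => Finsupp.ext fun k => by simpa using gproj_of_mem (hx k))
    (fun i j h x hx => Finsupp.ext fun k => by simpa using gproj_of_mem_ne h (hx k))
    (by
      rw [eq_top_iff]
      rintro x -
      induction x using Finsupp.induction_linear with
      | zero => exact zero_mem _
      | add a b ha hb => exact add_mem ha hb
      | single k x =>
        exact mem_iSup_of_decompose (gr := gr) (p := (⨆ i, polyGr gr i).comap (Finsupp.lsingle k)) x
          fun i => Submodule.mem_iSup_of_mem i (single_mem_polyGr (decompose gr x i).2 k))

/-- The DGLA of polynomials `L[t]`. -/
def poly (L : DGLA.{u, v} K) : DGLA.{u, v} K where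
  carrier := ℕ →₀ L.carrier
  gr := polyGr L.gr
  d := Finsupp.mapRange.linearMap L.d
  bracket := polyBilin L.bracket
  d_mem i x hx k := by simpa using L.d_mem i _ (hx k)
  d_d x := Finsupp.ext fun k => by simp [L.d_d]
  bracket_mem i j x y hx hy := by
    refine polyGr_induction (p := fun x => polyBilin L.bracket x y ∈ polyGr L.gr (i + j))
      (by simp) (fun a b ha hb => by rw [map_add]; exact add_mem ha hb) (fun k x hx => ?_) hx
    refine map_mem_polyGr (polyBilin L.bracket (Finsupp.single k x)) (fun l y hy => ?_) hy
    rw [polyBilin_single]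
    exact single_mem_polyGr (L.bracket_mem _ _ _ _ hx hy) _
  skew i j x y hx hy := by
    refine polyGr_induction (p := fun x => polyBilin L.bracket x y =
      -((-1 : K) ^ (i * j) • polyBilin L.bracket y x)) (by simp)
      (fun a b ha hb => by simp only [map_add, LinearMap.add_apply, ha, hb]; module)
      (fun k x hx => ?_) hx
    refine polyGr_induction (p := fun y => polyBilin L.bracket (Finsupp.single k x) y =
      -((-1 : K) ^ (i * j) • polyBilin L.bracket y (Finsupp.single k x))) (by simp)
      (fun a b ha hb => by simp only [map_add, LinearMap.add_apply, ha, hb]; module)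
      (fun l y hy => ?_) hy
    rw [polyBilin_single, polyBilin_single, L.skew _ _ _ _ hx hy, add_comm l k,
      Finsupp.smul_single, Finsupp.single_neg]
  jacobi i j x y z hx hy := by
    induction z using Finsupp.induction_linear with
    | zero => simp
    | add a b ha hb => simp only [map_add, ha, hb]; module
    | single m z =>
      refine polyGr_induction (p := fun x => polyBilin L.bracket x
        (polyBilin L.bracket y (Finsupp.single m z)) = polyBilin L.bracket
        (polyBilin L.bracket x y) (Finsupp.single m z) + (-1 : K) ^ (i * j) •
          polyBilin L.bracket y (polyBilin L.bracket x (Finsupp.single m z))) (by simp)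
        (fun a b ha hb => by simp only [map_add, LinearMap.add_apply, ha, hb]; module)
        (fun k x hx => ?_) hx
      refine polyGr_induction (p := fun y => polyBilin L.bracket (Finsupp.single k x)
        (polyBilin L.bracket y (Finsupp.single m z)) = polyBilin L.bracket
        (polyBilin L.bracket (Finsupp.single k x) y) (Finsupp.single m z) + (-1 : K) ^ (i * j) •
          polyBilin L.bracket y (polyBilin L.bracket (Finsupp.single k x) (Finsupp.single m z)))
        (by simp) (fun a b ha hb => by simp only [map_add, LinearMap.add_apply, ha, hb]; module)
        (fun l y hy => ?_) hy
      simp only [polyBilin_single]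
      rw [L.jacobi _ _ _ _ _ hx hy, Finsupp.single_add, Finsupp.smul_single, ← add_assoc,
        ← add_assoc, add_comm l k]
  leibniz i x y hx := by
    induction y using Finsupp.induction_linear with
    | zero => simp
    | add a b ha hb => simp only [map_add, ha, hb]; module
    | single m y =>
      refine polyGr_induction (p := fun x => Finsupp.mapRange.linearMap L.d
        (polyBilin L.bracket x (Finsupp.single m y)) =
        polyBilin L.bracket (Finsupp.mapRange.linearMap L.d x) (Finsupp.single m y) +
        (-1 : K) ^ i • polyBilin L.bracket x (Finsupp.mapRange.linearMap L.d (Finsupp.single m y)))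
        (by simp) (fun a b ha hb => by simp only [map_add, LinearMap.add_apply, ha, hb]; module)
        (fun k x hx => ?_) hx
      simp only [Finsupp.mapRange.linearMap_apply, Finsupp.mapRange_single, polyBilin_single]
      rw [L.leibniz _ _ _ hx, Finsupp.single_add, Finsupp.smul_single]

end poly

end DGLA

end LInf

end

/-! ### Polynomial calculus, equalizers and polynomial forms -/

noncomputable section

namespace LInf

namespace DGLA

variable {K : Type u} [Field K]

section calculus

variable {V W : Type*} [AddCommGroup V] [Module K V] [AddCommGroup W] [Module K W]

variable (K V) in
/-- The derivative of polynomials. -/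
def deriv : (ℕ →₀ V) →ₗ[K] (ℕ →₀ V) :=
  Finsupp.lsum K fun k => (k : K) • Finsupp.lsingle (k - 1)

variable (K V) in
/-- The primitive of a polynomial vanishing at `0`. -/
def integ : (ℕ →₀ V) →ₗ[K] (ℕ →₀ V) :=
  Finsupp.lsum K fun k => ((k : K) + 1)⁻¹ • Finsupp.lsingle (k + 1)

variable (V) in
/-- Evaluation of polynomials at `c`. -/
def evalAt (c : K) : (ℕ →₀ V) →ₗ[K] V :=
  Finsupp.lsum K fun k => c ^ k • LinearMap.id

variable (V) in
/-- The substitution `t ↦ c t`. -/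
def rescale (c : K) : (ℕ →₀ V) →ₗ[K] (ℕ →₀ V) :=
  Finsupp.lsum K fun k => c ^ k • Finsupp.lsingle k

theorem deriv_single (k : ℕ) (x : V) :
    deriv K V (Finsupp.single k x) = (k : K) • Finsupp.single (k - 1) x := by
  simp [deriv]

theorem integ_single (k : ℕ) (x : V) :
    integ K V (Finsupp.single k x) = ((k : K) + 1)⁻¹ • Finsupp.single (k + 1) x := by
  simp [integ]

theorem evalAt_single (c : K) (k : ℕ) (x : V) :
    evalAt V c (Finsupp.single k x) = c ^ k • x := by
  simp [evalAt]

theorem rescale_single (c : K) (k : ℕ) (x : V) :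
    rescale V c (Finsupp.single k x) = c ^ k • Finsupp.single k x := by
  simp [rescale]

theorem poly_hom_ext {f g : (ℕ →₀ V) →ₗ[K] W}
    (h : ∀ k x, f (Finsupp.single k x) = g (Finsupp.single k x)) (a : ℕ →₀ V) : f a = g a := by
  induction a using Finsupp.induction_linear with
  | zero => simp
  | add a b ha hb => rw [map_add, map_add, ha, hb]
  | single k x => exact h k x

theorem deriv_integ [CharZero K] (a : ℕ →₀ V) : deriv K V (integ K V a) = a := by
  refine poly_hom_ext (f := deriv K V ∘ₗ integ K V) (g := LinearMap.id) (fun k x => ?_) a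
  have : (k : K) + 1 ≠ 0 := Nat.cast_add_one_ne_zero k
  simp [integ_single, deriv_single, this]

theorem integ_deriv [CharZero K] (a : ℕ →₀ V) :
    integ K V (deriv K V a) = a - Finsupp.single 0 (evalAt V (0 : K) a) := by
  refine poly_hom_ext (f := integ K V ∘ₗ deriv K V)
    (g := LinearMap.id - Finsupp.lsingle 0 ∘ₗ evalAt V (0 : K)) (fun k x => ?_) a
  cases k with
  | zero => simp [deriv_single, evalAt_single]
  | succ k =>
    have : (k : K) + 1 ≠ 0 := Nat.cast_add_one_ne_zero k
    simp [integ_single, deriv_single, evalAt_single, this]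

theorem evalAt_zero_integ (a : ℕ →₀ V) : evalAt V (0 : K) (integ K V a) = 0 :=
  poly_hom_ext (f := evalAt V (0 : K) ∘ₗ integ K V) (g := 0)
    (fun k x => by simp [integ_single, evalAt_single]) a

theorem evalAt_mapRange (φ : V →ₗ[K] W) (c : K) (a : ℕ →₀ V) :
    evalAt W c (Finsupp.mapRange.linearMap φ a) = φ (evalAt V c a) :=
  poly_hom_ext (f := evalAt W c ∘ₗ Finsupp.mapRange.linearMap φ) (g := φ ∘ₗ evalAt V c)
    (fun k x => by simp [evalAt_single]) a

theorem deriv_mapRange (φ : V →ₗ[K] W) (a : ℕ →₀ V) :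
    deriv K W (Finsupp.mapRange.linearMap φ a) = Finsupp.mapRange.linearMap φ (deriv K V a) :=
  poly_hom_ext (f := deriv K W ∘ₗ Finsupp.mapRange.linearMap φ)
    (g := Finsupp.mapRange.linearMap φ ∘ₗ deriv K V)
    (fun k x => by
      simp only [LinearMap.comp_apply, deriv_single, map_smul]
      simp [deriv_single]) a

theorem integ_mapRange (φ : V →ₗ[K] W) (a : ℕ →₀ V) :
    integ K W (Finsupp.mapRange.linearMap φ a) = Finsupp.mapRange.linearMap φ (integ K V a) :=
  poly_hom_ext (f := integ K W ∘ₗ Finsupp.mapRange.linearMap φ)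
    (g := Finsupp.mapRange.linearMap φ ∘ₗ integ K V)
    (fun k x => by
      simp only [LinearMap.comp_apply, integ_single, map_smul]
      simp [integ_single]) a

theorem rescale_mapRange (φ : V →ₗ[K] W) (c : K) (a : ℕ →₀ V) :
    rescale W c (Finsupp.mapRange.linearMap φ a) = Finsupp.mapRange.linearMap φ (rescale V c a) :=
  poly_hom_ext (f := rescale W c ∘ₗ Finsupp.mapRange.linearMap φ)
    (g := Finsupp.mapRange.linearMap φ ∘ₗ rescale V c)
    (fun k x => by
      simp only [LinearMap.comp_apply, rescale_single, map_smul]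
      simp [rescale_single]) a

variable {gr : ℤ → Submodule K V}

theorem deriv_mem {i : ℤ} {a : ℕ →₀ V} (ha : a ∈ polyGr gr i) : deriv K V a ∈ polyGr gr i :=
  map_mem_polyGr _ (fun k x hx => by
    rw [deriv_single]; exact Submodule.smul_mem _ _ (single_mem_polyGr hx _)) ha

theorem integ_mem {i : ℤ} {a : ℕ →₀ V} (ha : a ∈ polyGr gr i) : integ K V a ∈ polyGr gr i :=
  map_mem_polyGr _ (fun k x hx => by
    rw [integ_single]; exact Submodule.smul_mem _ _ (single_mem_polyGr hx _)) ha

theorem evalAt_mem (c : K) {i : ℤ} {a : ℕ →₀ V} (ha : a ∈ polyGr gr i) : evalAt V c a ∈ gr i :=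
  map_mem_polyGr _ (fun k x hx => by
    rw [evalAt_single]; exact Submodule.smul_mem _ _ hx) ha

theorem rescale_mem (c : K) {i : ℤ} {a : ℕ →₀ V} (ha : a ∈ polyGr gr i) :
    rescale V c a ∈ polyGr gr i :=
  map_mem_polyGr _ (fun k x hx => by
    rw [rescale_single]; exact Submodule.smul_mem _ _ (single_mem_polyGr hx _)) ha

/-- An identity between bilinear maps of polynomials holds if it holds on monomials. -/
theorem poly_bilin_ext {X : Type*} [AddCommGroup X] [Module K X]
    {f g : (ℕ →₀ V) →ₗ[K] (ℕ →₀ W) →ₗ[K] X}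
    (h : ∀ k x l y, f (Finsupp.single k x) (Finsupp.single l y) =
      g (Finsupp.single k x) (Finsupp.single l y)) (a : ℕ →₀ V) (b : ℕ →₀ W) : f a b = g a b :=
  LinearMap.congr_fun (poly_hom_ext (fun k x => LinearMap.ext (poly_hom_ext (h k x))) a) b

theorem deriv_polyBilin (b : V →ₗ[K] V →ₗ[K] V) (x y : ℕ →₀ V) : deriv K V (polyBilin b x y) =
    polyBilin b (deriv K V x) y + polyBilin b x (deriv K V y) := by
  refine poly_bilin_ext (f := (polyBilin b).compr₂ (deriv K V))
    (g := polyBilin b ∘ₗ deriv K V + (polyBilin b).compl₂ (deriv K V)) (fun k x l y => ?_) x y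
  simp only [LinearMap.compr₂_apply, LinearMap.add_apply, LinearMap.comp_apply,
    LinearMap.compl₂_apply, deriv_single, polyBilin_single, map_smul, LinearMap.smul_apply]
  rcases k with - | k <;> rcases l with - | l
  · simp
  · simp
  · simp
  · rw [show k + 1 + (l + 1) - 1 = k + l + 1 by omega, show k + 1 - 1 + (l + 1) = k + l + 1 by omega,
      show k + 1 + (l + 1 - 1) = k + l + 1 by omega, ← add_smul]
    push_cast; rfl

theorem evalAt_polyBilin (b : V →ₗ[K] V →ₗ[K] V) (c : K) (x y : ℕ →₀ V) :
    evalAt V c (polyBilin b x y) = b (evalAt V c x) (evalAt V c y) := by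
  refine poly_bilin_ext (f := (polyBilin b).compr₂ (evalAt V c))
    (g := (b ∘ₗ evalAt V c).compl₂ (evalAt V c)) (fun k x l y => ?_) x y
  simp [polyBilin_single, evalAt_single, pow_add, smul_smul, mul_comm]

theorem rescale_polyBilin (b : V →ₗ[K] V →ₗ[K] V) (c : K) (x y : ℕ →₀ V) :
    rescale V c (polyBilin b x y) = polyBilin b (rescale V c x) (rescale V c y) := by
  refine poly_bilin_ext (f := (polyBilin b).compr₂ (rescale V c))
    (g := (polyBilin b ∘ₗ rescale V c).compl₂ (rescale V c)) (fun k x l y => ?_) x y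
  simp only [LinearMap.compr₂_apply, LinearMap.comp_apply, LinearMap.compl₂_apply,
    rescale_single, polyBilin_single, map_smul, LinearMap.smul_apply]
  rw [smul_smul, pow_add, mul_comm]

theorem polyBilin_mapRange {b : V →ₗ[K] V →ₗ[K] V} {b' : W →ₗ[K] W →ₗ[K] W} {φ : V →ₗ[K] W}
    (h : ∀ x y, φ (b x y) = b' (φ x) (φ y)) (x y : ℕ →₀ V) :
    Finsupp.mapRange.linearMap φ (polyBilin b x y) =
      polyBilin b' (Finsupp.mapRange.linearMap φ x) (Finsupp.mapRange.linearMap φ y) := by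
  refine poly_bilin_ext (f := (polyBilin b).compr₂ (Finsupp.mapRange.linearMap φ))
    (g := (polyBilin b' ∘ₗ Finsupp.mapRange.linearMap φ).compl₂ (Finsupp.mapRange.linearMap φ))
    (fun k x l y => ?_) x y
  simp [polyBilin_single, h]

end calculus

section limits

variable {L M N : DGLA.{u, v} K}

@[ext] theorem hom_ext {f g : L ⟶ M} (h : ∀ x, Hom.toLin f x = Hom.toLin g x) : f = g :=
  Hom.ext (LinearMap.ext h)

@[simp] theorem toLin_comp (f : L ⟶ M) (g : M ⟶ N) (x : L.carrier) :
    Hom.toLin (f ≫ g) x = Hom.toLin g (Hom.toLin f x) := rfl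

/-- The zero morphism. -/
def zeroHom (L M : DGLA.{u, v} K) : L ⟶ M :=
  Hom.mk 0 (fun _ _ _ => zero_mem _) (by simp) (by simp)

/-- The equalizer of two morphisms of DGLAs. -/
def eqz (f g : L ⟶ M) : DGLA.{u, v} K :=
  L.sub (LinearMap.eqLocus (Hom.toLin f) (Hom.toLin g))
    (fun x hx i => by
      rw [LinearMap.mem_eqLocus] at hx ⊢
      rw [← gproj_map (Hom.mem f), ← gproj_map (Hom.mem g), hx])
    (fun x hx => by
      rw [LinearMap.mem_eqLocus] at hx ⊢
      rw [Hom.comm f, Hom.comm g, hx])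
    (fun x hx y hy => by
      rw [LinearMap.mem_eqLocus] at hx hy ⊢
      rw [Hom.map_bracket f, Hom.map_bracket g, hx, hy])

/-- The inclusion of the equalizer. -/
def eqzι (f g : L ⟶ M) : eqz f g ⟶ L :=
  Hom.mk (LinearMap.eqLocus (Hom.toLin f) (Hom.toLin g)).subtype (fun _ _ h => h) (fun _ => rfl)
    (fun _ _ => rfl)

theorem eqz_condition (f g : L ⟶ M) (x : (eqz f g).carrier) :
    Hom.toLin f (Hom.toLin (eqzι f g) x) = Hom.toLin g (Hom.toLin (eqzι f g) x) := x.2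

theorem eqzι_injective (f g : L ⟶ M) : Function.Injective (Hom.toLin (eqzι f g)) :=
  Subtype.val_injective

/-- A linear map into the equalizer. -/
def eqzLin {X : Type*} [AddCommGroup X] [Module K X] (f g : L ⟶ M) (h : X →ₗ[K] L.carrier)
    (w : ∀ x, Hom.toLin f (h x) = Hom.toLin g (h x)) : X →ₗ[K] (eqz f g).carrier :=
  h.codRestrict (LinearMap.eqLocus (Hom.toLin f) (Hom.toLin g)) w

/-- The morphism into the equalizer given by its universal property. -/
def eqzLift (f g : L ⟶ M) (h : N ⟶ L) (w : ∀ x, Hom.toLin f (Hom.toLin h x) =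
    Hom.toLin g (Hom.toLin h x)) : N ⟶ eqz f g :=
  Hom.mk (eqzLin f g (Hom.toLin h) w) (fun i x hx => Hom.mem h i x hx)
    (fun x => Subtype.ext (Hom.comm h x)) (fun x y => Subtype.ext (Hom.map_bracket h x y))

/-- The first projection. -/
def prodFst (L M : DGLA.{u, v} K) : L.prod M ⟶ L :=
  Hom.mk (LinearMap.fst K _ _) (fun _ _ h => h.1) (fun _ => rfl) (fun _ _ => rfl)

/-- The second projection. -/
def prodSnd (L M : DGLA.{u, v} K) : L.prod M ⟶ M :=
  Hom.mk (LinearMap.snd K _ _) (fun _ _ h => h.2) (fun _ => rfl) (fun _ _ => rfl)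

/-- The morphism into the product given by its universal property. -/
def prodLift (f : N ⟶ L) (g : N ⟶ M) : N ⟶ L.prod M :=
  Hom.mk ((Hom.toLin f).prod (Hom.toLin g)) (fun i x h => ⟨Hom.mem f i x h, Hom.mem g i x h⟩)
    (fun x => Prod.ext (Hom.comm f x) (Hom.comm g x))
    (fun x y => Prod.ext (Hom.map_bracket f x y) (Hom.map_bracket g x y))

/-- Evaluation as a morphism `M[t] → M`. -/
def polyEval (M : DGLA.{u, v} K) (c : K) : M.poly ⟶ M :=
  Hom.mk (evalAt M.carrier c) (fun _ _ h => evalAt_mem c h) (fun a => evalAt_mapRange M.d c a)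
    (fun a b => evalAt_polyBilin M.bracket c a b)

/-- The substitution `t ↦ c t` as an endomorphism of `M[t]`. -/
def polyRescale (M : DGLA.{u, v} K) (c : K) : M.poly ⟶ M.poly :=
  Hom.mk (rescale M.carrier c) (fun _ _ h => rescale_mem c h) (fun a => rescale_mapRange M.d c a)
    (fun a b => rescale_polyBilin M.bracket c a b)

/-- The morphism of polynomials induced by a morphism of DGLAs. -/
def polyMap (f : M ⟶ N) : M.poly ⟶ N.poly :=
  Hom.mk (Finsupp.mapRange.linearMap (Hom.toLin f))
    (fun i x h k => (Finsupp.mapRange_apply (hf := map_zero (Hom.toLin f)) ..).symm ▸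
      Hom.mem f i _ (h k))
    (fun a => poly_hom_ext (f := Finsupp.mapRange.linearMap (Hom.toLin f) ∘ₗ
        Finsupp.mapRange.linearMap M.d)
      (g := Finsupp.mapRange.linearMap N.d ∘ₗ Finsupp.mapRange.linearMap (Hom.toLin f))
      (fun k x => by simp [Hom.comm f]) a)
    (polyBilin_mapRange (Hom.map_bracket f))

/-- The constant polynomials. -/
def polyConst (M : DGLA.{u, v} K) : M ⟶ M.poly :=
  Hom.mk (Finsupp.lsingle 0) (fun _ _ h => single_mem_polyGr h 0)
    (fun _ => (Finsupp.mapRange_single (hf := map_zero M.d)).symm)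
    (fun x y => (polyBilin_single M.bracket 0 0 x y).symm)

/-- The derivation `d/dt` of `M[t]`. -/
def polyDer (M : DGLA.{u, v} K) : M.poly.Der where
  toLin := deriv K M.carrier
  mem _ _ h := deriv_mem h
  comm a := deriv_mapRange M.d a
  map_bracket a b := deriv_polyBilin M.bracket a b

/-- The polynomial differential forms `M[t, dt]`, whose elements are written `a + dt b`. -/
abbrev polyForms (M : DGLA.{u, v} K) : DGLA.{u, v} K := M.poly.forms M.polyDer

end limits

end DGLA

end LInf

end

/-! ### Path objects, homotopy fibres and the contraction onto the cone -/

noncomputable section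

namespace LInf

open GSym

namespace DGLA

variable {K : Type u} [Field K] {L M : DGLA.{u, v} K}

section path

/-- The DGLA of pairs of `l` in `L` and a polynomial form on `M` ending in `χ l`. -/
def path (χ : L ⟶ M) : DGLA.{u, v} K :=
  eqz (prodSnd L M.polyForms ≫ formsFst ≫ polyEval M 1) (prodFst L M.polyForms ≫ χ)

variable (χ : L ⟶ M)

/-- The inclusion into the product. -/
def pathι : path χ ⟶ L.prod M.polyForms := eqzι _ _

/-- The component in `L`. -/
def pathFst : path χ ⟶ L := pathι χ ≫ prodFst _ _

/-- The coefficient `a` of the form `a + dt b`. -/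
def pathA : (path χ).carrier →ₗ[K] (ℕ →₀ M.carrier) :=
  Hom.toLin (pathι χ ≫ prodSnd _ _ ≫ formsFst)

/-- The coefficient `b` of the form `a + dt b`. -/
def pathB : (path χ).carrier →ₗ[K] (ℕ →₀ M.carrier) :=
  formsSnd ∘ₗ Hom.toLin (pathι χ ≫ prodSnd _ _)

theorem evalAt_one_pathA (x : (path χ).carrier) :
    evalAt M.carrier (1 : K) (pathA χ x) = Hom.toLin χ (Hom.toLin (pathFst χ) x) :=
  eqz_condition _ _ x

/-- Evaluation at the starting point. -/
def pathEval : path χ ⟶ M := (pathι χ ≫ prodSnd _ _ ≫ formsFst) ≫ polyEval M 0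

theorem pathEval_apply (x : (path χ).carrier) :
    Hom.toLin (pathEval χ) x = evalAt M.carrier (0 : K) (pathA χ x) := rfl

variable {χ} in
theorem path_ext {x y : (path χ).carrier}
    (h₁ : Hom.toLin (pathFst χ) x = Hom.toLin (pathFst χ) y) (h₂ : pathA χ x = pathA χ y)
    (h₃ : pathB χ x = pathB χ y) : x = y :=
  eqzι_injective _ _ (Prod.ext h₁ (forms_ext h₂ h₃))

variable {χ} in
theorem mem_path_gr {i : ℤ} {x : (path χ).carrier} : x ∈ (path χ).gr i ↔
    Hom.toLin (pathFst χ) x ∈ L.gr i ∧ pathA χ x ∈ polyGr M.gr i ∧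
      pathB χ x ∈ polyGr M.gr (i - 1) := Iff.rfl

theorem pathA_d (x : (path χ).carrier) :
    pathA χ ((path χ).d x) = Finsupp.mapRange.linearMap M.d (pathA χ x) := rfl

theorem pathB_d (x : (path χ).carrier) : pathB χ ((path χ).d x) =
    deriv K M.carrier (pathA χ x) - Finsupp.mapRange.linearMap M.d (pathB χ x) := rfl

variable {X : Type*} [AddCommGroup X] [Module K X]

/-- A linear map into the path DGLA given by its components. -/
def pathLin (l : X →ₗ[K] L.carrier) (a b : X →ₗ[K] (ℕ →₀ M.carrier))
    (w : ∀ x, evalAt M.carrier (1 : K) (a x) = Hom.toLin χ (l x)) :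
    X →ₗ[K] (path χ).carrier :=
  eqzLin _ _ (l.prod (formsMk ∘ₗ a.prod b)) w

variable (l : X →ₗ[K] L.carrier) (a b : X →ₗ[K] (ℕ →₀ M.carrier))
    (w : ∀ x, evalAt M.carrier (1 : K) (a x) = Hom.toLin χ (l x))

@[simp] theorem pathA_pathLin (x : X) : pathA χ (pathLin χ l a b w x) = a x := rfl

theorem deriv_const (x : M.carrier) :
    M.polyDer.toLin (Hom.toLin M.polyConst x) = 0 := by
  change deriv K M.carrier (Finsupp.single 0 x) = 0
  simp [deriv_single]

/-- The constant paths. -/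
def pathConst : L ⟶ path χ :=
  eqzLift _ _ (prodLift (𝟙 L) (χ ≫ formsInl M.polyConst deriv_const)) fun x => by
    change evalAt M.carrier (1 : K) (Finsupp.single 0 (Hom.toLin χ x)) = _
    rw [evalAt_single, pow_zero, one_smul]; rfl

@[simp] theorem pathA_pathConst (x : L.carrier) :
    pathA χ (Hom.toLin (pathConst χ) x) = Finsupp.single 0 (Hom.toLin χ x) := rfl

@[simp] theorem pathB_pathConst (x : L.carrier) :
    pathB χ (Hom.toLin (pathConst χ) x) = 0 := rfl

theorem pathEval_pathConst (x : L.carrier) :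
    Hom.toLin (pathEval χ) (Hom.toLin (pathConst χ) x) = Hom.toLin χ x := by
  rw [pathEval_apply, pathA_pathConst, evalAt_single, pow_zero, one_smul]

end path

section fibre

variable (χ : L ⟶ M)

/-- The homotopy fibre of a morphism of DGLAs. -/
def fibre : DGLA.{u, v} K := eqz (pathEval χ) (zeroHom _ _)

/-- The inclusion of the homotopy fibre. -/
def fibreι : fibre χ ⟶ path χ := eqzι _ _

theorem pathEval_fibreι (x : (fibre χ).carrier) :
    Hom.toLin (pathEval χ) (Hom.toLin (fibreι χ) x) = 0 := eqz_condition _ _ x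

/-- The component in `L`. -/
def fibreFst : fibre χ ⟶ L := fibreι χ ≫ pathFst χ

variable {χ} in
theorem fibreι_injective : Function.Injective (Hom.toLin (fibreι χ)) := eqzι_injective _ _

variable {χ} in
theorem mem_fibre_gr {i : ℤ} {x : (fibre χ).carrier} : x ∈ (fibre χ).gr i ↔
    Hom.toLin (fibreι χ) x ∈ (path χ).gr i := Iff.rfl

variable {X : Type*} [AddCommGroup X] [Module K X]

/-- A linear map into the homotopy fibre. -/
def fibreLin (f : X →ₗ[K] (path χ).carrier) (w : ∀ x, Hom.toLin (pathEval χ) (f x) = 0) :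
    X →ₗ[K] (fibre χ).carrier := eqzLin _ _ f w

@[simp] theorem fibreι_fibreLin (f : X →ₗ[K] (path χ).carrier)
    (w : ∀ x, Hom.toLin (pathEval χ) (f x) = 0) (x : X) :
    Hom.toLin (fibreι χ) (fibreLin χ f w x) = f x := rfl

/-- The map `(l, m) ↦ (l, t χ l + dt m)` from the cone to the homotopy fibre. -/
def fibreS : L.carrier × M.carrier →ₗ[K] (fibre χ).carrier :=
  fibreLin χ (pathLin χ (LinearMap.fst K _ _)
    (Finsupp.lsingle 1 ∘ₗ Hom.toLin χ ∘ₗ LinearMap.fst K _ _)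
    (Finsupp.lsingle 0 ∘ₗ LinearMap.snd K _ _) (fun x => by simp [evalAt_single]))
    (fun x => by
      change evalAt M.carrier (0 : K) (Finsupp.single 1 _) = 0
      simp [evalAt_single])

theorem fibreS_fst (x : L.carrier × M.carrier) :
    Hom.toLin (pathFst χ) (Hom.toLin (fibreι χ) (fibreS χ x)) = x.1 := rfl

theorem fibreS_A (x : L.carrier × M.carrier) :
    pathA χ (Hom.toLin (fibreι χ) (fibreS χ x)) = Finsupp.single 1 (Hom.toLin χ x.1) := rfl

theorem fibreS_B (x : L.carrier × M.carrier) :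
    pathB χ (Hom.toLin (fibreι χ) (fibreS χ x)) = Finsupp.single 0 x.2 := rfl

/-- The map `(l, a + dt b) ↦ (l, ∫ b)` from the homotopy fibre to the cone. -/
def fibreP : (fibre χ).carrier →ₗ[K] L.carrier × M.carrier :=
  (Hom.toLin (fibreFst χ)).prod
    (evalAt M.carrier (1 : K) ∘ₗ integ K M.carrier ∘ₗ pathB χ ∘ₗ Hom.toLin (fibreι χ))

/-- The negative of the homotopy between `s p` and the identity on the homotopy fibre. -/
def fibreH : (fibre χ).carrier →ₗ[K] (fibre χ).carrier :=
  fibreLin χ (pathLin χ 0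
    (Finsupp.lsingle 1 ∘ₗ evalAt M.carrier (1 : K) ∘ₗ integ K M.carrier ∘ₗ pathB χ ∘ₗ
      Hom.toLin (fibreι χ) - integ K M.carrier ∘ₗ pathB χ ∘ₗ Hom.toLin (fibreι χ)) 0
    (fun x => by simp [evalAt_single]))
    (fun x => by simp [pathEval_apply, evalAt_single, evalAt_zero_integ])

theorem fibreH_fst (x : (fibre χ).carrier) :
    Hom.toLin (pathFst χ) (Hom.toLin (fibreι χ) (fibreH χ x)) = 0 := rfl

theorem fibreH_A (x : (fibre χ).carrier) :
    pathA χ (Hom.toLin (fibreι χ) (fibreH χ x)) = Finsupp.single 1 (evalAt M.carrier (1 : K)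
      (integ K M.carrier (pathB χ (Hom.toLin (fibreι χ) x)))) -
        integ K M.carrier (pathB χ (Hom.toLin (fibreι χ) x)) := rfl

theorem fibreH_B (x : (fibre χ).carrier) :
    pathB χ (Hom.toLin (fibreι χ) (fibreH χ x)) = 0 := rfl

theorem fibreP_fst (x : (fibre χ).carrier) :
    (fibreP χ x).1 = Hom.toLin (pathFst χ) (Hom.toLin (fibreι χ) x) := rfl

theorem fibreP_snd (x : (fibre χ).carrier) : (fibreP χ x).2 =
    evalAt M.carrier (1 : K) (integ K M.carrier (pathB χ (Hom.toLin (fibreι χ) x))) := rfl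

/-- The homotopy sends `b` to the function `t ∫₀¹ b - ∫₀ᵗ b`, which vanishes at both ends and so
stays in the fibre. Its derivative replaces `b` by its mean, and the fundamental theorem of calculus
with `a(0) = 0` and `a(1) = χ l` replaces `a` by `t χ l`. -/
theorem fibre_homotopy [CharZero K] (x : (fibre χ).carrier) :
    (fibre χ).d (fibreH χ x) + fibreH χ ((fibre χ).d x) = fibreS χ (fibreP χ x) - x := by
  have h0 : evalAt M.carrier (0 : K) (pathA χ (Hom.toLin (fibreι χ) x)) = 0 :=
    pathEval_fibreι χ x
  have h1 := evalAt_one_pathA χ (Hom.toLin (fibreι χ) x)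
  apply fibreι_injective
  simp only [map_add, map_sub, Hom.comm (fibreι χ)]
  refine path_ext ?_ ?_ ?_
  · simp only [map_add, map_sub, Hom.comm (pathFst χ), fibreH_fst, fibreS_fst, fibreP_fst]
    simp
  · simp only [map_add, map_sub, pathA_d, fibreH_A, fibreS_A, fibreP_fst, Hom.comm (fibreι χ),
      pathB_d, integ_deriv, h0, h1, integ_mapRange, evalAt_mapRange]
    simp only [Finsupp.mapRange.linearMap_apply, Finsupp.mapRange_single, Finsupp.single_zero,
      map_zero, sub_zero, Finsupp.single_sub]
    abel
  · simp only [map_add, map_sub, pathB_d, fibreH_A, fibreH_B, fibreS_B, fibreP_snd, deriv_integ,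
      deriv_single]
    simp

theorem toLInf_q_ι (N : DGLA.{u, v} K) (x : N.carrier) :
    N.toLInf.q (ι (shift N.gr 1) x) = - N.d x := by
  change N.q (ι (shift N.gr 1) x) = _
  simp [q]

/-- The contraction of the homotopy fibre onto the suspended mapping cone. -/
def fibreContraction [CharZero K] : Contraction (fibre χ).toLInf where
  carrier := L.carrier × M.carrier
  gr := coneGr L M
  s := fibreS χ
  p := fibreP χ
  h := fibreH χ
  s_mem i x hx := mem_fibre_gr.2 (mem_path_gr.2 ⟨hx.1, single_mem_polyGr (Hom.mem χ i _ hx.1) 1,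
    single_mem_polyGr hx.2 0⟩)
  p_mem i x hx := by
    obtain ⟨h1, h2, h3⟩ := mem_path_gr.1 (mem_fibre_gr.1 hx)
    exact ⟨h1, evalAt_mem 1 (integ_mem h3)⟩
  h_mem i x hx := by
    obtain ⟨h1, h2, h3⟩ := mem_path_gr.1 (mem_fibre_gr.1 hx)
    exact mem_fibre_gr.2 (mem_path_gr.2 ⟨zero_mem _,
      sub_mem (single_mem_polyGr (evalAt_mem 1 (integ_mem h3)) 1) (integ_mem h3), zero_mem _⟩)
  p_s x := by
    refine Prod.ext rfl ?_
    change evalAt M.carrier (1 : K) (integ K M.carrier (Finsupp.single 0 x.2)) = x.2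
    simp [integ_single, evalAt_single]
  homotopy x := by
    -- Since `q₁ = -d`, the identity for `d` changes sign; this is why `fibreH` is a homotopy from
    -- the identity to `s p` for `d`.
    refine (congrArg₂ (fun a b : (fibre χ).carrier => a + b) (toLInf_q_ι (fibre χ) (fibreH χ x))
      (congrArg (fibreH χ) (toLInf_q_ι (fibre χ) x))).trans ?_
    refine Eq.trans ?_ (neg_sub (fibreS χ (fibreP χ x)) (x : (fibre χ).carrier))
    rw [← fibre_homotopy χ x, neg_add, map_neg]

end fibre

end DGLA

end LInf

end

/-! ### Naturality of the transfer and the functor on arrows -/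

noncomputable section

namespace LInf

open GSym Module.End

namespace Contraction

variable {K : Type u} [Field K] [CharZero K] {A B : LInfAlg.{u, v} K} (C : Contraction A)
  (C' : Contraction B)

section naturality

variable {φ : A.carrier →ₗ[K] B.carrier}
  (hφ : ∀ i, ∀ x ∈ shift A.gr 1 i, φ x ∈ shift B.gr 1 i)
  {ψ : C.carrier →ₗ[K] C'.carrier}
  (hψ : ∀ i, ∀ x ∈ shift C.gr 1 i, ψ x ∈ shift C'.gr 1 i)
  (hq : ∀ x, φ (A.q x) = B.q (GSym.map (gr := shift A.gr 1) (gr' := shift B.gr 1) φ hφ x))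
  (hh : ∀ x, φ (C.h x) = C'.h (φ x)) (hp : ∀ x, ψ (C.p x) = C'.p (φ x))

include hq hh in
-- A linear map compatible with the structure maps and the homotopies intertwines both coderivations
-- whose commutator is `D`. All further naturality is then spectral.
theorem map_D (x : A.S) : GSym.map (gr := shift A.gr 1) (gr' := shift B.gr 1) φ hφ (C.D x) =
    C'.D (GSym.map (gr := shift A.gr 1) (gr' := shift B.gr 1) φ hφ x) := by
  have h1 := coder_map (gr := shift A.gr 1) (gr' := shift B.gr 1) φ hφ hq
  have h2 := coder_map (gr := shift A.gr 1) (gr' := shift B.gr 1) φ hφ (f := C.h ∘ₗ proj)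
    (g := C'.h ∘ₗ proj) (fun x => by simp [hh, proj_map])
  simp only [D_apply, LInfAlg.Q, η, map_add, h1, h2]

include hp in
theorem map_mapP (x : A.S) :
    GSym.map (gr := shift C.gr 1) (gr' := shift C'.gr 1) ψ hψ (C.mapP x) =
      C'.mapP (GSym.map (gr := shift A.gr 1) (gr' := shift B.gr 1) φ hφ x) := by
  have hθ : ∀ i, ∀ x ∈ shift A.gr 1 i, (ψ ∘ₗ C.p) x ∈ shift C'.gr 1 i :=
    fun i x hx => hψ i _ (C.p_mem_shift i x hx)
  exact (GSym.map_map (gr' := shift C.gr 1) C.p C.p_mem_shift ψ hψ (ψ ∘ₗ C.p) hθ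
    (fun _ => rfl) x).trans
    (GSym.map_map (gr' := shift B.gr 1) φ hφ C'.p C'.p_mem_shift (ψ ∘ₗ C.p) hθ hp x).symm

include hq hh hp in
-- The right side lies in the generalized kernel for `C'`, by intertwining, and has the correct
-- image under `S(p)`. These two properties characterize `incl`.
theorem incl_map (x : C.S) :
    C'.incl (GSym.map (gr := shift C.gr 1) (gr' := shift C'.gr 1) ψ hψ x) =
      GSym.map (gr := shift A.gr 1) (gr' := shift B.gr 1) φ hφ (C.incl x) := by
  refine C'.eq_incl (maxGenEigenspace_intertwine
    (f := (GSym.map (gr := shift A.gr 1) (gr' := shift B.gr 1) φ hφ).toLinearMap)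
    (C.map_D C' hφ hq hh) (C.incl_mem x)) ?_
  rw [← C.map_mapP C' hφ hψ hp, mapP_incl]

include hq hh hp in
theorem map_transferQ (x : C.S) :
    GSym.map (gr := shift C.gr 1) (gr' := shift C'.gr 1) ψ hψ (C.transferQ x) =
      C'.transferQ (GSym.map (gr := shift C.gr 1) (gr' := shift C'.gr 1) ψ hψ x) := by
  rw [transferQ_apply, transferQ_apply, C.incl_map C' hφ hψ hq hh hp, C.map_mapP C' hφ hψ hp]
  exact congrArg _ (coder_map (gr := shift A.gr 1) (gr' := shift B.gr 1) φ hφ hq _)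

/-- The linear `L_∞`-morphism of transferred structures induced by a compatible pair of linear
maps. -/
def transferMap : C.transfer ⟶ C'.transfer :=
  LInfAlg.Hom.mk (mapCoalgHom (gr := shift C.gr 1) (gr' := shift C'.gr 1) ψ hψ)
    (map_one (GSym.map _ _)) (fun _ _ hx => map_mem_degree _ _ hx) fun x => by
      refine (congrArg (GSym.map ψ hψ) (LinearMap.congr_fun C.transfer_Q x)).trans ?_
      refine Eq.trans ?_ (LinearMap.congr_fun C'.transfer_Q _).symm
      exact C.map_transferQ C' hφ hψ hq hh hp x

end naturality

/-- With `h = 0` also `D = 0`, so the generalized kernel is everything and `S(s)` has the properties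
characterizing `incl`: the transfer is linear. -/
theorem incl_of_homotopy_zero (h : ∀ x, C.h x = 0) (x : C.S) : C.incl x = C.mapS x := by
  refine C.eq_incl (mem_maxGenEigenspace_of_apply_eq ?_) (C.mapP_mapS x)
  have h0 : C.h = 0 := LinearMap.ext h
  have h1 : C.η = 0 := by rw [η, h0]; simp [coder]
  rw [zero_smul, D_apply, h1]
  simp

end Contraction

theorem LInfAlg.linearPart_mapCoalgHom {K : Type u} [Field K] {A B : LInfAlg.{u, v} K} {f : A ⟶ B}
    {φ : A.carrier →ₗ[K] B.carrier} {hφ : ∀ i, ∀ x ∈ shift A.gr 1 i, φ x ∈ shift B.gr 1 i}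
    (h : ∀ x, Hom.toCoalgHom f x = GSym.map (gr := shift A.gr 1) (gr' := shift B.gr 1) φ hφ x)
    (x : A.carrier) : linearPart f x = φ x := by
  change proj (Hom.toCoalgHom f (ι _ x)) = _
  rw [h, GSym.map_ι, proj_ι]

namespace DGLA

variable {K : Type u} [Field K]

section functoriality

variable {χ χ' : Arrow (DGLA.{u, v} K)} (φ : χ ⟶ χ')

theorem arrow_w (x : χ.left.carrier) : Hom.toLin χ'.hom (Hom.toLin φ.left x) =
    Hom.toLin φ.right (Hom.toLin χ.hom x) :=
  LinearMap.congr_fun (congrArg Hom.toLin φ.w) x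

/-- The functoriality of the path DGLA. -/
def pathMap : path χ.hom ⟶ path χ'.hom :=
  eqzLift _ _ (prodLift (pathFst χ.hom ≫ φ.left) (pathι χ.hom ≫ prodSnd _ _ ≫
    formsMap (polyMap φ.right) fun x => (deriv_mapRange (Hom.toLin φ.right) x).symm)) fun x => by
      refine (evalAt_mapRange (Hom.toLin φ.right) 1 (pathA χ.hom x)).trans ?_
      rw [evalAt_one_pathA]
      exact (arrow_w φ _).symm

theorem pathFst_pathMap (x : (path χ.hom).carrier) :
    Hom.toLin (pathFst χ'.hom) (Hom.toLin (pathMap φ) x) =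
      Hom.toLin φ.left (Hom.toLin (pathFst χ.hom) x) := rfl

theorem pathA_pathMap (x : (path χ.hom).carrier) :
    pathA χ'.hom (Hom.toLin (pathMap φ) x) =
      Finsupp.mapRange.linearMap (Hom.toLin φ.right) (pathA χ.hom x) := rfl

theorem pathB_pathMap (x : (path χ.hom).carrier) :
    pathB χ'.hom (Hom.toLin (pathMap φ) x) =
      Finsupp.mapRange.linearMap (Hom.toLin φ.right) (pathB χ.hom x) := rfl

/-- The functoriality of the homotopy fibre. -/
def fibreMap : fibre χ.hom ⟶ fibre χ'.hom :=
  eqzLift _ _ (fibreι χ.hom ≫ pathMap φ) fun x => by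
    have h := pathEval_fibreι χ.hom x
    rw [toLin_comp, pathEval_apply, pathA_pathMap, evalAt_mapRange, ← pathEval_apply, h, map_zero]
    rfl

theorem fibreι_fibreMap (x : (fibre χ.hom).carrier) :
    Hom.toLin (fibreι χ'.hom) (Hom.toLin (fibreMap φ) x) =
      Hom.toLin (pathMap φ) (Hom.toLin (fibreι χ.hom) x) := rfl

theorem fibreMap_fibreH (x : (fibre χ.hom).carrier) :
    Hom.toLin (fibreMap φ) (fibreH χ.hom x) = fibreH χ'.hom (Hom.toLin (fibreMap φ) x) := by
  apply fibreι_injective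
  rw [fibreι_fibreMap]
  refine path_ext ?_ ?_ ?_
  · rw [pathFst_pathMap, fibreH_fst, fibreH_fst, map_zero]
  · rw [pathA_pathMap, fibreH_A, fibreH_A, fibreι_fibreMap, pathB_pathMap, integ_mapRange,
      evalAt_mapRange, map_sub]
    simp
  · rw [pathB_pathMap, fibreH_B, fibreH_B, map_zero]

/-- The map of cones, as a map between the retracts of the homotopy fibres. -/
def coneLin [CharZero K] :
    (fibreContraction χ.hom).carrier →ₗ[K] (fibreContraction χ'.hom).carrier :=
  DG.Hom.toLin ((coneFunctor K).map φ)

theorem coneLin_mem [CharZero K] (i : ℤ) (x : (fibreContraction χ.hom).carrier)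
    (hx : x ∈ shift (fibreContraction χ.hom).gr 1 i) :
    coneLin φ x ∈ shift (fibreContraction χ'.hom).gr 1 i :=
  DG.Hom.mem ((coneFunctor K).map φ) _ x hx

theorem coneLin_fibreP [CharZero K] (x : (fibre χ.hom).carrier) :
    coneLin φ (fibreP χ.hom x) = fibreP χ'.hom (Hom.toLin (fibreMap φ) x) := by
  refine Prod.ext rfl ?_
  rw [fibreP_snd, fibreι_fibreMap, pathB_pathMap, integ_mapRange, evalAt_mapRange]
  rfl

end functoriality

variable [CharZero K]

/-- The functor of `L_∞`-structures on mapping cones. -/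
def coneLInf (K : Type u) [Field K] [CharZero K] : Arrow (DGLA.{u, v} K) ⥤ LInfAlg.{u, v} K where
  obj χ := (fibreContraction χ.hom).transfer
  map {χ χ'} φ := (fibreContraction χ.hom).transferMap (fibreContraction χ'.hom)
    (Hom.mem_shift (fibreMap φ)) (coneLin_mem φ) (map_q (fibreMap φ)) (fibreMap_fibreH φ)
    (coneLin_fibreP φ)
  map_id χ := LInfAlg.Hom.ext (CoalgHom.ext fun x =>
    GSym.map_eq_self (gr := shift (fibreContraction χ.hom).gr 1) _ _ (fun _ => rfl) x)
  map_comp {χ χ' χ''} _ _ := LInfAlg.Hom.ext (CoalgHom.ext fun x =>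
    (GSym.map_map (gr := shift (fibreContraction χ.hom).gr 1)
      (gr' := shift (fibreContraction χ'.hom).gr 1)
      (gr'' := shift (fibreContraction χ''.hom).gr 1)
      _ _ _ _ _ _ (fun _ => rfl) x).symm)

theorem linearPart_coneLInf_map {χ χ' : Arrow (DGLA.{u, v} K)} (φ : χ ⟶ χ')
    (x : χ.left.carrier × χ.right.carrier) :
    LInfAlg.linearPart ((coneLInf K).map φ) x = coneLin φ x :=
  LInfAlg.linearPart_mapCoalgHom (f := (coneLInf K).map φ) (φ := coneLin φ) (hφ := coneLin_mem φ)
    (fun _ => rfl) x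

/-- By the fundamental theorem of calculus the integral of the derivative of `a` is `a(1) - a(0) = χ
l`, which is the extra term in the differential of the cone. -/
theorem fibreP_d {L M : DGLA.{u, v} K} (χ : L ⟶ M) (x : (fibre χ).carrier) :
    fibreP χ ((fibre χ).d x) = (cone χ).d (fibreP χ x) := by
  refine Prod.ext rfl ?_
  have h0 : evalAt M.carrier (0 : K) (pathA χ (Hom.toLin (fibreι χ) x)) = 0 :=
    pathEval_fibreι χ x
  have h1 := evalAt_one_pathA χ (Hom.toLin (fibreι χ) x)
  rw [fibreP_snd, Hom.comm (fibreι χ), pathB_d, map_sub, integ_deriv, h0, integ_mapRange, map_sub,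
    map_sub, h1, evalAt_mapRange]
  simp only [Finsupp.single_zero, map_zero, sub_zero]
  rfl

theorem coneLInf_d {L M : DGLA.{u, v} K} (χ : L ⟶ M) (x : L.carrier × M.carrier) :
    -((fibreContraction χ).transfer.q (ι (shift (coneGr L M) 1) x)) = (cone χ).d x := by
  refine (congrArg Neg.neg ((fibreContraction χ).transfer_q_ι x)).trans ?_
  refine (congrArg (fun y => -fibreP χ y) (toLInf_q_ι (fibre χ) (fibreS χ x))).trans ?_
  rw [map_neg, neg_neg, fibreP_d]
  exact congrArg _ ((fibreContraction χ).p_s x)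

/-- The complex underlying the `L_∞`-structure on the mapping cone is the mapping cone. -/
def coneLInfForgetIso (K : Type u) [Field K] [CharZero K] :
    coneLInf.{u, v} K ⋙ LInfAlg.forget K ≅ coneFunctor K :=
  NatIso.ofComponents (fun χ =>
    { hom := DG.Hom.mk (LinearMap.id (M := χ.left.carrier × χ.right.carrier)) (fun _ _ h => h)
        (fun x => coneLInf_d χ.hom x)
      inv := DG.Hom.mk (LinearMap.id (M := χ.left.carrier × χ.right.carrier)) (fun _ _ h => h)
        (fun x => (coneLInf_d χ.hom x).symm)
      hom_inv_id := rfl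
      inv_hom_id := rfl })
    fun φ => DG.Hom.ext (LinearMap.ext fun x => linearPart_coneLInf_map φ x)

/-! ### Restriction to `L → 0` and the Quillen construction -/

section toZero

variable (L : DGLA.{u, v} K)

theorem fibreH_toZero (x : (fibre L.toZero).carrier) : fibreH L.toZero x = 0 := by
  apply fibreι_injective
  refine path_ext ?_ ?_ ?_
  · rw [fibreH_fst, map_zero, map_zero]
  · exact Finsupp.ext fun _ => rfl
  · exact Finsupp.ext fun _ => rfl

/-- The canonical `L_∞`-morphism to `L` from the mapping cone of `L → 0`. -/
def coneLInfToZero : (coneLInf K).obj ((toArrow K).obj L) ⟶ (quillen K).obj L :=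
  (fibreContraction L.toZero).inclHom ≫ (quillen K).map (fibreFst L.toZero)

theorem coneLInfToZero_apply (x : ((coneLInf K).obj ((toArrow K).obj L)).S) :
    LInfAlg.Hom.toCoalgHom (coneLInfToZero L) x =
      GSym.map (gr := shift (fibre L.toZero).gr 1) (gr' := shift L.gr 1)
        (Hom.toLin (fibreFst L.toZero)) (Hom.mem_shift (fibreFst L.toZero))
        ((fibreContraction L.toZero).mapS x) :=
  congrArg (GSym.map (gr := shift (fibre L.toZero).gr 1) (gr' := shift L.gr 1) _ _)
    ((fibreContraction L.toZero).incl_of_homotopy_zero (fibreH_toZero L) x)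

theorem proj_fibreFst_mapS_ι (x : (fibreContraction L.toZero).carrier) :
    proj (GSym.map (gr := shift (fibre L.toZero).gr 1) (gr' := shift L.gr 1)
        (Hom.toLin (fibreFst L.toZero)) (Hom.mem_shift (fibreFst L.toZero))
        ((fibreContraction L.toZero).mapS (ι _ x))) =
      Hom.toLin (fibreFst L.toZero) ((fibreContraction L.toZero).s x) :=
  (congrArg (fun y => proj (GSym.map (gr := shift (fibre L.toZero).gr 1) (gr' := shift L.gr 1)
    (Hom.toLin (fibreFst L.toZero)) (Hom.mem_shift (fibreFst L.toZero)) y))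
    ((fibreContraction L.toZero).mapS_ι x)).trans
  ((congrArg proj (GSym.map_ι _ _ _)).trans (proj_ι _))

theorem proj_fibreFst_mapS_mul (v w : (fibreContraction L.toZero).carrier)
    (x : (fibreContraction L.toZero).S) :
    proj (GSym.map (gr := shift (fibre L.toZero).gr 1) (gr' := shift L.gr 1)
        (Hom.toLin (fibreFst L.toZero)) (Hom.mem_shift (fibreFst L.toZero))
        ((fibreContraction L.toZero).mapS (ι _ v * ι _ w * x))) = 0 := by
  have h (u) : GSym.map (gr := shift (fibre L.toZero).gr 1) (gr' := shift L.gr 1)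
      (Hom.toLin (fibreFst L.toZero)) (Hom.mem_shift (fibreFst L.toZero))
      ((fibreContraction L.toZero).mapS (ι _ u)) =
      ι _ (Hom.toLin (fibreFst L.toZero) ((fibreContraction L.toZero).s u)) :=
    (congrArg (GSym.map _ _) ((fibreContraction L.toZero).mapS_ι u)).trans (GSym.map_ι _ _ _)
  rw [map_mul, map_mul]
  refine (congrArg proj ((map_mul (GSym.map _ _) _ _).trans
    (congrArg₂ (· * ·) (map_mul (GSym.map _ _) _ _) rfl))).trans ?_
  rw [h, h, mul_assoc, proj_ι_mul, map_mul, counit_ι, zero_mul, zero_smul]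

theorem isLinear_coneLInfToZero : LInfAlg.IsLinear (coneLInfToZero L) := fun v w x =>
  (congrArg proj (coneLInfToZero_apply L _)).trans (proj_fibreFst_mapS_mul L v w x)

theorem linearPart_coneLInfToZero (x : L.carrier × PUnit.{v + 1}) :
    LInfAlg.linearPart (coneLInfToZero L) x = x.1 :=
  (congrArg proj (coneLInfToZero_apply L _)).trans (proj_fibreFst_mapS_ι L x)

theorem isIso_coneLInfToZero : IsIso (coneLInfToZero L) :=
  LInfAlg.isIso_of_linearPart
    ⟨fun x y h => Prod.ext ((linearPart_coneLInfToZero L x).symm.trans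
      (h.trans (linearPart_coneLInfToZero L y))) rfl,
    fun x => ⟨(x, PUnit.unit), linearPart_coneLInfToZero L (x, PUnit.unit)⟩⟩

/-- The restriction of the `L_∞`-structures on mapping cones to DGLAs is the Quillen
construction. -/
def coneLInfToArrowIso (K : Type u) [Field K] [CharZero K] :
    toArrow.{u, v} K ⋙ coneLInf K ≅ quillen K :=
  NatIso.ofComponents
    (fun L => haveI := isIso_coneLInfToZero L; asIso (coneLInfToZero L))
    fun {L L'} f => LInfAlg.Hom.ext (CoalgHom.ext fun x => by
      have h := (fibreContraction L.toZero).incl_map (fibreContraction L'.toZero)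
        (Hom.mem_shift (fibreMap ((toArrow K).map f))) (coneLin_mem ((toArrow K).map f))
        (map_q (fibreMap ((toArrow K).map f))) (fibreMap_fibreH ((toArrow K).map f))
        (coneLin_fibreP ((toArrow K).map f)) x
      refine (congrArg (GSym.map (gr := shift (fibre L'.toZero).gr 1) (gr' := shift L'.gr 1)
        (Hom.toLin (fibreFst L'.toZero)) (Hom.mem_shift (fibreFst L'.toZero))) h).trans ?_
      -- Both composites are algebra homomorphisms induced by one linear map, the component in `L`
      -- followed by `f`.
      have hθ := Hom.mem_shift (fibreFst L.toZero ≫ f)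
      refine (GSym.map_map (gr := shift (fibre L.toZero).gr 1)
        (gr' := shift (fibre L'.toZero).gr 1) (gr'' := shift L'.gr 1) _ _ _ _
        (Hom.toLin (fibreFst L.toZero ≫ f)) hθ (fun _ => rfl) _).trans ?_
      exact (GSym.map_map (gr := shift (fibre L.toZero).gr 1)
        (gr' := shift L.gr 1) (gr'' := shift L'.gr 1) _ _ _ _
        (Hom.toLin (fibreFst L.toZero ≫ f)) hθ (fun _ => rfl) _).symm)

end toZero

end DGLA

end LInf

end

/-! ### Natural endomorphisms of the underlying graded space -/

noncomputable section

namespace LInf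

open GSym

namespace DGLA

variable {K : Type u} [Field K]

section naturalMaps

theorem rescale_apply {V : Type*} [AddCommGroup V] [Module K V] (c : K) (a : ℕ →₀ V) (k : ℕ) :
    rescale V c a k = c ^ k • a k := by
  induction a using Finsupp.induction_linear with
  | zero => simp
  | add a b ha hb => simp [ha, hb]
  | single j x =>
    rw [rescale_single]
    by_cases h : j = k
    · subst h; simp
    · simp [h]

/-- The substitution `t ↦ 2 t` multiplies the coefficient of `t^k` by `2^k`, and in characteristic
`0` this equals `2` only for `k = 1`. -/
theorem eq_single_one_of_rescale [CharZero K] {V : Type*} [AddCommGroup V] [Module K V]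
    {a : ℕ →₀ V} (h : rescale V (2 : K) a = (2 : K) • a) : a = Finsupp.single 1 (a 1) := by
  ext k
  by_cases hk : k = 1
  · subst hk; simp
  · rw [Finsupp.single_eq_of_ne hk]
    have h1 : ((2 : K) ^ k - 2) • a k = 0 := by
      rw [sub_smul, ← rescale_apply, h, Finsupp.smul_apply, sub_self]
    refine (smul_eq_zero.1 h1).resolve_left fun h2 => hk ?_
    have h3 : (2 : ℕ) ^ k = 2 ^ 1 := by exact_mod_cast (sub_eq_zero.1 h2).trans (pow_one 2).symm
    exact Nat.pow_right_injective le_rfl h3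

/-- A product of polynomials without constant term starts in order two. Hence a restriction on
linear coefficients alone is automatically closed under the bracket, even if the prescribed span is
not a subalgebra. -/
theorem evalAt_zero_deriv_polyBilin {V : Type*} [AddCommGroup V] [Module K V]
    (b : V →ₗ[K] V →ₗ[K] V) {x y : ℕ →₀ V} (hx : evalAt V (0 : K) x = 0)
    (hy : evalAt V (0 : K) y = 0) : evalAt V (0 : K) (deriv K V (polyBilin b x y)) = 0 := by
  rw [deriv_polyBilin, map_add, evalAt_polyBilin, evalAt_polyBilin, hx, hy, map_zero, map_zero,
    LinearMap.zero_apply, add_zero]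

theorem evalAt_zero_deriv_single {V : Type*} [AddCommGroup V] [Module K V] (x : V) :
    evalAt V (0 : K) (deriv K V (Finsupp.single 1 x)) = x := by
  simp [deriv_single, evalAt_single]

variable (L : DGLA.{u, v} K)

theorem gproj_mem_span {i : ℤ} {x : L.carrier} (hx : x ∈ L.gr i) (j : ℤ) {y : L.carrier}
    (hy : y ∈ Submodule.span K {x, L.d x}) :
    gproj L.gr j y ∈ Submodule.span K {x, L.d x} := by
  have key : ∀ k, ∀ z ∈ L.gr k, z ∈ Submodule.span K {x, L.d x} →
      gproj L.gr j z ∈ Submodule.span K {x, L.d x} := fun k z hz hz' => by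
    by_cases h : j = k
    · subst h; rwa [gproj_of_mem hz]
    · rw [gproj_of_mem_ne h hz]; exact zero_mem _
  obtain ⟨a, b, rfl⟩ := Submodule.mem_span_pair.1 hy
  rw [map_add, map_smul, map_smul]
  exact add_mem (Submodule.smul_mem _ _ (key i x hx (Submodule.subset_span (by simp))))
    (Submodule.smul_mem _ _ (key _ _ (L.d_mem i x hx) (Submodule.subset_span (by simp))))

theorem d_mem_span {x y : L.carrier} (hy : y ∈ Submodule.span K {x, L.d x}) :
    L.d y ∈ Submodule.span K {x, L.d x} := by
  obtain ⟨a, b, rfl⟩ := Submodule.mem_span_pair.1 hy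
  rw [map_add, map_smul, map_smul, L.d_d, smul_zero, add_zero]
  exact Submodule.smul_mem _ _ (Submodule.subset_span (by simp))

/-- The polynomials without constant term whose linear coefficient is in the span of `x` and
`d x`. -/
def tangentSpan (x : L.carrier) : Submodule K L.poly.carrier :=
  LinearMap.ker (evalAt L.carrier (0 : K)) ⊓
    (Submodule.span K {x, L.d x}).comap (evalAt L.carrier (0 : K) ∘ₗ deriv K L.carrier)

variable {L} in
theorem mem_tangentSpan {x : L.carrier} {a : L.poly.carrier} : a ∈ L.tangentSpan x ↔
    evalAt L.carrier (0 : K) a = 0 ∧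
      evalAt L.carrier (0 : K) (deriv K L.carrier a) ∈ Submodule.span K {x, L.d x} := Iff.rfl

/-- The sub-DGLA of `L[t]` of polynomials without constant term whose linear coefficient is in the
span of `x` and `d x`. -/
def tangentSub {i : ℤ} {x : L.carrier} (hx : x ∈ L.gr i) : DGLA.{u, v} K :=
  L.poly.sub (L.tangentSpan x)
    (fun a ha j => by
      obtain ⟨h0, h1⟩ := mem_tangentSpan.1 ha
      refine mem_tangentSpan.2 ⟨?_, ?_⟩
      · refine (gproj_map (gr := L.poly.gr) (gr' := L.gr) (l := evalAt L.carrier (0 : K))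
          (fun _ _ h => evalAt_mem 0 h) a j).symm.trans ?_
        exact (congrArg (gproj L.gr j) h0).trans (map_zero _)
      · have := gproj_map (gr := L.poly.gr) (gr' := L.gr)
          (l := evalAt L.carrier (0 : K) ∘ₗ deriv K L.carrier)
          (fun _ _ h => evalAt_mem 0 (deriv_mem h)) a j
        refine (congrArg (· ∈ Submodule.span K {x, L.d x}) this).mp ?_
        exact L.gproj_mem_span hx j h1)
    (fun a ha => by
      obtain ⟨h0, h1⟩ := mem_tangentSpan.1 ha
      refine mem_tangentSpan.2 ⟨?_, ?_⟩
      · refine (evalAt_mapRange L.d 0 a).trans ?_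
        rw [h0, map_zero]
      · have h2 := (congrArg (evalAt L.carrier (0 : K)) (deriv_mapRange L.d a)).trans
          (evalAt_mapRange L.d 0 (deriv K L.carrier a))
        have h3 := L.d_mem_span h1
        rw [← h2] at h3
        exact h3)
    (fun a ha b hb => by
      obtain ⟨h0, -⟩ := mem_tangentSpan.1 ha
      obtain ⟨h0', -⟩ := mem_tangentSpan.1 hb
      refine mem_tangentSpan.2 ⟨?_, ?_⟩
      · refine (evalAt_polyBilin L.bracket 0 a b).trans ?_
        rw [h0, map_zero, LinearMap.zero_apply]
      · have h2 := evalAt_zero_deriv_polyBilin L.bracket h0 h0'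
        exact (congrArg (· ∈ Submodule.span K {x, L.d x}) h2).mpr (zero_mem _))

/-- The inclusion of the sub-DGLA. -/
def tangentι {i : ℤ} {x : L.carrier} (hx : x ∈ L.gr i) : L.tangentSub hx ⟶ L.poly :=
  Hom.mk (L.tangentSpan x).subtype (fun _ _ h => h) (fun _ => rfl) (fun _ _ => rfl)

theorem single_one_mem_tangentSpan (x : L.carrier) :
    (Finsupp.single 1 x : ℕ →₀ L.carrier) ∈ L.tangentSpan x := by
  refine mem_tangentSpan.2 ⟨by simp [evalAt_single], ?_⟩
  rw [evalAt_zero_deriv_single]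
  exact Submodule.subset_span (by simp)

/-- A degree preserving linear endomorphism, natural with respect to morphisms of DGLAs, preserves
the lines spanned by homogeneous elements. -/
theorem exists_smul_of_natural [CharZero K] (θ : ∀ L : DGLA.{u, v} K, L.carrier →ₗ[K] L.carrier)
    (hθ : ∀ (L M : DGLA.{u, v} K) (f : L ⟶ M) x, θ M (Hom.toLin f x) = Hom.toLin f (θ L x))
    (hdeg : ∀ (L : DGLA.{u, v} K) (i : ℤ), ∀ x ∈ L.gr i, θ L x ∈ L.gr i)
    {i : ℤ} {x : L.carrier} (hx : x ∈ L.gr i) : ∃ c : K, θ L x = c • x := by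
  -- The element `x` is lifted to the monomial `t x` in `L[t]`, where more endomorphisms and
  -- sub-DGLAs are available. Evaluation at `t = 1` recovers `θ L x` from `y`.
  obtain ⟨y, hy⟩ : ∃ y : ℕ →₀ L.carrier, y = θ L.poly (Finsupp.single 1 x : ℕ →₀ L.carrier) :=
    ⟨_, rfl⟩
  have h1 : evalAt L.carrier (1 : K) y = θ L x := by
    rw [hy]
    refine (hθ L.poly L (L.polyEval 1) (Finsupp.single 1 x : ℕ →₀ L.carrier)).symm.trans ?_
    refine congrArg (θ L) ((evalAt_single 1 1 x).trans ?_)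
    simp
  -- Naturality for the substitution `t ↦ 2 t`, which doubles `t x`, forces `y` to be a monomial of
  -- order one.
  have h2 : rescale L.carrier (2 : K) y = (2 : K) • y := by
    rw [hy]
    refine (hθ L.poly L.poly (L.polyRescale 2) (Finsupp.single 1 x : ℕ →₀ L.carrier)).symm.trans ?_
    refine (congrArg (θ L.poly) ((rescale_single 2 1 x).trans ?_)).trans (map_smul _ _ _)
    exact congrArg (· • (Finsupp.single 1 x : ℕ →₀ L.carrier)) (pow_one (2 : K))
  -- Naturality for the inclusion of the sub-DGLA containing `t x` confines the linear coefficient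
  -- of `y` to the span of `x` and `d x`.
  have h3 : y ∈ L.tangentSpan x := by
    have h := hθ _ _ (L.tangentι hx) ⟨_, L.single_one_mem_tangentSpan x⟩
    rw [hy]
    refine (congrArg (· ∈ L.tangentSpan x) h).mpr ?_
    exact (θ (L.tangentSub hx) ⟨_, L.single_one_mem_tangentSpan x⟩ : L.tangentSpan x).2
  have h4 := eq_single_one_of_rescale h2
  have h5 : θ L x = y 1 := by
    rw [← h1, h4, evalAt_single]; simp
  have h6 := (mem_tangentSpan.1 h3).2
  rw [h4, evalAt_zero_deriv_single, ← h5] at h6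
  obtain ⟨a, b, h8⟩ := Submodule.mem_span_pair.1 h6
  refine ⟨a, ?_⟩
  -- Passing to the component of degree `i` removes the multiple of `d x`, which has degree `i + 1`.
  have h9 := congrArg (gproj L.gr i) h8
  rw [map_add, map_smul, map_smul, gproj_of_mem hx,
    gproj_of_mem_ne (by omega : i ≠ i + 1) (L.d_mem i x hx), smul_zero, add_zero,
    gproj_of_mem (hdeg L i x hx)] at h9
  exact h9.symm

end naturalMaps

end DGLA

end LInf

end

/-! ### Contracting the cone of the path evaluation onto the homotopy fibre -/

noncomputable section

namespace LInf

open GSym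

/-- A linear endomorphism scaling every homogeneous element by a nonzero factor is bijective. -/
theorem bijective_of_smul {K V : Type*} [Field K] [AddCommGroup V] [Module K V]
    {gr : ℤ → Submodule K V} [Decomposition gr] {ω : V →ₗ[K] V}
    (h : ∀ i, ∀ x ∈ gr i, ∃ c : K, c ≠ 0 ∧ ω x = c • x) : Function.Bijective ω := by
  have hω : ∀ i, ∀ x ∈ gr i, ω x ∈ gr i := fun i x hx => by
    obtain ⟨c, -, hc⟩ := h i x hx
    rw [hc]; exact Submodule.smul_mem _ _ hx
  constructor
  · refine (injective_iff_map_eq_zero ω).2 fun x hx => ?_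
    refine (Submodule.mem_bot K).1 (mem_iSup_of_decompose (gr := gr) x fun i => ?_)
    obtain ⟨c, h0, hc⟩ := h i _ (gproj_mem (gr := gr) i x)
    rw [← gproj_map hω, hx, map_zero] at hc
    exact (Submodule.mem_bot K).2 ((smul_eq_zero.1 hc.symm).resolve_left h0)
  · rw [← LinearMap.range_eq_top, eq_top_iff]
    refine fun x _ => mem_iSup_of_decompose (gr := gr) x fun i => ?_
    obtain ⟨c, h0, hc⟩ := h i _ (gproj_mem (gr := gr) i x)
    refine ⟨c⁻¹ • gproj gr i x, ?_⟩
    rw [map_smul, hc, inv_smul_smul₀ h0]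
    rfl

/-- A contraction of a complex isomorphic to the complex underlying an `L_∞`-algebra. -/
def Contraction.ofIso {K : Type u} [Field K] [CharZero K] {A : LInfAlg.{u, v} K} {T : DG.{u, v} K}
    (e : (LInfAlg.forget K).obj A ≅ T) {W : Type v} [AddCommGroup W] [Module K W]
    (gr : ℤ → Submodule K W) [Decomposition gr] (s : W →ₗ[K] T.carrier) (p : T.carrier →ₗ[K] W)
    (h : T.carrier →ₗ[K] T.carrier) (s_mem : ∀ i, ∀ x ∈ gr i, s x ∈ T.gr i)
    (p_mem : ∀ i, ∀ x ∈ T.gr i, p x ∈ gr i) (h_mem : ∀ i, ∀ x ∈ T.gr i, h x ∈ T.gr (i - 1))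
    (p_s : ∀ x, p (s x) = x) (homotopy : ∀ x, T.d (h x) + h (T.d x) = x - s (p x)) :
    Contraction A where
  carrier := W
  gr := gr
  s := DG.Hom.toLin e.inv ∘ₗ s
  p := p ∘ₗ DG.Hom.toLin e.hom
  h := -(DG.Hom.toLin e.inv ∘ₗ h ∘ₗ DG.Hom.toLin e.hom)
  s_mem i x hx := DG.Hom.mem e.inv i _ (s_mem i x hx)
  p_mem i x hx := p_mem i _ (DG.Hom.mem e.hom i x hx)
  h_mem i x hx := neg_mem (DG.Hom.mem e.inv _ _ (h_mem i _ (DG.Hom.mem e.hom i x hx)))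
  p_s x := (congrArg p (LinearMap.congr_fun (congrArg DG.Hom.toLin e.inv_hom_id) (s x))).trans
    (p_s x)
  homotopy x := by
    have h1 : ∀ y, A.q (ι _ (DG.Hom.toLin e.inv y)) = -DG.Hom.toLin e.inv (T.d y) := fun y =>
      (neg_neg _).symm.trans (congrArg Neg.neg (DG.Hom.comm e.inv y).symm)
    have h2 : DG.Hom.toLin e.hom (A.q (ι _ x)) = -T.d (DG.Hom.toLin e.hom x) := by
      refine (neg_neg _).symm.trans (congrArg Neg.neg ?_)
      exact (map_neg (DG.Hom.toLin e.hom) _).symm.trans (DG.Hom.comm e.hom x)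
    have h3 : DG.Hom.toLin e.inv (DG.Hom.toLin e.hom x) = x :=
      LinearMap.congr_fun (congrArg DG.Hom.toLin e.hom_inv_id) x
    have h4 := congrArg (DG.Hom.toLin e.inv) (homotopy (DG.Hom.toLin e.hom x))
    rw [map_add, map_sub, h3] at h4
    have h5 : ∀ y : A.carrier, A.q (ι _ (-y)) = -A.q (ι _ y) := fun y => by
      rw [map_neg, map_neg]
    refine Eq.trans ?_ h4
    refine congrArg₂ (· + ·) ?_ ?_
    · exact (h5 _).trans ((congrArg Neg.neg (h1 _)).trans (neg_neg _))
    · refine (congrArg (fun y => -DG.Hom.toLin e.inv (h y)) h2).trans ?_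
      rw [map_neg, map_neg, neg_neg]

namespace DGLA

variable {K : Type u} [Field K]

section pathCone

variable {L M : DGLA.{u, v} K} (χ : L ⟶ M)

/-- The retraction of the cone of the evaluation `path χ → M` onto the fibre of the evaluation. -/
def pathConeR : (cone (pathEval χ)).carrier →ₗ[K] (fibre χ).carrier :=
  fibreLin χ (pathLin χ (Hom.toLin (pathFst χ) ∘ₗ LinearMap.fst K (path χ).carrier M.carrier)
    ((pathA χ - (Finsupp.lsingle 0 - Finsupp.lsingle 1) ∘ₗ evalAt M.carrier (0 : K) ∘ₗ pathA χ) ∘ₗ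
      LinearMap.fst K (path χ).carrier M.carrier)
    (pathB χ ∘ₗ LinearMap.fst K (path χ).carrier M.carrier +
      Finsupp.lsingle 0 ∘ₗ LinearMap.snd K (path χ).carrier M.carrier)
    (fun x => by
      refine Eq.trans ?_ (evalAt_one_pathA χ x.1)
      change evalAt M.carrier (1 : K) (pathA χ x.1 -
        (Finsupp.single 0 (Hom.toLin (pathEval χ) x.1) -
          Finsupp.single 1 (Hom.toLin (pathEval χ) x.1))) = _
      simp [evalAt_single]))
    (fun x => by
      change evalAt M.carrier (0 : K) (pathA χ x.1 -
        (Finsupp.single 0 (Hom.toLin (pathEval χ) x.1) -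
          Finsupp.single 1 (Hom.toLin (pathEval χ) x.1))) = 0
      rw [map_sub, ← pathEval_apply]
      simp [evalAt_single])

/-- The homotopy contracting the cone of the evaluation `path χ → M` onto the fibre. -/
def pathConeH : (cone (pathEval χ)).carrier →ₗ[K] (cone (pathEval χ)).carrier :=
  LinearMap.inl K (path χ).carrier M.carrier ∘ₗ
    pathLin χ 0 (Finsupp.lsingle 0 - Finsupp.lsingle 1) 0 (fun x => by simp [evalAt_single]) ∘ₗ
      LinearMap.snd K (path χ).carrier M.carrier

/-- The inclusion of the fibre into the cone. -/
def pathConeS : (fibre χ).carrier →ₗ[K] (cone (pathEval χ)).carrier :=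
  LinearMap.inl K (path χ).carrier M.carrier ∘ₗ Hom.toLin (fibreι χ)

theorem pathConeR_fst (x : (cone (pathEval χ)).carrier) :
    Hom.toLin (pathFst χ) (Hom.toLin (fibreι χ) (pathConeR χ x)) = Hom.toLin (pathFst χ) x.1 := rfl

theorem pathConeR_A (x : (cone (pathEval χ)).carrier) :
    pathA χ (Hom.toLin (fibreι χ) (pathConeR χ x)) = pathA χ x.1 -
      (Finsupp.single 0 (Hom.toLin (pathEval χ) x.1) -
        Finsupp.single 1 (Hom.toLin (pathEval χ) x.1)) := rfl

theorem pathConeR_B (x : (cone (pathEval χ)).carrier) :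
    pathB χ (Hom.toLin (fibreι χ) (pathConeR χ x)) = pathB χ x.1 + Finsupp.single 0 x.2 := rfl

theorem pathConeH_fst (x : (cone (pathEval χ)).carrier) :
    Hom.toLin (pathFst χ) (pathConeH χ x).1 = 0 := rfl

theorem pathConeH_A (x : (cone (pathEval χ)).carrier) :
    pathA χ (pathConeH χ x).1 = Finsupp.single 0 x.2 - Finsupp.single 1 x.2 := rfl

theorem pathConeH_B (x : (cone (pathEval χ)).carrier) :
    pathB χ (pathConeH χ x).1 = 0 := rfl

theorem pathConeR_pathConeS (x : (fibre χ).carrier) : pathConeR χ (pathConeS χ x) = x := by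
  apply fibreι_injective
  have h : Hom.toLin (pathEval χ) (pathConeS χ x).1 = 0 := pathEval_fibreι χ x
  refine path_ext rfl ?_ ?_
  · rw [pathConeR_A, h, Finsupp.single_zero, Finsupp.single_zero, sub_zero, sub_zero]; rfl
  · rw [pathConeR_B]
    exact (congrArg (_ + ·) (Finsupp.single_zero 0)).trans (add_zero _)

/-- Evaluation at `t = 0` has the linear section `m ↦ (1 - t) m`, which vanishes at `t = 1` as paths
over `l = 0` must. The cone of a split surjection contracts onto its kernel, and the homotopy is
this section. -/
theorem pathCone_homotopy (x : (cone (pathEval χ)).carrier) :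
    (cone (pathEval χ)).d (pathConeH χ x) + pathConeH χ ((cone (pathEval χ)).d x) =
      x - pathConeS χ (pathConeR χ x) := by
  refine Prod.ext (path_ext ?_ ?_ ?_) ?_
  · change Hom.toLin (pathFst χ) ((path χ).d (pathConeH χ x).1 +
      (pathConeH χ ((cone (pathEval χ)).d x)).1) =
        Hom.toLin (pathFst χ) (x.1 - Hom.toLin (fibreι χ) (pathConeR χ x))
    rw [map_add, map_sub, Hom.comm (pathFst χ), pathConeH_fst, pathConeH_fst, pathConeR_fst,
      map_zero, add_zero, sub_self]
  · change pathA χ ((path χ).d (pathConeH χ x).1 + (pathConeH χ ((cone (pathEval χ)).d x)).1) =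
        pathA χ (x.1 - Hom.toLin (fibreι χ) (pathConeR χ x))
    have h : ((cone (pathEval χ)).d x).2 = Hom.toLin (pathEval χ) x.1 - M.d x.2 := rfl
    rw [map_add, map_sub, pathA_d, pathConeH_A, pathConeH_A, pathConeR_A, h, map_sub]
    simp only [Finsupp.mapRange.linearMap_apply, Finsupp.mapRange_single, Finsupp.single_sub]
    abel
  · change pathB χ ((path χ).d (pathConeH χ x).1 + (pathConeH χ ((cone (pathEval χ)).d x)).1) =
        pathB χ (x.1 - Hom.toLin (fibreι χ) (pathConeR χ x))
    rw [map_add, map_sub, pathB_d, pathConeH_A, pathConeH_B, pathConeH_B, pathConeR_B, map_sub,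
      deriv_single, deriv_single]
    simp
  · change Hom.toLin (pathEval χ) (pathConeH χ x).1 - M.d (pathConeH χ x).2 +
      (pathConeH χ ((cone (pathEval χ)).d x)).2 = x.2 - 0
    have h1 : (pathConeH χ x).2 = 0 := rfl
    have h2 : (pathConeH χ ((cone (pathEval χ)).d x)).2 = 0 := rfl
    rw [h1, h2, pathEval_apply, pathConeH_A, map_sub, evalAt_single, evalAt_single]
    simp

theorem pathConeS_mem (i : ℤ) (x : (fibre χ).carrier) (hx : x ∈ (fibre χ).gr i) :
    pathConeS χ x ∈ (cone (pathEval χ)).gr i :=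
  ⟨Hom.mem (fibreι χ) i x hx, zero_mem _⟩

theorem pathConeR_mem (i : ℤ) (x : (cone (pathEval χ)).carrier)
    (hx : x ∈ (cone (pathEval χ)).gr i) : pathConeR χ x ∈ (fibre χ).gr i := by
  obtain ⟨h1, h2, h3⟩ := mem_path_gr.1 hx.1
  have h4 := Hom.mem (pathEval χ) i _ hx.1
  exact mem_fibre_gr.2 (mem_path_gr.2 ⟨h1,
    sub_mem h2 (sub_mem (single_mem_polyGr h4 0) (single_mem_polyGr h4 1)),
    add_mem h3 (single_mem_polyGr hx.2 0)⟩)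

theorem pathConeH_mem (i : ℤ) (x : (cone (pathEval χ)).carrier)
    (hx : x ∈ (cone (pathEval χ)).gr i) : pathConeH χ x ∈ (cone (pathEval χ)).gr (i - 1) :=
  ⟨mem_path_gr.2 ⟨zero_mem _, sub_mem (single_mem_polyGr hx.2 0) (single_mem_polyGr hx.2 1),
    zero_mem _⟩, zero_mem _⟩

/-- The inclusion of the homotopy fibre as a morphism of arrows. -/
def fibreArrow : (toArrow K).obj (fibre χ) ⟶ Arrow.mk (pathEval χ) :=
  Arrow.homMk (fibreι χ) (zeroHom _ _) (hom_ext fun x => pathEval_fibreι χ x)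

/-- The inclusion of a morphism of DGLAs into the evaluation of paths. -/
def constArrow : Arrow.mk χ ⟶ Arrow.mk (pathEval χ) :=
  Arrow.homMk (pathConst χ) (𝟙 M) (hom_ext fun x => pathEval_pathConst χ x)

theorem coneFunctor_fibreArrow
    (x : ((coneFunctor K).obj ((toArrow K).obj (fibre χ))).carrier) :
    DG.Hom.toLin ((coneFunctor K).map (fibreArrow χ)) x = pathConeS χ (coneToZero _ x) := rfl

/-- The retraction subtracts `(1 - t) χ l` from the constant path at `χ l`, leaving `t χ l`, which
is the form chosen in `fibreS`. The zigzag through the path object thus recovers the embedding of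
the cone into the homotopy fibre. -/
theorem pathConeR_coneFunctor_constArrow (x : L.carrier × M.carrier) :
    pathConeR χ (DG.Hom.toLin ((coneFunctor K).map (constArrow χ)) x) = fibreS χ x := by
  apply fibreι_injective
  have h1 : (DG.Hom.toLin ((coneFunctor K).map (constArrow χ)) x).1 = Hom.toLin (pathConst χ) x.1 :=
    rfl
  have h2 : (DG.Hom.toLin ((coneFunctor K).map (constArrow χ)) x).2 = x.2 := rfl
  refine path_ext rfl ?_ ?_
  · refine (pathConeR_A χ _).trans ?_
    rw [h1, pathEval_pathConst, pathA_pathConst, fibreS_A, sub_sub_cancel]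
  · refine (pathConeR_B χ _).trans ?_
    rw [h1, h2, pathB_pathConst, fibreS_B, zero_add]

end pathCone

end DGLA

end LInf

end

/-! ### Uniqueness on objects -/

noncomputable section

namespace LInf

open GSym

variable {K : Type u} [Field K]

theorem DG.bijective_of_iso {A B : DG.{u, v} K} (e : A ≅ B) :
    Function.Bijective (DG.Hom.toLin e.hom) :=
  Function.bijective_iff_has_inverse.2 ⟨DG.Hom.toLin e.inv,
    LinearMap.congr_fun (congrArg DG.Hom.toLin e.hom_inv_id),
    LinearMap.congr_fun (congrArg DG.Hom.toLin e.inv_hom_id)⟩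

variable [CharZero K]

theorem LInfAlg.bijective_linearPart_of_iso {A B : LInfAlg.{u, v} K} (e : A ≅ B) :
    Function.Bijective (LInfAlg.linearPart e.hom) :=
  DG.bijective_of_iso ((LInfAlg.forget K).mapIso e)

theorem LInfAlg.linearPart_comp_apply {A B C : LInfAlg.{u, v} K} (f : A ⟶ B) (g : B ⟶ C)
    (x : A.carrier) : linearPart (f ≫ g) x = linearPart g (linearPart f x) :=
  LinearMap.congr_fun (linearPart_comp f g) x

theorem LInfAlg.linearPart_square {A B C D : LInfAlg.{u, v} K} {f : A ⟶ B} {g : B ⟶ D} {h : A ⟶ C}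
    {k : C ⟶ D} (w : f ≫ g = h ≫ k) (x : A.carrier) :
    linearPart g (linearPart f x) = linearPart k (linearPart h x) := by
  rw [← linearPart_comp_apply, ← linearPart_comp_apply, w]

namespace DGLA

theorem coneToZero_map {L M : DGLA.{u, v} K} (f : L ⟶ M)
    (x : ((coneFunctor K).obj ((toArrow K).obj L)).carrier) :
    coneToZero M (DG.Hom.toLin ((coneFunctor K).map ((toArrow K).map f)) x) =
      Hom.toLin f (coneToZero L x) := rfl

theorem linearPart_quillen_map {L M : DGLA.{u, v} K} (f : L ⟶ M) (x : L.carrier) :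
    LInfAlg.linearPart ((quillen K).map f) x = Hom.toLin f x :=
  LInfAlg.linearPart_mapCoalgHom (f := (quillen K).map f) (φ := Hom.toLin f)
    (hφ := Hom.mem_shift f) (fun _ => rfl) x

section uniqueness

variable {F : Arrow (DGLA.{u, v} K) ⥤ LInfAlg.{u, v} K} (α : toArrow K ⋙ F ≅ quillen K)
  (β : F ⋙ LInfAlg.forget K ≅ coneFunctor K)

/-- The identification with the mapping cone of the complex underlying the value of a functor. -/
def toCone (χ : Arrow (DGLA.{u, v} K)) :
    (F.obj χ).carrier →ₗ[K] ((coneFunctor K).obj χ).carrier :=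
  DG.Hom.toLin (β.hom.app χ)

theorem toCone_bijective (χ : Arrow (DGLA.{u, v} K)) : Function.Bijective (toCone β χ) :=
  DG.bijective_of_iso (β.app χ)

theorem toCone_mem (χ : Arrow (DGLA.{u, v} K)) (i : ℤ) (x : (F.obj χ).carrier)
    (hx : x ∈ (F.obj χ).gr i) : toCone β χ x ∈ ((coneFunctor K).obj χ).gr i :=
  DG.Hom.mem (β.hom.app χ) i x hx

theorem toCone_map {χ χ' : Arrow (DGLA.{u, v} K)} (φ : χ ⟶ χ') (x : (F.obj χ).carrier) :
    toCone β χ' (LInfAlg.linearPart (F.map φ) x) =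
      DG.Hom.toLin ((coneFunctor K).map φ) (toCone β χ x) :=
  LinearMap.congr_fun (congrArg DG.Hom.toLin (β.hom.naturality φ)) x

/-- The identification of a DGLA, seen as an `L_∞`-algebra, with the value of a functor. -/
def toValue (L : DGLA.{u, v} K) : (quillen K).obj L ⟶ F.obj ((toArrow K).obj L) := α.inv.app L

theorem toValue_map {L M : DGLA.{u, v} K} (f : L ⟶ M) : (quillen K).map f ≫ toValue α M =
    toValue α L ≫ F.map ((toArrow K).map f) := α.inv.naturality f

/-- The discrepancy between the two identifications of the complex underlying the value of the
functor at `L → 0` with `L`. -/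
def discrepancy (L : DGLA.{u, v} K) : L.carrier →ₗ[K] L.carrier :=
  coneToZero L ∘ₗ toCone β ((toArrow K).obj L) ∘ₗ LInfAlg.linearPart (toValue α L)

theorem discrepancy_apply (L : DGLA.{u, v} K) (x : L.carrier) : discrepancy α β L x =
    coneToZero L (toCone β ((toArrow K).obj L) (LInfAlg.linearPart (toValue α L) x)) := rfl

theorem discrepancy_bijective (L : DGLA.{u, v} K) : Function.Bijective (discrepancy α β L) := by
  have h : Function.Bijective (coneToZero L) :=
    ⟨fun x y hxy => Prod.ext hxy rfl, fun x => ⟨(x, PUnit.unit), rfl⟩⟩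
  exact h.comp ((toCone_bijective β _).comp
    (LInfAlg.bijective_linearPart_of_iso (α.symm.app L)))

theorem discrepancy_mem (L : DGLA.{u, v} K) (i : ℤ) (x : L.carrier) (hx : x ∈ L.gr i) :
    discrepancy α β L x ∈ L.gr i :=
  (toCone_mem β _ i _ (LInfAlg.linearPart_mem (toValue α L) i x hx)).1

/-- Both identifications are natural and linear parts compose, so their discrepancy is natural. This
puts `exists_smul_of_natural` at disposal. -/
theorem discrepancy_map (L M : DGLA.{u, v} K) (f : L ⟶ M) (x : L.carrier) :
    discrepancy α β M (Hom.toLin f x) = Hom.toLin f (discrepancy α β L x) := by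
  have h := LInfAlg.linearPart_square (toValue_map α f) x
  rw [linearPart_quillen_map] at h
  rw [discrepancy_apply, discrepancy_apply, h, toCone_map, coneToZero_map]

theorem exists_smul_discrepancy {L : DGLA.{u, v} K} {i : ℤ} {x : L.carrier} (hx : x ∈ L.gr i) :
    ∃ c : K, discrepancy α β L x = c • x :=
  exists_smul_of_natural L (discrepancy α β) (discrepancy_map α β) (discrepancy_mem α β) hx

variable {L M : DGLA.{u, v} K} (χ : L ⟶ M)

/-- The contraction of the value at the evaluation `path χ → M` onto the homotopy fibre. -/
def pathContraction : Contraction (F.obj (Arrow.mk (pathEval χ))) :=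
  Contraction.ofIso (β.app (Arrow.mk (pathEval χ))) (fibre χ).gr (pathConeS χ) (pathConeR χ)
    (pathConeH χ) (pathConeS_mem χ) (pathConeR_mem χ) (pathConeH_mem χ) (pathConeR_pathConeS χ)
    (pathCone_homotopy χ)

theorem pathContraction_p (x : (F.obj (Arrow.mk (pathEval χ))).carrier) :
    (pathContraction β χ).p x = pathConeR χ (toCone β (Arrow.mk (pathEval χ)) x) := rfl

/-- The comparison of the homotopy fibre with the structure transferred to it. -/
def fibreComparison : (quillen K).obj (fibre χ) ⟶ (pathContraction β χ).transfer :=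
  toValue α (fibre χ) ≫ F.map (fibreArrow χ) ≫ (pathContraction β χ).projHom

/-- Under `β` the arrow `fibreArrow χ` acts by the inclusion of the fibre into the cone of the
evaluation, and the retraction undoes this inclusion. Only the mismatch between `α` and `β` remains.
-/
theorem linearPart_fibreComparison (x : (fibre χ).carrier) :
    LInfAlg.linearPart (fibreComparison α β χ) x = discrepancy α β (fibre χ) x := by
  have h : pathConeR χ (toCone β (Arrow.mk (pathEval χ)) (LInfAlg.linearPart
      (F.map (fibreArrow χ)) (LInfAlg.linearPart (toValue α (fibre χ)) x))) =
        discrepancy α β (fibre χ) x := by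
    rw [toCone_map, coneFunctor_fibreArrow, pathConeR_pathConeS, discrepancy_apply]
  refine Eq.trans ?_ h
  refine (LInfAlg.linearPart_comp_apply (toValue α (fibre χ))
    (F.map (fibreArrow χ) ≫ (pathContraction β χ).projHom) x).trans ?_
  refine (LInfAlg.linearPart_comp_apply (F.map (fibreArrow χ))
    (pathContraction β χ).projHom _).trans ?_
  exact (pathContraction β χ).linearPart_projHom _

theorem isIso_fibreComparison : IsIso (fibreComparison α β χ) :=
  LInfAlg.isIso_of_linearPart (by
    have h : LInfAlg.linearPart (fibreComparison α β χ) = discrepancy α β (fibre χ) :=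
      LinearMap.ext (linearPart_fibreComparison α β χ)
    rw [h]
    exact discrepancy_bijective α β _)

/-- The comparison with the `L_∞`-structure on the mapping cone. -/
def coneComparison : F.obj (Arrow.mk χ) ⟶ (coneLInf K).obj (Arrow.mk χ) :=
  haveI := isIso_fibreComparison α β χ
  F.map (constArrow χ) ≫ (pathContraction β χ).projHom ≫ inv (fibreComparison α β χ) ≫
    (fibreContraction χ).projHom

/-- The linear part is `p θ⁻¹ s` after `toCone`, with `θ` the discrepancy on the homotopy fibre; the
element `y` stands for `θ⁻¹ s` of the given cone element. -/
theorem linearPart_coneComparison (x : (F.obj (Arrow.mk χ)).carrier) :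
    ∃ y : (fibre χ).carrier, discrepancy α β (fibre χ) y = fibreS χ (toCone β (Arrow.mk χ) x) ∧
      LInfAlg.linearPart (coneComparison α β χ) x = fibreP χ y := by
  have := isIso_fibreComparison α β χ
  refine ⟨LInfAlg.linearPart (inv (fibreComparison α β χ))
    (LInfAlg.linearPart (pathContraction β χ).projHom
      (LInfAlg.linearPart (F.map (constArrow χ)) x)), ?_, ?_⟩
  · refine (linearPart_fibreComparison α β χ _).symm.trans ?_
    refine (LInfAlg.linearPart_comp_apply (inv (fibreComparison α β χ))
      (fibreComparison α β χ) _).symm.trans ?_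
    rw [IsIso.inv_hom_id, LInfAlg.linearPart_id]
    refine ((pathContraction β χ).linearPart_projHom _).trans ?_
    rw [pathContraction_p]
    refine (congrArg (pathConeR χ) (toCone_map β (constArrow χ) _)).trans ?_
    exact pathConeR_coneFunctor_constArrow χ _
  · refine (LInfAlg.linearPart_comp_apply _ _ x).trans ?_
    refine (LInfAlg.linearPart_comp_apply _ _ _).trans ?_
    refine (LInfAlg.linearPart_comp_apply _ _ _).trans ?_
    exact (fibreContraction χ).linearPart_projHom _

/-- The discrepancy acts on the homogeneous vector `s x` as a scalar `c`, so its inverse acts there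
as `c⁻¹`, and `p s = 1`. The scalar may vary with the element, so no commutation of the discrepancy
with `s` or `p` is used. -/
theorem linearPart_coneComparison_of_mem {i : ℤ} {x : (F.obj (Arrow.mk χ)).carrier}
    (hx : x ∈ (F.obj (Arrow.mk χ)).gr i) : ∃ c : K, c ≠ 0 ∧
      LInfAlg.linearPart (coneComparison α β χ) x = c • toCone β (Arrow.mk χ) x := by
  obtain ⟨y, h1, h2⟩ := linearPart_coneComparison α β χ x
  have hs : fibreS χ (toCone β (Arrow.mk χ) x) ∈ (fibre χ).gr i :=
    (fibreContraction χ).s_mem i _ (toCone_mem β _ i x hx)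
  have hps : fibreP χ (fibreS χ (toCone β (Arrow.mk χ) x)) = toCone β (Arrow.mk χ) x :=
    (fibreContraction χ).p_s _
  obtain ⟨c, hc⟩ := exists_smul_discrepancy α β hs
  -- On the zero vector the scalar is arbitrary and could be `0`, so this case is separated and uses
  -- the scalar `1`.
  by_cases h0 : fibreS χ (toCone β (Arrow.mk χ) x) = 0
  · refine ⟨1, one_ne_zero, ?_⟩
    rw [h0, ← map_zero (discrepancy α β (fibre χ))] at h1
    rw [h0, map_zero] at hps
    rw [h2, (discrepancy_bijective α β _).1 h1, map_zero, one_smul, ← hps]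
  · have hc0 : c ≠ 0 := by
      rintro rfl
      rw [zero_smul, ← map_zero (discrepancy α β (fibre χ))] at hc
      exact h0 ((discrepancy_bijective α β _).1 hc)
    refine ⟨c⁻¹, inv_ne_zero hc0, ?_⟩
    have h3 : y = c⁻¹ • fibreS χ (toCone β (Arrow.mk χ) x) := by
      apply (discrepancy_bijective α β _).1
      rw [h1, map_smul, hc, inv_smul_smul₀ hc0]
    rw [h2, h3, map_smul, hps]
    rfl

/-- After identifying source and target through `β`, the linear part multiplies homogeneous elements
by nonzero scalars and is therefore bijective, whatever the discrepancy is. -/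
theorem isIso_coneComparison : IsIso (coneComparison α β χ) := by
  refine LInfAlg.isIso_of_linearPart ?_
  let e : (F.obj (Arrow.mk χ)).carrier ≃ₗ[K] ((coneFunctor K).obj (Arrow.mk χ)).carrier :=
    LinearEquiv.ofBijective _ (toCone_bijective β (Arrow.mk χ))
  let f : (F.obj (Arrow.mk χ)).carrier →ₗ[K] ((coneFunctor K).obj (Arrow.mk χ)).carrier :=
    LInfAlg.linearPart (coneComparison α β χ)
  have h : Function.Bijective (e.symm.toLinearMap ∘ₗ f) :=
    bijective_of_smul (gr := (F.obj (Arrow.mk χ)).gr) fun i x hx => by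
      obtain ⟨c, h0, hc⟩ := linearPart_coneComparison_of_mem α β χ hx
      refine ⟨c, h0, ?_⟩
      refine (congrArg e.symm hc).trans ?_
      rw [map_smul]
      exact congrArg (c • ·) (e.symm_apply_apply x)
  exact (Function.Bijective.of_comp_iff' e.symm.bijective f).1 h

/-- The commutativity of the triangles determines the functor on objects up to isomorphism. -/
theorem nonempty_iso_coneLInf (α : toArrow K ⋙ F ≅ quillen K)
    (β : F ⋙ LInfAlg.forget K ≅ coneFunctor K) : Nonempty (F.obj (Arrow.mk χ) ≅ (coneLInf K).obj (Arrow.mk χ)) :=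
  haveI := isIso_coneComparison α β χ
  ⟨asIso (coneComparison α β χ)⟩

end uniqueness

end DGLA

end LInf

end

/-- `α` and `β` are the two commuting triangles; `α` consists of linear `L_∞`-isomorphisms whose
linear part is, via `β`, the canonical identification of `C_{L → 0} = L ⊕ 0` with `L`. In the
uniqueness clause it suffices that both triangles commute up to some natural isomorphism. -/
theorem theorem1 (K : Type u) [Field K] [CharZero K] :
    ∃ Ct : Arrow (LInf.DGLA.{u, v} K) ⥤ LInf.LInfAlg.{u, v} K,
      (∃ (α : LInf.DGLA.toArrow K ⋙ Ct ≅ LInf.DGLA.quillen K)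
          (β : Ct ⋙ LInf.LInfAlg.forget K ≅ LInf.DGLA.coneFunctor K),
        ∀ L : LInf.DGLA.{u, v} K, LInf.LInfAlg.IsLinear (α.hom.app L) ∧
          ∀ x, LInf.LInfAlg.linearPart (α.hom.app L) x =
            LInf.DGLA.coneToZero L
              (LInf.DG.Hom.toLin (β.hom.app ((LInf.DGLA.toArrow K).obj L)) x)) ∧
      ∀ F : Arrow (LInf.DGLA.{u, v} K) ⥤ LInf.LInfAlg.{u, v} K,
        Nonempty (LInf.DGLA.toArrow K ⋙ F ≅ LInf.DGLA.quillen K) →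
        Nonempty (F ⋙ LInf.LInfAlg.forget K ≅ LInf.DGLA.coneFunctor K) →
        ∀ χ : Arrow (LInf.DGLA.{u, v} K), Nonempty (F.obj χ ≅ Ct.obj χ) := by
  refine ⟨LInf.DGLA.coneLInf K, ⟨LInf.DGLA.coneLInfToArrowIso K, LInf.DGLA.coneLInfForgetIso K,
    fun L => ⟨LInf.DGLA.isLinear_coneLInfToZero L, LInf.DGLA.linearPart_coneLInfToZero L⟩⟩, ?_⟩
  rintro F ⟨α⟩ ⟨β⟩ χ
  exact LInf.DGLA.nonempty_iso_coneLInf χ.hom α β
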